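/- Let $(X,\omega,J,\Omega)$ be a Calabi-Yau manifold of complex dimension $n$: $(X,\omega)$ is a symplectic manifold, $J$ is an $\omega$-compatible integrable complex structure, and $\Omega$ is a nowhere vanishing holomorphic volume form. Let $L$ be a connected oriented smooth $n$-manifold (not necessarily compact) and $S\subset L$ a finite subset, and let $\pi:\widetilde L_S\to L$ be the oriented blowup of $L$ at $S$. *Definitions.* A continuous map $\Psi$ from $L$ to a manifold is *cone-smooth* (with respect to $S$) if $\Psi\circ\pi$ is smooth on $\widetilde L_S$. For $p\in L$ its *cone-derivative* $d\Psi_p:T_pL\to T_{\Psi(p)}X$ is the $1$-homogeneous map given by the one-sided derivatives along rays out of $p$; it is smooth on $T_pL\setminus\{0\}$, and it is the usual differential if $p\notin S$. The map $\Psi:L\to X$ is a *cone-immersion* if, moreover, it is an immersion on $L\setminus S$ and $d\Psi_p|_{T_pL\setminus\{0\}}$ is an immersion for $p\in S$. A *cone-diffeomorphism* of $(L,S)$ is a cone-smooth map $L\to L$ that fixes every point of $S$, restricts to a diffeomorphism of $L\setminus S$, and whose cone-derivatives at the points $p\in S$ restrict to diffeomorphisms of $T_pL\setminus\{0\}$.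 A *cone-immersed submanifold* $\Lambda=[(\Psi,S)]$ of $X$ is the orbit of a cone-immersion $\Psi$ under composition with cone-diffeomorphisms. It is *smoothly embedded* if the orbit contains a smooth embedding $L\to X$. It is *Lagrangian* if $\Psi^*\omega=0$ on $L\setminus S$, and *positive* if, moreover, $\operatorname{Re}\Omega$ is positive on the oriented tangent spaces $d\Psi_x(T_xL)$, $x\in L\setminus S$, and on the oriented limit tangent spaces $d(d\Psi_p)_v(T_pL)$, $p\in S$, $0\neq v\in T_pL$. A *geodesic of positive Lagrangians* is a path $\Lambda_t=[(\Psi_t,S)]$, $t\in[0,1]$, of cone-immersed positive Lagrangians with $\Psi_t(S)=C_0$ for a fixed finite set $C_0\subset X$, where $(t,\tilde x)\mapsto\Psi_t(\pi(\tilde x))$ is smooth on $[0,1]\times\widetilde L_S$, the lifting $(\Psi_t)_t$ is *horizontal*, i.e. $i_{\frac{d}{dt}\Psi_t}\operatorname{Re}\Omega=0$ on $L\setminus S$, and there is a time-independent cone-smooth function $h:L\to\mathbb R$ with $\omega(\tfrac{d}{dt}\Psi_t,d\Psi_t(\cdot))=dh$ on $L\setminus S$ for all $t$. Its *critical locus*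 is $\bigcap_{t\in[0,1]}\Psi_t(L)\subset X$. If $\Lambda_0$ and $\Lambda_1$ are embedded, then for every $q$ in the critical locus there is a unique $p\in L$ with $\Psi_t(p)=q$ for all $t\in[0,1]$; the *tangent cone* of $\Lambda_t$ at $q$ is $TC_{\hat q_t}\Lambda_t:=(d\Psi_t)_p(T_pL)\subset T_qX$. The geodesic is *of regularity $C^{1,1}$ in a neighborhood of $q$* if there are a neighborhood $U$ of $q$ in $X$ and a family of maps $\Phi_t:L\to X$, with $\Phi_t$ representing $\Lambda_t$ for every $t\in[0,1]$, such that near every point $(t,x)\in[0,1]\times L$ with $\Phi_t(x)\in U$ the map $(t,x)\mapsto\Phi_t(x)$ is $C^1$ with Lipschitz first derivatives in local charts. **Lemma.** Let $(\Lambda_t)_{t\in[0,1]}$ be a geodesic of positive Lagrangians in $X$ whose endpoints $\Lambda_0$ and $\Lambda_1$ are smoothly embedded, and let $q$ be a point of its critical locus. If the tangent cone $TC_{\hat q_t}\Lambda_t$ is a linear subspace of $T_qX$ for every $t\in[0,1]$, then the geodesic $(\Lambda_t)_t$ is of regularity $C^{1,1}$ in a neighborhood of $q$. -/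

import Mathlib

open Set Topology
open scoped Manifold ContDiff NNReal

noncomputable section

namespace PosLag

/-! ### Differential forms on manifolds -/

section Forms

variable {𝕜 : Type*} [NontriviallyNormedField 𝕜]
  {V : Type*} [NormedAddCommGroup V] [NormedSpace 𝕜 V]
  {G : Type*} [NormedAddCommGroup G] [NormedSpace 𝕜 G]
  {M : Type*} [TopologicalSpace M] [ChartedSpace V M]

/-- The pull-back of a `k`-form `α` on `M` by the inverse of the chart around `x₀`: a form on the
open subset `(chartAt V x₀).target` of the model space (only its values there are meaningful). -/
def chartForm {k : ℕ} (α : (x : M) → TangentSpace 𝓘(𝕜, V) x [⋀^Fin k]→L[𝕜] G)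
    (x₀ : M) (y : V) : V [⋀^Fin k]→L[𝕜] G :=
  (α ((chartAt V x₀).symm y)).compContinuousLinearMap
    (mfderiv 𝓘(𝕜, V) 𝓘(𝕜, V) (chartAt V x₀).symm y)

end Forms

/-! ### Calabi-Yau manifolds -/

section CalabiYau

variable (n : ℕ)
  (E : Type*) [NormedAddCommGroup E] [NormedSpace ℂ E]
  (X : Type*) [TopologicalSpace X] [ChartedSpace E X]

/-- The complex structure `J` of a complex manifold: multiplication by `i` on tangent spaces.
It is well defined on tangent vectors because the chart changes are holomorphic. -/
def cxJ {E : Type*} [NormedAddCommGroup E] [NormedSpace ℂ E]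
    {X : Type*} [TopologicalSpace X] [ChartedSpace E X] (x : X)
    (v : TangentSpace 𝓘(ℝ, E) x) : TangentSpace 𝓘(ℝ, E) x :=
  (Complex.I • (show E from v) : E)

/-- A Calabi-Yau structure on a complex manifold `X` of complex dimension `n`: a symplectic form
compatible with the complex structure, and a nowhere vanishing holomorphic volume form. -/
structure CalabiYau where
  /-- the symplectic form -/
  sympl : (x : X) → TangentSpace 𝓘(ℝ, E) x [⋀^Fin 2]→L[ℝ] ℝ
  sympl_smooth : ∀ x₀ : X, ContDiffOn ℝ ∞ (chartForm sympl x₀) (chartAt E x₀).target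
  sympl_closed : ∀ x₀ : X, ∀ y ∈ (chartAt E x₀).target, extDeriv (chartForm sympl x₀) y = 0
  sympl_invariant : ∀ (x : X) (u v : TangentSpace 𝓘(ℝ, E) x),
    sympl x ![cxJ x u, cxJ x v] = sympl x ![u, v]
  sympl_positive : ∀ (x : X) (u : TangentSpace 𝓘(ℝ, E) x), u ≠ 0 → 0 < sympl x ![u, cxJ x u]
  /-- the holomorphic volume form -/
  holVol : (x : X) → TangentSpace 𝓘(ℂ, E) x [⋀^Fin n]→L[ℂ] ℂ
  holVol_holomorphic : ∀ x₀ : X,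
    DifferentiableOn ℂ (chartForm holVol x₀) (chartAt E x₀).target
  holVol_ne_zero : ∀ x : X, holVol x ≠ 0

variable {n E X}

/-- The real part of the holomorphic volume form, evaluated on real tangent vectors. -/
def CalabiYau.reVol (Y : CalabiYau n E X) (x : X) (v : Fin n → TangentSpace 𝓘(ℝ, E) x) : ℝ :=
  (Y.holVol x v).re

end CalabiYau

/-! ### Cone-smooth maps -/

section Cone

variable {V : Type*} [NormedAddCommGroup V] [NormedSpace ℝ V]
  {M : Type*} [TopologicalSpace M] [ChartedSpace V M]
  {W : Type*} [NormedAddCommGroup W] [NormedSpace ℝ W]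
  {N : Type*} [TopologicalSpace N] [ChartedSpace W N]

/-- Polar coordinates around `p`: `(s, v) ↦ p + s v` in the chart around `p`. For `s ≥ 0` and
`v ≠ 0` this is the projection of the oriented blowup of `M` at `p` to `M`, precomposed with the
surjective submersion `(s, v) ↦ (s ‖v‖, [v])` onto the collar `[0, ε) × ℙ⁺(T_p M)` of the
exceptional sphere. -/
def polar (p : M) (s : ℝ) (v : V) : M :=
  (chartAt V p).symm (chartAt V p p + s • v)

/-- The domain of polar coordinates of radius `ε`; the exceptional sphere is `s = 0`. -/
def polarDomain (V : Type*) [NormedAddCommGroup V] (ε : ℝ) : Set (ℝ × V) :=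
  {z | 0 ≤ z.1 ∧ z.2 ≠ 0 ∧ z.1 * ‖z.2‖ < ε}

variable (V W)

/-- `f` is cone-smooth at `p`: its composition with the blowup projection is smooth near the
exceptional sphere over `p`, up to the boundary. -/
def ConeSmoothAt (f : M → N) (p : M) : Prop :=
  ∃ ε > 0, ContMDiffOn 𝓘(ℝ, ℝ × V) 𝓘(ℝ, W) ∞
    (fun z : ℝ × V => f (polar p z.1 z.2)) (polarDomain V ε)

/-- The cone-derivative of `f` at `p`: the one-sided derivative of `f` along rays out of `p`. -/
def coneDeriv (f : M → N) (p : M) (v : TangentSpace 𝓘(ℝ, V) p) : TangentSpace 𝓘(ℝ, W) (f p) :=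
  mfderivWithin 𝓘(ℝ, ℝ) 𝓘(ℝ, W) (fun s : ℝ => f (polar p s (show V from v))) (Ici 0) 0 (1 : ℝ)

/-- The derivative of the cone-derivative at `v ≠ 0`. It only depends on the point `[v]` of the
exceptional sphere, where it is the value of the blowup differential of `f`. -/
def blowupDeriv (f : M → N) (p : M) (v : TangentSpace 𝓘(ℝ, V) p) :
    TangentSpace 𝓘(ℝ, V) p →L[ℝ] TangentSpace 𝓘(ℝ, W) (f p) :=
  fderiv ℝ (E := V) (F := W) (coneDeriv V W f p) v

/-- `(f, S)` is a cone-smooth map. -/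
structure IsConeSmooth (S : Set M) (f : M → N) : Prop where
  continuous : Continuous f
  smooth : ContMDiffOn 𝓘(ℝ, V) 𝓘(ℝ, W) ∞ f Sᶜ
  coneSmooth : ∀ p ∈ S, ConeSmoothAt V W f p

/-- `(f, S)` is a cone-immersion. -/
structure IsConeImmersion (S : Set M) (f : M → N) : Prop extends IsConeSmooth V W S f where
  immersive : ∀ x ∉ S, Function.Injective (mfderiv 𝓘(ℝ, V) 𝓘(ℝ, W) f x)
  coneImmersive : ∀ p ∈ S, ∀ v : TangentSpace 𝓘(ℝ, V) p, v ≠ 0 →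
    Function.Injective (blowupDeriv V W f p v)

/-- `φ` is a cone-diffeomorphism of `(M, S)`: it fixes the points of `S`, restricts to a
diffeomorphism of `M ∖ S`, and its cone-derivatives at the points `p` of `S` restrict to
diffeomorphisms of `T_p M ∖ 0`. -/
structure IsConeDiffeo (S : Set M) (φ : M → M) : Prop extends IsConeSmooth V V S φ where
  fix : ∀ p ∈ S, φ p = p
  mapsTo : MapsTo φ Sᶜ Sᶜ
  exists_inverse : ∃ χ : M → M, MapsTo χ Sᶜ Sᶜ ∧ InvOn χ φ Sᶜ Sᶜ ∧
    ContMDiffOn 𝓘(ℝ, V) 𝓘(ℝ, V) ∞ χ Sᶜ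
  coneDeriv_ne_zero : ∀ p ∈ S, MapsTo (α := V) (β := V) (coneDeriv V V φ p) {0}ᶜ {0}ᶜ
  exists_coneDeriv_inverse : ∀ p ∈ S, ∃ B : V → V, MapsTo B {0}ᶜ {0}ᶜ ∧
    InvOn B (coneDeriv V V φ p) {0}ᶜ {0}ᶜ ∧ ContDiffOn ℝ ∞ B {0}ᶜ

/-- The cone-immersed submanifold represented by the cone-immersion `(f, S)`, as the set of all
its representatives: the orbit of `f` under the cone-diffeomorphisms of a connected `(M, S)`. -/
def coneOrbit (S : Set M) (f : M → N) : Set (M → N) :=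
  {g | ∃ φ : M → M, IsConeDiffeo V S φ ∧ g = f ∘ φ}

/-- A (cone-immersed) submanifold is smoothly embedded if it is represented by a smooth
embedding. -/
def IsSmoothlyEmbedded (K : Set (M → N)) : Prop :=
  ∃ f ∈ K, Manifold.IsSmoothEmbedding 𝓘(ℝ, V) 𝓘(ℝ, W) ∞ f

/-- The tangent cone at the point `p`, as a subset of the tangent space of the target. -/
def tangentCone (f : M → N) (p : M) : Set (TangentSpace 𝓘(ℝ, W) (f p)) :=
  range (coneDeriv V W f p)

/-- The family of maps `(Ψ t, S)`, `t ∈ [0, 1]`, is cone-smooth: it is smooth as a map on the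
product of `[0, 1]` and the oriented blowup of `M` at `S`. -/
structure IsConeSmoothFamily (S : Set M) (Ψ : ℝ → M → N) : Prop where
  smooth : ContMDiffOn (𝓘(ℝ, ℝ).prod 𝓘(ℝ, V)) 𝓘(ℝ, W) ∞
    (fun z : ℝ × M => Ψ z.1 z.2) (Icc 0 1 ×ˢ Sᶜ)
  coneSmooth : ∀ p ∈ S, ∃ ε > 0, ContMDiffOn 𝓘(ℝ, ℝ × ℝ × V) 𝓘(ℝ, W) ∞
    (fun z : ℝ × ℝ × V => Ψ z.1 (polar p z.2.1 z.2.2)) (Icc 0 1 ×ˢ polarDomain V ε)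

/-- The time derivative at `t` of a family of maps parametrized by `[0, 1]`. -/
def timeDeriv (Ψ : ℝ → M → N) (t : ℝ) (x : M) : TangentSpace 𝓘(ℝ, W) (Ψ t x) :=
  mfderivWithin 𝓘(ℝ, ℝ) 𝓘(ℝ, W) (fun τ : ℝ => Ψ τ x) (Icc 0 1) t (1 : ℝ)

/-- The domain `([0, 1] ∩ (t₀ - r, t₀ + r)) × B(x₀, r)` in the chart around `x₀`. -/
def localDomain (t₀ : ℝ) (x₀ : M) (r : ℝ) : Set (ℝ × V) :=
  (Icc 0 1 ∩ Metric.ball t₀ r) ×ˢ Metric.ball (chartAt V x₀ x₀) r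

/-- The family `Ψ` in the charts around `x₀` and `Ψ t₀ x₀`. -/
def localFamily (Ψ : ℝ → M → N) (t₀ : ℝ) (x₀ : M) (z : ℝ × V) : W :=
  chartAt W (Ψ t₀ x₀) (Ψ z.1 ((chartAt V x₀).symm z.2))

/-- The map `(t, x) ↦ Ψ t x` on `[0, 1] × M` is of class `C^{1,1}` near `(t₀, x₀)`: in local
charts it is continuously differentiable with Lipschitz derivative. -/
def IsC11At (Ψ : ℝ → M → N) (t₀ : ℝ) (x₀ : M) : Prop :=
  ∃ r > 0, Metric.ball (chartAt V x₀ x₀) r ⊆ (chartAt V x₀).target ∧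
    (∀ z ∈ localDomain V t₀ x₀ r,
      Ψ z.1 ((chartAt V x₀).symm z.2) ∈ (chartAt W (Ψ t₀ x₀)).source) ∧
    ContDiffOn ℝ 1 (localFamily V W Ψ t₀ x₀) (localDomain V t₀ x₀ r) ∧
    ∃ K : ℝ≥0, LipschitzOnWith K
      (fderivWithin ℝ (localFamily V W Ψ t₀ x₀) (localDomain V t₀ x₀ r)) (localDomain V t₀ x₀ r)

end Cone

/-! ### Geodesics of positive Lagrangians -/

section Geodesic

variable {n : ℕ}
  {E : Type*} [NormedAddCommGroup E] [NormedSpace ℂ E]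
  {X : Type*} [TopologicalSpace X] [ChartedSpace E X]
  {L : Type*} [TopologicalSpace L] [ChartedSpace (EuclideanSpace ℝ (Fin n)) L]

/-- An orientation of the `n`-manifold `L`, given by a nowhere vanishing continuous `n`-form. A
frame is positively oriented if the form is positive on it. -/
structure OrientationForm (n : ℕ) (L : Type*) [TopologicalSpace L]
    [ChartedSpace (EuclideanSpace ℝ (Fin n)) L] where
  /-- the volume form -/
  form : (x : L) → TangentSpace 𝓘(ℝ, EuclideanSpace ℝ (Fin n)) x [⋀^Fin n]→L[ℝ] ℝ
  continuous : ∀ x₀ : L, ContinuousOn (chartForm form x₀)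
    (chartAt (EuclideanSpace ℝ (Fin n)) x₀).target
  ne_zero : ∀ x : L, form x ≠ 0

/-- The differential of a map `L → X`. -/
abbrev tangentMapAt (n : ℕ) (E : Type*) [NormedAddCommGroup E] [NormedSpace ℂ E]
    {X : Type*} [TopologicalSpace X] [ChartedSpace E X]
    {L : Type*} [TopologicalSpace L] [ChartedSpace (EuclideanSpace ℝ (Fin n)) L]
    (f : L → X) (x : L) :
    TangentSpace 𝓘(ℝ, EuclideanSpace ℝ (Fin n)) x →L[ℝ] TangentSpace 𝓘(ℝ, E) (f x) :=
  mfderiv 𝓘(ℝ, EuclideanSpace ℝ (Fin n)) 𝓘(ℝ, E) f x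

/-- The cone-immersion `(f, S)` is Lagrangian (it is an immersion of half the dimension). -/
def IsLagrangian (Y : CalabiYau n E X) (S : Set L) (f : L → X) : Prop :=
  ∀ x ∉ S, ∀ u v, Y.sympl (f x) ![tangentMapAt n E f x u, tangentMapAt n E f x v] = 0

/-- The Lagrangian cone-immersion `(f, S)` is positive: the real part of the holomorphic volume
form is positive on the tangent spaces at smooth points and at all points of the exceptional
spheres over the cone points. -/
structure IsPositive (Y : CalabiYau n E X) (o : OrientationForm n L) (S : Set L) (f : L → X) :
    Prop where
  smooth_locus : ∀ x ∉ S, ∀ w, 0 < o.form x w →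
    0 < Y.reVol (f x) (fun i => tangentMapAt n E f x (w i))
  cone_locus : ∀ p ∈ S, ∀ v : TangentSpace 𝓘(ℝ, EuclideanSpace ℝ (Fin n)) p, v ≠ 0 →
    ∀ w, 0 < o.form p w →
      0 < Y.reVol (f p) (fun i => blowupDeriv (EuclideanSpace ℝ (Fin n)) E f p v (w i))

variable (Y : CalabiYau n E X) (o : OrientationForm n L) (S : Finset L) (C₀ : Set X)

/-- A cone-smooth geodesic `Λ_t = [(Ψ t, S)]`, `t ∈ [0, 1]`, of oriented cone-immersed positive
Lagrangians of type `(L, S)` with static cone locus `C₀`, given by a horizontal lifting `Ψ` and the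
Hamiltonian `h = h_t ∘ Ψ t` with respect to it. (`Ψ t` is only meaningful for `t ∈ [0, 1]`.) -/
structure PositiveGeodesic where
  /-- the horizontal lifting -/
  lift : ℝ → L → X
  coneImmersion : ∀ t ∈ Icc (0 : ℝ) 1,
    IsConeImmersion (EuclideanSpace ℝ (Fin n)) E (S : Set L) (lift t)
  coneLocus : ∀ t ∈ Icc (0 : ℝ) 1, lift t '' (S : Set L) = C₀
  lagrangian : ∀ t ∈ Icc (0 : ℝ) 1, IsLagrangian Y (S : Set L) (lift t)
  positive : ∀ t ∈ Icc (0 : ℝ) 1, IsPositive Y o (S : Set L) (lift t)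
  smoothFamily : IsConeSmoothFamily (EuclideanSpace ℝ (Fin n)) E (S : Set L) lift
  /-- the contraction of the real volume form with the time derivative vanishes on `L ∖ S` -/
  horizontal : ∀ t ∈ Icc (0 : ℝ) 1, ∀ x ∉ S,
    ∀ (w : Fin n → TangentSpace 𝓘(ℝ, EuclideanSpace ℝ (Fin n)) x) (i : Fin n),
      Y.reVol (lift t x)
        (Function.update (fun j => tangentMapAt n E (lift t) x (w j)) i (timeDeriv E lift t x)) = 0
  /-- the time-independent Hamiltonian -/
  ham : L → ℝ
  ham_coneSmooth : IsConeSmooth (EuclideanSpace ℝ (Fin n)) ℝ (S : Set L) ham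
  /-- the time derivative of `Λ_t`, i.e. the contraction of the symplectic form with the time
  derivative of the lifting, is the differential of the Hamiltonian -/
  deriv_eq : ∀ t ∈ Icc (0 : ℝ) 1, ∀ x ∉ S,
    ∀ v : TangentSpace 𝓘(ℝ, EuclideanSpace ℝ (Fin n)) x,
      Y.sympl (lift t x) ![timeDeriv E lift t x, tangentMapAt n E (lift t) x v] =
        mfderiv 𝓘(ℝ, EuclideanSpace ℝ (Fin n)) 𝓘(ℝ, ℝ) ham x v

namespace PositiveGeodesic

variable {Y o S C₀}

/-- The cone-immersed Lagrangian `Λ_t`. -/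
def submanifold (Λ : PositiveGeodesic Y o S C₀) (t : ℝ) : Set (L → X) :=
  coneOrbit (EuclideanSpace ℝ (Fin n)) (S : Set L) (Λ.lift t)

/-- The critical locus: the intersection of the images of all the `Λ_t`. -/
def critLocus (Λ : PositiveGeodesic Y o S C₀) : Set X :=
  ⋂ t ∈ Icc (0 : ℝ) 1, range (Λ.lift t)

/-- The geodesic is of class `C^{1,1}` in a neighborhood of `q`: it has a lifting that is of class
`C^{1,1}` as a map of `(t, x) ∈ [0, 1] × L` wherever it takes values in some neighborhood of `q`. -/
def IsC11Near (Λ : PositiveGeodesic Y o S C₀) (q : X) : Prop :=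
  ∃ U ∈ 𝓝 q, ∃ Φ : ℝ → L → X, (∀ t ∈ Icc (0 : ℝ) 1, Φ t ∈ Λ.submanifold t) ∧
    ∀ t ∈ Icc (0 : ℝ) 1, ∀ x : L, Φ t x ∈ U → IsC11At (EuclideanSpace ℝ (Fin n)) E Φ t x

end PositiveGeodesic

end Geodesic

end PosLag

end

namespace PosLag

open Filter

/-! ### Inverse functions on sets with boundary -/

section Inverse

variable {G H : Type*} [NormedAddCommGroup G] [NormedSpace ℝ G] [NormedAddCommGroup H]
  [NormedSpace ℝ H]

/-! The critical point is static. Let `𝒜` be the set of pairs `(t, x)` with `Λ.lift t x = q`. If no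
single `p` lay over `q` for all times, the velocity at every point of `𝒜` would be transverse to the
Lagrangian. Cone points do not move, since their images lie in the finite set `C₀`. At any other
point, a tangent velocity forces `dh = 0`. As `h` is independent of time, the velocity then lies at
every time in the symplectic complement of the tangent space, which is the tangent space itself. A
horizontal tangent velocity is zero by positivity, so the point would be static after all.
Transversality makes `𝒜` discrete, hence countable, although it projects onto `[0, 1]`
(`exists_forall_lift_eq`).

Away from `S` the lifting is already smooth, so the case that matters is `p ∈ S`. Let `Ψ 0 ∘ φ` be a
smooth embedding representing the initial Lagrangian. In polar coordinates at `p`, two divisions by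
the radial coordinate give `Ψ t (φ (p + s v)) = q + s A(t, v) + s² k(t, s, v)` in charts, with `k`
smooth on the blowup. The map `A t` is positively homogeneous and immersive off the origin, it fills
a linear subspace, and `A 0` is linear. Hence `A t = B t ∘ C t` with `B t` linear and `C t` a
homogeneous isotopy of `V ∖ 0` starting at the identity (`exists_isHomogIsotopy`,
`exists_linear_polar_expansion`). Each `C t` is surjective. It is injective because the set of times
with injective `C t` is open and closed and contains `0` (`IsHomogIsotopy.injOn`).

Up to a constant factor `c`, the inverse of `C t` is realized as the cone-derivative at `p` of a
cone-diffeomorphism `θ t` supported near `p` (`IsHomogIsotopy.exists_cutoff_inverse`,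
`IsHomogIsotopy.exists_coneDiffeo`). After composition with `θ t` the first order term becomes the
linear map `c • B t`. The remainder is still `s²` times a smooth function on the blowup. Its
derivative is `s` times such a function, and these are Lipschitz across the origin: directions jump
there, but the factor `s` compensates (`exists_hasFDerivWithinAt_of_polar_sq`). This is exactly
`C^{1,1}`. Finally, the neighborhood of `q` is chosen to avoid the rest of `C₀`, so that by
injectivity of `Λ.lift 0` no other cone point is seen. -/

theorem contDiffOn_of_rightInverse [CompleteSpace G] {f : G → H} {g : H → G} {s : Set G}
    {t : Set H} (hs : UniqueDiffOn ℝ s) (ht : UniqueDiffOn ℝ t) (hf : ContDiffOn ℝ ∞ f s)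
    (hg : ContinuousOn g t) (hgt : MapsTo g t s) (hfg : ∀ y ∈ t, f (g y) = y)
    (hinv : ∀ x ∈ s, ∃ e : G ≃L[ℝ] H, (e : G →L[ℝ] H) = fderivWithin ℝ f s x) :
    ContDiffOn ℝ ∞ g t := by
  have hder : ∀ y ∈ t, HasFDerivWithinAt g
      (ContinuousLinearMap.inverse (fderivWithin ℝ f s (g y))) t y := by
    intro y hy
    obtain ⟨e, he⟩ := hinv (g y) (hgt hy)
    rw [← he, ContinuousLinearMap.inverse_equiv]
    refine HasFDerivWithinAt.of_local_left_inverse (t := s) (f := f) ?_ ?_ hy ?_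
    · exact (hg y hy).tendsto_nhdsWithin hgt
    · rw [he]
      exact (hf.differentiableOn (by simp) (g y) (hgt hy)).hasFDerivWithinAt
    · filter_upwards [self_mem_nhdsWithin] with z hz using hfg z hz
  -- Bootstrap: the derivative of `g` is inversion composed with `f'` and `g`, so each order of
  -- smoothness of `g` yields the next.
  have key : ∀ m : ℕ, ContDiffOn ℝ m g t := by
    intro m
    induction m with
    | zero => simpa using hg
    | succ m ih =>
      have : ((m + 1 : ℕ) : WithTop ℕ∞) = (m : WithTop ℕ∞) + 1 := by push_cast; rfl
      rw [this, contDiffOn_succ_iff_fderivWithin ht]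
      refine ⟨fun y hy => (hder y hy).differentiableWithinAt, by simp, ?_⟩
      have h1 : ContDiffOn ℝ m (fun y => ContinuousLinearMap.inverse (fderivWithin ℝ f s (g y)))
          t := by
        intro y hy
        obtain ⟨e, he⟩ := hinv (g y) (hgt hy)
        have h2 : ContDiffAt ℝ m (ContinuousLinearMap.inverse (R := ℝ))
            (fderivWithin ℝ f s (g y)) := by
          rw [← he]; exact contDiffAt_map_inverse e
        have h3 : ContDiffOn ℝ m (fderivWithin ℝ f s) s :=
          hf.fderivWithin hs (by exact_mod_cast le_top)
        exact h2.comp_contDiffWithinAt y ((h3.comp ih hgt) y hy)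
      exact h1.congr fun y hy => (hder y hy).fderivWithin (ht y hy)
  exact contDiffOn_infty.2 key

/-- A family of maps, `C¹` in the space variable with jointly continuous derivative, is uniformly
close to its derivative. -/
theorem exists_approximatesLinearOn {T : Type*} [TopologicalSpace T] {I : Set T} {O : Set G}
    {c : T → G → H} {D : T × G → G →L[ℝ] H} (hO : IsOpen O)
    (hc : ∀ t ∈ I, ∀ v ∈ O, HasFDerivAt (c t) (D (t, v)) v) (hD : ContinuousOn D (I ×ˢ O))
    {t₀ : T} (ht₀ : t₀ ∈ I) {v₀ : G} (hv₀ : v₀ ∈ O) {κ : ℝ≥0} (hκ : 0 < κ) :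
    ∃ ε > 0, Metric.closedBall v₀ ε ⊆ O ∧
      ∀ᶠ t in 𝓝[I] t₀, ApproximatesLinearOn (c t) (D (t₀, v₀)) (Metric.closedBall v₀ ε) κ := by
  have h1 : ∀ᶠ z in 𝓝[I ×ˢ O] (t₀, v₀), dist (D z) (D (t₀, v₀)) < κ :=
    (hD (t₀, v₀) ⟨ht₀, hv₀⟩) (Metric.ball_mem_nhds _ (by exact_mod_cast hκ))
  rw [nhdsWithin_prod_eq, hO.nhdsWithin_eq hv₀] at h1
  obtain ⟨pa, ha, pb, hb, hab⟩ := Filter.eventually_prod_iff.1 h1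
  obtain ⟨ε, hε, hεs⟩ := Metric.nhds_basis_closedBall.mem_iff.1
    (Filter.inter_mem hb (hO.mem_nhds hv₀))
  refine ⟨ε, hε, fun x hx => (hεs hx).2, ?_⟩
  filter_upwards [ha, self_mem_nhdsWithin] with t hta htI
  intro x hx y hy
  have := (convex_closedBall v₀ ε).norm_image_sub_le_of_norm_hasFDerivWithin_le'
    (f := c t) (f' := fun v => D (t, v)) (φ := D (t₀, v₀)) (C := κ)
    (fun v hv => (hc t htI v (hεs hv).2).hasFDerivWithinAt)
    (fun v hv => by
      have := (hab hta (hεs hv).1).le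
      rwa [dist_eq_norm] at this) hy hx
  exact this

variable {T : Type*} [TopologicalSpace T] {I : Set T} {O : Set G}
    {c : T → G → H} {D : T × G → G →L[ℝ] H}

/-- On a ball independent of `t`, every `c t` differs from the isomorphism `e` by a map with
Lipschitz constant below `‖e⁻¹‖⁻¹`. The common ball is what the compactness argument for global
injectivity needs. -/
theorem exists_eventually_injOn (hO : IsOpen O)
    (hc : ∀ t ∈ I, ∀ v ∈ O, HasFDerivAt (c t) (D (t, v)) v) (hD : ContinuousOn D (I ×ˢ O))
    {t₀ : T} (ht₀ : t₀ ∈ I) {v₀ : G} (hv₀ : v₀ ∈ O) (e : G ≃L[ℝ] H)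
    (he : (e : G →L[ℝ] H) = D (t₀, v₀)) :
    ∃ ε > 0, ∀ᶠ t in 𝓝[I] t₀, InjOn (c t) (Metric.closedBall v₀ ε) := by
  rcases subsingleton_or_nontrivial G with hG | hG
  · exact ⟨1, one_pos, Eventually.of_forall fun t => Set.injOn_of_subsingleton _ _⟩
  have hN : 0 < ‖(e.symm : H →L[ℝ] G)‖₊⁻¹ := inv_pos.2 e.nnnorm_symm_pos
  obtain ⟨κ, hκ, hκ'⟩ := exists_between hN
  obtain ⟨ε, hε, -, h⟩ := exists_approximatesLinearOn hO hc hD ht₀ hv₀ hκ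
  refine ⟨ε, hε, h.mono fun t ht => ?_⟩
  rw [← he] at ht
  exact ht.injOn (Or.inr hκ')

/-- The quantitative inverse function theorem, uniform in `t`: the image of a small ball contains a
ball of fixed radius around `c t v₀`, while this center moves little. -/
theorem eventually_exists_eq [CompleteSpace G] (hO : IsOpen O)
    (hc : ∀ t ∈ I, ∀ v ∈ O, HasFDerivAt (c t) (D (t, v)) v) (hD : ContinuousOn D (I ×ˢ O))
    {t₀ : T} (ht₀ : t₀ ∈ I) {v₀ : G} (hv₀ : v₀ ∈ O) (e : G ≃L[ℝ] H)
    (he : (e : G →L[ℝ] H) = D (t₀, v₀)) (hct : ContinuousWithinAt (fun t => c t v₀) I t₀)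
    {η : ℝ} (hη : 0 < η) :
    ∀ᶠ z in 𝓝[I] t₀ ×ˢ 𝓝 (c t₀ v₀), ∃ v ∈ Metric.closedBall v₀ η, c z.1 v = z.2 := by
  rcases subsingleton_or_nontrivial G with hG | hG
  · have : Subsingleton H := (Equiv.subsingleton_congr e.toEquiv).1 hG
    exact Eventually.of_forall fun z =>
      ⟨v₀, Metric.mem_closedBall_self hη.le, Subsingleton.elim _ _⟩
  have hN : 0 < ‖(e.symm : H →L[ℝ] G)‖₊⁻¹ := inv_pos.2 e.nnnorm_symm_pos
  obtain ⟨κ, hκ, hκ'⟩ := exists_between hN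
  obtain ⟨ε, hε, -, h⟩ := exists_approximatesLinearOn hO hc hD ht₀ hv₀ hκ
  have hκ'' : (0 : ℝ) < (‖(e.symm : H →L[ℝ] G)‖₊ : ℝ)⁻¹ - κ := by
    have : (κ : ℝ) < ((‖(e.symm : H →L[ℝ] G)‖₊⁻¹ : ℝ≥0) : ℝ) := by exact_mod_cast hκ'
    push_cast at this ⊢; linarith
  set μ := min ε η with hμ
  have hμ0 : 0 < μ := lt_min hε hη
  -- The radius that the image is guaranteed to contain. One half is spent on the drift of `c t v₀`,
  -- the other on the distance from the target to `c t₀ v₀`.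
  set ρ := ((‖(e.symm : H →L[ℝ] G)‖₊ : ℝ)⁻¹ - κ) * μ with hρ
  have hρ0 : 0 < ρ := mul_pos hκ'' hμ0
  have h1 : ∀ᶠ t in 𝓝[I] t₀, dist (c t v₀) (c t₀ v₀) < ρ / 2 :=
    hct (Metric.ball_mem_nhds _ (half_pos hρ0))
  have h2 : ∀ᶠ y in 𝓝 (c t₀ v₀), dist y (c t₀ v₀) < ρ / 2 :=
    Metric.ball_mem_nhds _ (half_pos hρ0)
  filter_upwards [(h.and h1).prod_mk h2] with z hz
  obtain ⟨⟨ha, hb⟩, hd⟩ := hz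
  rw [← he] at ha
  have hs := (ha.mono_set (Metric.closedBall_subset_closedBall (min_le_left ε η))
    ).surjOn_closedBall_of_nonlinearRightInverse e.toNonlinearRightInverse hμ0.le Subset.rfl
  have hz2 : z.2 ∈ Metric.closedBall (c z.1 v₀) ρ := by
    rw [Metric.mem_closedBall]
    calc dist z.2 (c z.1 v₀) ≤ dist z.2 (c t₀ v₀) + dist (c z.1 v₀) (c t₀ v₀) :=
          dist_triangle_right _ _ _
      _ ≤ ρ := by linarith
  obtain ⟨v, hv, hve⟩ := hs hz2
  exact ⟨v, Metric.closedBall_subset_closedBall (min_le_right ε η) hv, hve⟩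

end Inverse

/-! ### Smooth dependence of the inverses of a family of maps on time. -/

section FiberwiseInverse

variable {G H : Type*} [NormedAddCommGroup G] [NormedSpace ℝ G] [NormedAddCommGroup H]
  [NormedSpace ℝ H] {I : Set ℝ} {O : Set G} {c : ℝ × G → H}

/-- The derivative in the space variable of a family which is smooth on `I ×ˢ O`. -/
noncomputable def spaceDeriv (c : ℝ × G → H) (I : Set ℝ) (O : Set G) (z : ℝ × G) : G →L[ℝ] H :=
  (fderivWithin ℝ c (I ×ˢ O) z).comp (ContinuousLinearMap.inr ℝ ℝ G)

theorem contDiffOn_spaceDeriv (hI : UniqueDiffOn ℝ I) (hO : IsOpen O)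
    (hc : ContDiffOn ℝ ∞ c (I ×ˢ O)) : ContDiffOn ℝ ∞ (spaceDeriv c I O) (I ×ˢ O) := by
  have := hc.fderivWithin (hI.prod hO.uniqueDiffOn) (m := ∞) le_rfl
  exact this.clm_comp contDiffOn_const

theorem hasFDerivAt_spaceDeriv (hO : IsOpen O) (hc : ContDiffOn ℝ ∞ c (I ×ˢ O)) {t : ℝ}
    (ht : t ∈ I) {v : G} (hv : v ∈ O) :
    HasFDerivAt (fun w => c (t, w)) (spaceDeriv c I O (t, v)) v := by
  have h1 := (hc.differentiableOn (by simp) (t, v) ⟨ht, hv⟩).hasFDerivWithinAt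
  have h2 : HasFDerivWithinAt (fun w : G => (t, w)) (ContinuousLinearMap.inr ℝ ℝ G) O v :=
    (hasFDerivAt_prodMk_right t v).hasFDerivWithinAt
  exact (h1.comp v h2 (fun w hw => ⟨ht, hw⟩)).hasFDerivAt (hO.mem_nhds hv)

theorem exists_equiv_of_injective [FiniteDimensional ℝ G] [FiniteDimensional ℝ H]
    (hd : Module.finrank ℝ G = Module.finrank ℝ H) {A : G →L[ℝ] H} (hA : Function.Injective A) :
    ∃ e : G ≃L[ℝ] H, (e : G →L[ℝ] H) = A :=
  ⟨(LinearEquiv.ofInjectiveOfFinrankEq (A : G →ₗ[ℝ] H) hA hd).toContinuousLinearEquiv, by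
    ext x; rfl⟩

/-- The inverse function principle is applied to `(t, v) ↦ (t, c (t, v))`, whose derivative is
triangular. Continuity of `d` comes first: a solution close to the old one exists, and injectivity
on `O` identifies it with `d`. -/
theorem contDiffOn_fiberwise_inverse [FiniteDimensional ℝ G] {c : ℝ × G → G} {U : Set G}
    (hI : UniqueDiffOn ℝ I) (hO : IsOpen O) (hU : IsOpen U)
    (hc : ContDiffOn ℝ ∞ c (I ×ˢ O))
    (hinj : ∀ t ∈ I, ∀ v ∈ O, Function.Injective (spaceDeriv c I O (t, v)))
    (hcinj : ∀ t ∈ I, InjOn (fun v => c (t, v)) O)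
    {d : ℝ × G → G} (hd : ∀ t ∈ I, ∀ u ∈ U, d (t, u) ∈ O ∧ c (t, d (t, u)) = u) :
    ContDiffOn ℝ ∞ d (I ×ˢ U) := by
  have : CompleteSpace G := FiniteDimensional.complete ℝ G
  have hD := (contDiffOn_spaceDeriv hI hO hc).continuousOn
  have hder : ∀ t ∈ I, ∀ v ∈ O, HasFDerivAt (fun w => c (t, w)) (spaceDeriv c I O (t, v)) v :=
    fun t ht v hv => hasFDerivAt_spaceDeriv hO hc ht hv
  have hcont : ContinuousOn d (I ×ˢ U) := by
    rintro ⟨t₀, u₀⟩ ⟨ht₀, hu₀⟩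
    simp only at ht₀ hu₀
    obtain ⟨hv₀, hcv⟩ := hd t₀ ht₀ u₀ hu₀
    obtain ⟨e, he⟩ := exists_equiv_of_injective rfl (hinj t₀ ht₀ _ hv₀)
    rw [ContinuousWithinAt, Metric.tendsto_nhds]
    intro η hη
    obtain ⟨η', hη', hη'O⟩ := Metric.nhds_basis_closedBall.mem_iff.1 (hO.mem_nhds hv₀)
    have hct : ContinuousWithinAt (fun t => c (t, d (t₀, u₀))) I t₀ := by
      have : ContinuousOn (fun t => c (t, d (t₀, u₀))) I :=
        hc.continuousOn.comp (by fun_prop) (fun t ht => ⟨ht, hv₀⟩)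
      exact this t₀ ht₀
    have hev := eventually_exists_eq (c := fun t v => c (t, v)) hO hder hD ht₀ hv₀ e he hct
      (lt_min hη' (half_pos hη))
    rw [hcv] at hev
    rw [nhdsWithin_prod_eq]
    have hev2 : ∀ᶠ z in 𝓝[I] t₀ ×ˢ 𝓝[U] u₀, z.1 ∈ I ∧ z.2 ∈ U :=
      Filter.prod_mem_prod self_mem_nhdsWithin self_mem_nhdsWithin
    filter_upwards [hev.filter_mono (Filter.prod_mono le_rfl nhdsWithin_le_nhds), hev2]
      with z hz hz2
    obtain ⟨v, hv, hve⟩ := hz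
    have h3 := hd z.1 hz2.1 z.2 hz2.2
    have hvO : v ∈ O := hη'O (Metric.closedBall_subset_closedBall (min_le_left _ _) hv)
    have : d (z.1, z.2) = v := hcinj z.1 hz2.1 h3.1 hvO (h3.2.trans hve.symm)
    have hz' : d z = v := this
    rw [hz']
    exact (Metric.closedBall_subset_closedBall (min_le_right _ _) hv).trans_lt (half_lt_self hη)
  have hmain : ContDiffOn ℝ ∞ (fun z : ℝ × G => (z.1, d z)) (I ×ˢ U) := by
    refine contDiffOn_of_rightInverse (f := fun z : ℝ × G => (z.1, c z)) (s := I ×ˢ O)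
      (hI.prod hO.uniqueDiffOn) (hI.prod hU.uniqueDiffOn) (contDiffOn_fst.prodMk hc)
      (continuousOn_fst.prodMk hcont) (fun z hz => ⟨hz.1, (hd z.1 hz.1 z.2 hz.2).1⟩)
      (fun z hz => Prod.ext rfl (hd z.1 hz.1 z.2 hz.2).2) ?_
    rintro ⟨t, v⟩ ⟨ht, hv⟩
    have hu : UniqueDiffWithinAt ℝ (I ×ˢ O) (t, v) := (hI t ht).prod (hO.uniqueDiffWithinAt hv)
    have hdc := hc.differentiableOn (by simp) (t, v) ⟨ht, hv⟩
    have hf : fderivWithin ℝ (fun z : ℝ × G => (z.1, c z)) (I ×ˢ O) (t, v) =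
        (ContinuousLinearMap.fst ℝ ℝ G).prod (fderivWithin ℝ c (I ×ˢ O) (t, v)) :=
      (hasFDerivWithinAt_fst.prodMk hdc.hasFDerivWithinAt).fderivWithin hu
    rw [hf]
    refine exists_equiv_of_injective rfl ?_
    rw [injective_iff_map_eq_zero]
    rintro ⟨τ, w⟩ h
    simp only [ContinuousLinearMap.prod_apply, ContinuousLinearMap.coe_fst', Prod.mk_eq_zero] at h
    obtain ⟨rfl, h2⟩ := h
    have : spaceDeriv c I O (t, v) w = 0 := by simpa [spaceDeriv] using h2
    have := (injective_iff_map_eq_zero _).1 (hinj t ht v hv) w this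
    simp [this]
  exact contDiff_snd.comp_contDiffOn hmain

end FiberwiseInverse

/-! ### Parametric integrals and division by the radial coordinate -/

section ParametricIntegral

variable {Z : Type} [NormedAddCommGroup Z] [NormedSpace ℝ Z]

/-- Local convexity of `𝒟` makes the mean value inequality available up to the boundary of the
blowup, where dominated differentiation at interior points is not enough. -/
theorem hasFDerivWithinAt_parametric_integral {W : Type*} [NormedAddCommGroup W] [NormedSpace ℝ W]
    [CompleteSpace W] {𝒟 : Set Z} (hconv : ∀ z ∈ 𝒟, ∃ r > 0, Convex ℝ (Metric.ball z r ∩ 𝒟))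
    {u : Z × ℝ → W} {D : Z × ℝ → Z →L[ℝ] W} (hu : ContinuousOn u (𝒟 ×ˢ Icc 0 1))
    (hD : ContinuousOn D (𝒟 ×ˢ Icc 0 1))
    (hder : ∀ z ∈ 𝒟, ∀ σ ∈ Icc (0 : ℝ) 1, HasFDerivWithinAt (fun y => u (y, σ)) (D (z, σ)) 𝒟 z)
    {z₀ : Z} (hz₀ : z₀ ∈ 𝒟) :
    HasFDerivWithinAt (fun z => ∫ σ in (0 : ℝ)..1, u (z, σ)) (∫ σ in (0 : ℝ)..1, D (z₀, σ))
      𝒟 z₀ := by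
  have hui : ∀ z ∈ 𝒟, IntervalIntegrable (fun σ => u (z, σ)) MeasureTheory.volume 0 1 := by
    intro z hz
    refine ContinuousOn.intervalIntegrable ?_
    rw [uIcc_of_le zero_le_one]
    exact hu.comp (by fun_prop) fun σ hσ => ⟨hz, hσ⟩
  have hDi : IntervalIntegrable (fun σ => D (z₀, σ)) MeasureTheory.volume 0 1 := by
    refine ContinuousOn.intervalIntegrable ?_
    rw [uIcc_of_le zero_le_one]
    exact hD.comp (by fun_prop) fun σ hσ => ⟨hz₀, hσ⟩
  rw [hasFDerivWithinAt_iff_isLittleO, Asymptotics.isLittleO_iff]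
  intro η hη
  -- Compactness of `[0, 1]` makes the modulus of continuity of `D` at `z₀` uniform in `σ`.
  obtain ⟨N, hN, hND⟩ := IsCompact.mem_uniformity_of_prod (f := fun z σ => D (z, σ))
    isCompact_Icc hD hz₀ (Metric.dist_mem_uniformity hη)
  obtain ⟨r, hr, hrN⟩ := Metric.mem_nhdsWithin_iff.1 hN
  obtain ⟨r', hr', hconv'⟩ := hconv z₀ hz₀
  have hC : Convex ℝ (Metric.ball z₀ r ∩ (Metric.ball z₀ r' ∩ 𝒟)) :=
    (convex_ball _ _).inter hconv'
  have hmem : Metric.ball z₀ r ∩ (Metric.ball z₀ r' ∩ 𝒟) ∈ 𝓝[𝒟] z₀ :=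
    Filter.inter_mem (mem_nhdsWithin_of_mem_nhds (Metric.ball_mem_nhds _ hr))
      (Filter.inter_mem (mem_nhdsWithin_of_mem_nhds (Metric.ball_mem_nhds _ hr'))
        self_mem_nhdsWithin)
  filter_upwards [hmem] with z hz
  have hz0 : z₀ ∈ Metric.ball z₀ r ∩ (Metric.ball z₀ r' ∩ 𝒟) :=
    ⟨Metric.mem_ball_self hr, Metric.mem_ball_self hr', hz₀⟩
  have hpt : ∀ σ ∈ Icc (0 : ℝ) 1,
      ‖u (z, σ) - u (z₀, σ) - D (z₀, σ) (z - z₀)‖ ≤ η * ‖z - z₀‖ := by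
    intro σ hσ
    refine hC.norm_image_sub_le_of_norm_hasFDerivWithin_le' (f := fun y => u (y, σ))
      (f' := fun y => D (y, σ)) (φ := D (z₀, σ)) (fun y hy => ?_) (fun y hy => ?_) hz0 hz
    · exact (hder y hy.2.2 σ hσ).mono fun x hx => hx.2.2
    · have := hND y (hrN ⟨hy.1, hy.2.2⟩) σ hσ
      simp only [mem_ofPred_eq, dist_eq_norm] at this
      exact this.le
  have hDz : IntervalIntegrable (fun σ => D (z₀, σ) (z - z₀)) MeasureTheory.volume 0 1 := by
    refine ContinuousOn.intervalIntegrable ?_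
    rw [uIcc_of_le zero_le_one]
    have : ContinuousOn (fun σ => D (z₀, σ)) (Icc 0 1) :=
      hD.comp (by fun_prop) fun σ hσ => ⟨hz₀, hσ⟩
    exact this.clm_apply continuousOn_const
  rw [ContinuousLinearMap.intervalIntegral_apply hDi,
    ← intervalIntegral.integral_sub (hui z hz.2.2) (hui z₀ hz₀),
    ← intervalIntegral.integral_sub ((hui z hz.2.2).sub (hui z₀ hz₀)) hDz]
  have := intervalIntegral.norm_integral_le_of_norm_le_const (a := (0 : ℝ)) (b := 1)
    (f := fun σ => u (z, σ) - u (z₀, σ) - D (z₀, σ) (z - z₀)) (C := η * ‖z - z₀‖) (fun σ hσ => by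
      rw [uIoc_of_le zero_le_one] at hσ
      exact hpt σ ⟨hσ.1.le, hσ.2⟩)
  simpa using this

theorem hasFDerivWithinAt_prodMk_left_comp {W : Type*} [NormedAddCommGroup W] [NormedSpace ℝ W]
    {𝒟 : Set Z} {J : Set ℝ} {u : Z × ℝ → W} (hu : DifferentiableOn ℝ u (𝒟 ×ˢ J)) {y : Z}
    (hy : y ∈ 𝒟) {σ : ℝ} (hσ : σ ∈ J) :
    HasFDerivWithinAt (fun y => u (y, σ))
      ((fderivWithin ℝ u (𝒟 ×ˢ J) (y, σ)).comp (ContinuousLinearMap.inl ℝ Z ℝ)) 𝒟 y :=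
  (hu (y, σ) ⟨hy, hσ⟩).hasFDerivWithinAt.comp y
    (hasFDerivAt_prodMk_left (𝕜 := ℝ) y σ).hasFDerivWithinAt (fun _ hx => mk_mem_prod hx hσ)

theorem contDiffOn_parametric_integral {W : Type*} [NormedAddCommGroup W] [NormedSpace ℝ W]
    [CompleteSpace W] {𝒟 : Set Z} (hconv : ∀ z ∈ 𝒟, ∃ r > 0, Convex ℝ (Metric.ball z r ∩ 𝒟))
    (hU : UniqueDiffOn ℝ 𝒟) {u : Z × ℝ → W} (hu : ContDiffOn ℝ ∞ u (𝒟 ×ˢ Icc 0 1)) :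
    ContDiffOn ℝ ∞ (fun z => ∫ σ in (0 : ℝ)..1, u (z, σ)) 𝒟 := by
  have hUI : UniqueDiffOn ℝ (𝒟 ×ˢ Icc (0 : ℝ) 1) := hU.prod (uniqueDiffOn_Icc zero_lt_one)
  -- The induction replaces `W` by `Z →L[ℝ] W`, so `W` must be quantified inside. With `Z : Type`
  -- both live in the same universe.
  suffices H : ∀ (m : ℕ) (W : Type _) [NormedAddCommGroup W] [NormedSpace ℝ W] [CompleteSpace W]
      (u : Z × ℝ → W), ContDiffOn ℝ ∞ u (𝒟 ×ˢ Icc 0 1) →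
      ContDiffOn ℝ m (fun z => ∫ σ in (0 : ℝ)..1, u (z, σ)) 𝒟 from
    contDiffOn_infty.2 fun m => H m W u hu
  intro m
  induction m with
  | zero =>
    intro W _ _ _ u hu
    have hD : ContDiffOn ℝ ∞ (fun z => (fderivWithin ℝ u (𝒟 ×ˢ Icc (0 : ℝ) 1) z).comp
        (ContinuousLinearMap.inl ℝ Z ℝ)) (𝒟 ×ˢ Icc 0 1) :=
      (hu.fderivWithin hUI (m := ∞) le_rfl).clm_comp contDiffOn_const
    rw [Nat.cast_zero, contDiffOn_zero]
    intro z hz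
    refine (hasFDerivWithinAt_parametric_integral hconv hu.continuousOn hD.continuousOn
      (fun y hy σ hσ => ?_) hz).continuousWithinAt
    exact hasFDerivWithinAt_prodMk_left_comp (hu.differentiableOn (by simp)) hy hσ
  | succ m ih =>
    intro W _ _ _ u hu
    have hD : ContDiffOn ℝ ∞ (fun z => (fderivWithin ℝ u (𝒟 ×ˢ Icc (0 : ℝ) 1) z).comp
        (ContinuousLinearMap.inl ℝ Z ℝ)) (𝒟 ×ˢ Icc 0 1) :=
      (hu.fderivWithin hUI (m := ∞) le_rfl).clm_comp contDiffOn_const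
    have hder := fun z hz => hasFDerivWithinAt_parametric_integral hconv hu.continuousOn
      hD.continuousOn
      (fun y hy σ hσ => hasFDerivWithinAt_prodMk_left_comp (hu.differentiableOn (by simp)) hy hσ)
      (z₀ := z) hz
    have : ((m + 1 : ℕ) : WithTop ℕ∞) = (m : WithTop ℕ∞) + 1 := by push_cast; rfl
    rw [this, contDiffOn_succ_iff_fderivWithin hU]
    refine ⟨fun z hz => (hder z hz).differentiableWithinAt, by simp, ?_⟩
    exact (ih _ _ hD).congr fun z hz => (hder z hz).fderivWithin (hU z hz)

end ParametricIntegral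

section Hadamard

variable {V : Type} [NormedAddCommGroup V] [NormedSpace ℝ V]

theorem isOpen_polar_condition (V : Type*) [NormedAddCommGroup V] (ε : ℝ) :
    IsOpen {z : ℝ × V | z.2 ≠ 0 ∧ z.1 * ‖z.2‖ < ε} :=
  (isOpen_ne_fun continuous_snd continuous_const).inter
    (isOpen_lt (continuous_fst.mul continuous_snd.norm) continuous_const)

theorem polarDomain_eq_inter (V : Type*) [NormedAddCommGroup V] (ε : ℝ) :
    polarDomain V ε =
      (Ici (0 : ℝ) ×ˢ (univ : Set V)) ∩ {z : ℝ × V | z.2 ≠ 0 ∧ z.1 * ‖z.2‖ < ε} := by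
  ext z; simp [polarDomain]

theorem uniqueDiffOn_polarDomain (ε : ℝ) : UniqueDiffOn ℝ (polarDomain V ε) := by
  rw [polarDomain_eq_inter]
  exact ((uniqueDiffOn_Ici 0).prod uniqueDiffOn_univ).inter (isOpen_polar_condition V ε)

theorem uniqueDiffOn_Icc_prod_polarDomain (ε : ℝ) :
    UniqueDiffOn ℝ (Icc (0 : ℝ) 1 ×ˢ polarDomain V ε) :=
  (uniqueDiffOn_Icc zero_lt_one).prod (uniqueDiffOn_polarDomain ε)

/-- The conditions `v ≠ 0` and `s ‖v‖ < ε` are open, so near a given point only the convex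
constraints `t ∈ [0, 1]` and `s ≥ 0` are left. -/
theorem exists_convex_Icc_prod_polarDomain {ε : ℝ} {z : ℝ × ℝ × V}
    (hz : z ∈ Icc (0 : ℝ) 1 ×ˢ polarDomain V ε) :
    ∃ r > 0, Convex ℝ (Metric.ball z r ∩ Icc (0 : ℝ) 1 ×ˢ polarDomain V ε) := by
  have ho : IsOpen ((univ : Set ℝ) ×ˢ {z : ℝ × V | z.2 ≠ 0 ∧ z.1 * ‖z.2‖ < ε}) :=
    isOpen_univ.prod (isOpen_polar_condition V ε)
  rw [polarDomain_eq_inter] at hz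
  obtain ⟨r, hr, hrs⟩ := Metric.isOpen_iff.1 ho z ⟨mem_univ _, hz.2.2⟩
  refine ⟨r, hr, ?_⟩
  have : Metric.ball z r ∩ Icc (0 : ℝ) 1 ×ˢ polarDomain V ε =
      Metric.ball z r ∩ Icc (0 : ℝ) 1 ×ˢ (Ici (0 : ℝ) ×ˢ (univ : Set V)) := by
    rw [polarDomain_eq_inter]
    ext y
    constructor
    · rintro ⟨h1, h2, h3⟩
      exact ⟨h1, h2, h3.1⟩
    · rintro ⟨h1, h2, h3⟩
      exact ⟨h1, h2, h3, (hrs h1).2⟩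
  rw [this]
  exact (convex_ball _ _).inter
    ((convex_Icc _ _).prod ((convex_Ici _).prod convex_univ))

theorem smul_mem_polarDomain {V : Type*} [NormedAddCommGroup V] {ε s σ : ℝ} {v : V}
    (h : (s, v) ∈ polarDomain V ε)
    (hσ : σ ∈ Icc (0 : ℝ) 1) : (σ * s, v) ∈ polarDomain V ε := by
  obtain ⟨h1, h2, h3⟩ := h
  refine ⟨mul_nonneg hσ.1 h1, h2, lt_of_le_of_lt ?_ h3⟩
  simp only at h1 ⊢
  have : σ * s ≤ s := mul_le_of_le_one_left h1 hσ.2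
  gcongr

/-- Division by the radial coordinate: a smooth function on the blowup that vanishes on the
exceptional divisor is `s` times a smooth function. -/
theorem exists_contDiffOn_eq_add_smul {W : Type*} [NormedAddCommGroup W] [NormedSpace ℝ W]
    [CompleteSpace W] {ε : ℝ} {g : ℝ × ℝ × V → W}
    (hg : ContDiffOn ℝ ∞ g (Icc (0 : ℝ) 1 ×ˢ polarDomain V ε)) :
    ∃ k : ℝ × ℝ × V → W, ContDiffOn ℝ ∞ k (Icc (0 : ℝ) 1 ×ˢ polarDomain V ε) ∧
      ∀ t ∈ Icc (0 : ℝ) 1, ∀ s v, (s, v) ∈ polarDomain V ε →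
        g (t, s, v) = g (t, 0, v) + s • k (t, s, v) := by
  set 𝒟 := Icc (0 : ℝ) 1 ×ˢ polarDomain V ε with h𝒟
  have hU : UniqueDiffOn ℝ 𝒟 := uniqueDiffOn_Icc_prod_polarDomain ε
  set D : ℝ × ℝ × V → W := fun z => fderivWithin ℝ g 𝒟 z (0, 1, 0) with hDdef
  have hD : ContDiffOn ℝ ∞ D 𝒟 :=
    (hg.fderivWithin hU (m := ∞) le_rfl).clm_apply contDiffOn_const
  have hmaps : ∀ z ∈ 𝒟, ∀ σ ∈ Icc (0 : ℝ) 1, ((z.1, σ * z.2.1, z.2.2) : ℝ × ℝ × V) ∈ 𝒟 :=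
    fun z hz σ hσ => ⟨hz.1, smul_mem_polarDomain hz.2 hσ⟩
  -- Hadamard's formula: `D` is the derivative in `s`, averaged over the segment from `(t, 0, v)` to
  -- `(t, s, v)`.
  refine ⟨fun z => ∫ σ in (0 : ℝ)..1, D (z.1, σ * z.2.1, z.2.2), ?_, ?_⟩
  · refine contDiffOn_parametric_integral
      (u := fun y : (ℝ × ℝ × V) × ℝ => D (y.1.1, y.2 * y.1.2.1, y.1.2.2))
      (fun z hz => exists_convex_Icc_prod_polarDomain hz) hU ?_
    refine hD.comp (f := fun y : (ℝ × ℝ × V) × ℝ => (y.1.1, y.2 * y.1.2.1, y.1.2.2))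
      (ContDiff.contDiffOn (by fun_prop)) (fun y hy => hmaps y.1 hy.1 y.2 hy.2)
  · intro t ht s v hsv
    have hz : (t, s, v) ∈ 𝒟 := ⟨ht, hsv⟩
    have hder : ∀ σ ∈ Icc (0 : ℝ) 1, HasDerivWithinAt (fun σ => g (t, σ * s, v))
        (s • D (t, σ * s, v)) (Icc 0 1) σ := by
      intro σ hσ
      have h1 := (hg.differentiableOn (by simp) _ (hmaps _ hz σ hσ)).hasFDerivWithinAt
      have h2 : HasDerivWithinAt (fun σ : ℝ => ((t, σ * s, v) : ℝ × ℝ × V)) (0, s, 0)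
          (Icc 0 1) σ := by
        have h3 : HasDerivAt (fun σ : ℝ => σ * s) s σ := by
          simpa using (hasDerivAt_id σ).mul_const s
        exact ((hasDerivAt_const σ t).prodMk (h3.prodMk (hasDerivAt_const σ v))).hasDerivWithinAt
      have h4 := h1.comp_hasDerivWithinAt σ h2 (fun x hx => hmaps _ hz x hx)
      have : s • D (t, σ * s, v) = fderivWithin ℝ g 𝒟 (t, σ * s, v) (0, s, 0) := by
        rw [hDdef, ← map_smul]; simp
      rw [this]
      exact h4
    have hint : IntervalIntegrable (fun σ => s • D (t, σ * s, v)) MeasureTheory.volume 0 1 := by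
      refine ContinuousOn.intervalIntegrable ?_
      rw [uIcc_of_le zero_le_one]
      refine ContinuousOn.const_smul ?_ s
      exact hD.continuousOn.comp (f := fun σ : ℝ => ((t, σ * s, v) : ℝ × ℝ × V)) (by fun_prop)
        fun σ hσ => hmaps _ hz σ hσ
    have := intervalIntegral.integral_eq_sub_of_hasDerivAt_of_le zero_le_one
      (fun σ hσ => (hder σ hσ).continuousWithinAt)
      (fun σ hσ => (hder σ (Ioo_subset_Icc_self hσ)).hasDerivAt (Icc_mem_nhds hσ.1 hσ.2)) hint
    rw [intervalIntegral.integral_smul] at this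
    simp only [one_mul, zero_mul] at this
    rw [this]
    abel

end Hadamard

/-! ### Regularity of maps that are smooth on a blowup -/

section BlowupRegularity

variable {V : Type} [NormedAddCommGroup V] [NormedSpace ℝ V]
  {W : Type*} [NormedAddCommGroup W] [NormedSpace ℝ W]

/-- The compact part of radius `r` of the family of blowups. -/
def polarCompact (V : Type) [NormedAddCommGroup V] (r : ℝ) : Set (ℝ × ℝ × V) :=
  Icc (0 : ℝ) 1 ×ˢ (Icc (0 : ℝ) r ×ˢ Metric.sphere (0 : V) 1)

theorem isCompact_polarCompact [FiniteDimensional ℝ V] (r : ℝ) : IsCompact (polarCompact V r) :=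
  have := FiniteDimensional.proper ℝ V
  isCompact_Icc.prod (isCompact_Icc.prod (isCompact_sphere _ _))

theorem polarCompact_subset {V : Type} [NormedAddCommGroup V] {r ε : ℝ} (h : r < ε) :
    polarCompact V r ⊆ Icc (0 : ℝ) 1 ×ˢ polarDomain V ε := by
  rintro ⟨t, s, v⟩ ⟨ht, hs, hv⟩
  have hv' : ‖v‖ = 1 := by simpa using hv
  refine ⟨ht, hs.1, ?_, ?_⟩
  · simp only
    rintro rfl
    simp at hv'
  · simp only [hv', mul_one]
    exact lt_of_le_of_lt hs.2 h

theorem exists_lipschitzOnWith_polarCompact [FiniteDimensional ℝ V] {r ε : ℝ} (h : r < ε)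
    {κ : ℝ × ℝ × V → W} (hκ : ContDiffOn ℝ ∞ κ (Icc (0 : ℝ) 1 ×ˢ polarDomain V ε)) :
    ∃ K : ℝ≥0, LipschitzOnWith K κ (polarCompact V r) := by
  refine LocallyLipschitzOn.exists_lipschitzOnWith_of_compact (isCompact_polarCompact r) ?_
  intro z hz
  have hz' := polarCompact_subset h hz
  obtain ⟨ρ, hρ, hconv⟩ := exists_convex_Icc_prod_polarDomain hz'
  have h1 : ContDiffWithinAt ℝ 1 κ (Metric.ball z ρ ∩ Icc (0 : ℝ) 1 ×ˢ polarDomain V ε) z :=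
    ((hκ z hz').of_le (by norm_cast)).mono inter_subset_right
  obtain ⟨K, t, ht, hK⟩ := h1.exists_lipschitzOnWith hconv
  refine ⟨K, t, ?_, hK⟩
  rw [inter_comm, nhdsWithin_inter_of_mem'
    (mem_nhdsWithin_of_mem_nhds (Metric.ball_mem_nhds _ hρ))] at ht
  exact nhdsWithin_mono _ (polarCompact_subset h) ht

theorem exists_unit_smul_eq [Nontrivial V] (y : V) : ∃ v : V, ‖v‖ = 1 ∧ ‖y‖ • v = y := by
  by_cases hy : y = 0
  · obtain ⟨v, hv⟩ := exists_norm_eq V zero_le_one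
    exact ⟨v, hv, by simp [hy]⟩
  · have : ‖y‖ ≠ 0 := norm_ne_zero_iff.2 hy
    exact ⟨‖y‖⁻¹ • y, by simp [norm_smul, this], by simp [smul_smul, this]⟩

/-- The unit direction of `y` is discontinuous at the origin, but its variation is always multiplied
by the radius, and the product is controlled by the distance. -/
theorem exists_lipschitzOnWith_of_polar [FiniteDimensional ℝ V] [Nontrivial V] {r ε : ℝ}
    (hr : 0 < r) (h : r < ε) {κ : ℝ × ℝ × V → W}
    (hκ : ContDiffOn ℝ ∞ κ (Icc (0 : ℝ) 1 ×ˢ polarDomain V ε)) {f : ℝ × V → W}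
    (hf : ∀ t ∈ Icc (0 : ℝ) 1, ∀ s ∈ Icc (0 : ℝ) r, ∀ v : V, ‖v‖ = 1 →
      f (t, s • v) = s • κ (t, s, v)) :
    ∃ K : ℝ≥0, LipschitzOnWith K f (Icc (0 : ℝ) 1 ×ˢ Metric.ball (0 : V) r) := by
  obtain ⟨K, hK⟩ := exists_lipschitzOnWith_polarCompact h hκ
  obtain ⟨M, hM⟩ := (isCompact_polarCompact (V := V) r).exists_bound_of_continuousOn
    (hκ.continuousOn.mono (polarCompact_subset h))
  have hM0 : 0 ≤ M := by
    obtain ⟨v, hv⟩ := exists_norm_eq V zero_le_one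
    exact (norm_nonneg _).trans (hM (0, 0, v) ⟨by simp, by simp [hr.le], by simp [hv]⟩)
  set C : ℝ := M + K * (r + r + 2) with hC
  have hC0 : 0 ≤ C := by positivity
  have key : ∀ z ∈ Icc (0 : ℝ) 1 ×ˢ Metric.ball (0 : V) r,
      ∀ z' ∈ Icc (0 : ℝ) 1 ×ˢ Metric.ball (0 : V) r, ‖z'.2‖ ≤ ‖z.2‖ →
      dist (f z) (f z') ≤ C * dist z z' := by
    rintro ⟨t, y⟩ ⟨ht, hy⟩ ⟨t', y'⟩ ⟨ht', hy'⟩ hyy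
    simp only [mem_ball_zero_iff] at ht hy ht' hy' hyy
    obtain ⟨v, hv, hvy⟩ := exists_unit_smul_eq y
    obtain ⟨v', hv', hvy'⟩ := exists_unit_smul_eq y'
    set s := ‖y‖ with hs
    set s' := ‖y'‖ with hs'
    have hs0 : 0 ≤ s := norm_nonneg _
    have hs0' : 0 ≤ s' := norm_nonneg _
    have e1 : f (t, y) = s • κ (t, s, v) := by
      rw [← hvy]; exact hf t ht s ⟨hs0, hy.le⟩ v hv
    have e2 : f (t', y') = s' • κ (t', s', v') := by
      rw [← hvy']; exact hf t' ht' s' ⟨hs0', hy'.le⟩ v' hv'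
    have m1 : (t, s, v) ∈ polarCompact V r := ⟨ht, ⟨hs0, hy.le⟩, by simp [hv]⟩
    have m2 : (t', s', v') ∈ polarCompact V r := ⟨ht', ⟨hs0', hy'.le⟩, by simp [hv']⟩
    have d1 : dist t t' ≤ dist ((t, y) : ℝ × V) (t', y') := le_max_left _ _
    have d2 : dist y y' ≤ dist ((t, y) : ℝ × V) (t', y') := le_max_right _ _
    set δ := dist ((t, y) : ℝ × V) (t', y') with hδ
    have d3 : |s - s'| ≤ δ := by
      refine le_trans ?_ d2
      rw [dist_eq_norm]
      exact abs_norm_sub_norm_le y y'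
    -- With `y = s v` and `y' = s' v'` one has `s' (v - v') = (s' - s) v + (y - y')`, and both terms
    -- are at most `δ`.
    have d4 : s' * ‖v - v'‖ ≤ 2 * δ := by
      have : s' • (v - v') = (s' - s) • v + (y - y') := by
        conv_rhs => rw [← hvy, ← hvy']
        module
      calc s' * ‖v - v'‖ = ‖s' • (v - v')‖ := by rw [norm_smul, Real.norm_of_nonneg hs0']
        _ ≤ ‖(s' - s) • v‖ + ‖y - y'‖ := by rw [this]; exact norm_add_le _ _
        _ ≤ δ + δ := by
            refine add_le_add ?_ (by rwa [dist_eq_norm] at d2)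
            rw [norm_smul, hv, mul_one, Real.norm_eq_abs, abs_sub_comm]
            exact d3
        _ = 2 * δ := by ring
    have d5 : ‖κ (t, s, v) - κ (t', s', v')‖ ≤ K * (dist t t' + (|s - s'| + ‖v - v'‖)) := by
      have := hK.dist_le_mul _ m1 _ m2
      rw [dist_eq_norm] at this
      refine this.trans ?_
      gcongr
      rw [Prod.dist_eq, Prod.dist_eq]
      simp only
      refine max_le (le_add_of_nonneg_right (by positivity)) ?_
      refine le_trans (max_le ?_ ?_) (le_add_of_nonneg_left dist_nonneg)
      · rw [Real.dist_eq]; exact le_add_of_nonneg_right (norm_nonneg _)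
      · rw [dist_eq_norm]; exact le_add_of_nonneg_left (abs_nonneg _)
    have e3 : s • κ (t, s, v) - s' • κ (t', s', v') =
        (s - s') • κ (t, s, v) + s' • (κ (t, s, v) - κ (t', s', v')) := by module
    rw [e1, e2, dist_eq_norm, e3]
    have hδ0 : 0 ≤ δ := dist_nonneg
    calc ‖(s - s') • κ (t, s, v) + s' • (κ (t, s, v) - κ (t', s', v'))‖
        ≤ |s - s'| * ‖κ (t, s, v)‖ + s' * ‖κ (t, s, v) - κ (t', s', v')‖ := by
          refine (norm_add_le _ _).trans (le_of_eq ?_)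
          rw [norm_smul, norm_smul, Real.norm_eq_abs, Real.norm_of_nonneg hs0']
      _ ≤ δ * M + s' * (K * (dist t t' + (|s - s'| + ‖v - v'‖))) := by
          gcongr
          exact hM _ m1
      _ = δ * M + K * (s' * dist t t' + s' * |s - s'| + s' * ‖v - v'‖) := by ring
      _ ≤ δ * M + K * (r * δ + r * δ + 2 * δ) := by gcongr
      _ = C * δ := by rw [hC]; ring
  refine ⟨⟨C, hC0⟩, LipschitzOnWith.of_dist_le_mul fun z hz z' hz' => ?_⟩
  rcases le_total ‖z'.2‖ ‖z.2‖ with hle | hle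
  · exact key z hz z' hz' hle
  · rw [dist_comm, dist_comm z z']
    exact key z' hz' z hz hle

/-- A map which is quadratic in the radial coordinate is of class `C^{1,1}`. -/
theorem exists_hasFDerivWithinAt_of_polar_sq [FiniteDimensional ℝ V] [Nontrivial V] {r ε : ℝ}
    (hr : 0 < r) (h : r < ε) {k : ℝ × ℝ × V → W}
    (hk : ContDiffOn ℝ ∞ k (Icc (0 : ℝ) 1 ×ˢ polarDomain V ε)) {f : ℝ × V → W}
    (hf : ∀ t ∈ Icc (0 : ℝ) 1, ∀ s v, (s, v) ∈ polarDomain V ε →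
      f (t, s • v) = s ^ 2 • k (t, s, v)) :
    ∃ f' : ℝ × V → ℝ × V →L[ℝ] W,
      (∀ z ∈ Icc (0 : ℝ) 1 ×ˢ Metric.ball (0 : V) r,
        HasFDerivWithinAt f (f' z) (Icc (0 : ℝ) 1 ×ˢ Metric.ball (0 : V) r) z) ∧
      ∃ K : ℝ≥0, LipschitzOnWith K f' (Icc (0 : ℝ) 1 ×ˢ Metric.ball (0 : V) r) := by
  set 𝒟 := Icc (0 : ℝ) 1 ×ˢ polarDomain V ε with h𝒟
  set M₁ : ℝ × V →L[ℝ] ℝ × ℝ × V :=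
    (ContinuousLinearMap.inl ℝ ℝ (ℝ × V)).comp (ContinuousLinearMap.fst ℝ ℝ V) with hM₁
  set M₂ : ℝ × V →L[ℝ] ℝ × ℝ × V :=
    ((ContinuousLinearMap.inr ℝ ℝ (ℝ × V)).comp (ContinuousLinearMap.inr ℝ ℝ V)).comp
      (ContinuousLinearMap.snd ℝ ℝ V) with hM₂
  set κ : ℝ × ℝ × V → ℝ × V →L[ℝ] W :=
    fun z => (fderivWithin ℝ k 𝒟 z).comp (z.2.1 • M₁ + M₂) with hκ
  have hκs : ContDiffOn ℝ ∞ κ 𝒟 := by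
    refine (hk.fderivWithin (uniqueDiffOn_Icc_prod_polarDomain ε) (m := ∞) le_rfl).clm_comp ?_
    exact ContDiff.contDiffOn (by fun_prop)
  classical
  -- The derivative vanishes at the origin, where `f` is bounded by a multiple of `‖y‖²`. Elsewhere
  -- it is the radius times the function `κ`, which is smooth on the blowup.
  set f' : ℝ × V → ℝ × V →L[ℝ] W := fun z =>
    if z.2 = 0 then 0 else ‖z.2‖ • κ (z.1, ‖z.2‖, ‖z.2‖⁻¹ • z.2) with hf'
  refine ⟨f', ?_, ?_⟩
  · rintro ⟨t, y⟩ ⟨ht, hy⟩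
    simp only [mem_ball_zero_iff] at ht hy
    by_cases hy0 : y = 0
    · subst hy0
      have hz : f' (t, 0) = 0 := by simp [hf']
      rw [hz]
      obtain ⟨M, hM⟩ := (isCompact_polarCompact (V := V) r).exists_bound_of_continuousOn
        (hk.continuousOn.mono (polarCompact_subset h))
      have hb : ∀ z ∈ Icc (0 : ℝ) 1 ×ˢ Metric.ball (0 : V) r, ‖f z‖ ≤ ‖z.2‖ ^ 2 * M := by
        rintro ⟨t', y'⟩ ⟨ht', hy'⟩
        simp only [mem_ball_zero_iff] at ht' hy'
        obtain ⟨v, hv, hvy⟩ := exists_unit_smul_eq y'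
        have hm : (t', ‖y'‖, v) ∈ polarCompact V r :=
          ⟨ht', ⟨norm_nonneg _, hy'.le⟩, by simp [hv]⟩
        have := hf t' ht' ‖y'‖ v (polarCompact_subset h hm).2
        rw [hvy] at this
        rw [this, norm_smul, Real.norm_of_nonneg (by positivity)]
        simp only
        gcongr
        exact hM _ hm
      have h0 : f (t, 0) = 0 := by
        have := hb (t, 0) ⟨ht, by simp [hr]⟩
        simpa using this
      rw [hasFDerivWithinAt_iff_isLittleO, Asymptotics.isLittleO_iff]
      intro η hη
      have hnear : ∀ᶠ z : ℝ × V in 𝓝 (t, 0), ‖z.2‖ * (|M| + 1) < η := by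
        have : Continuous fun z : ℝ × V => ‖z.2‖ * (|M| + 1) := by fun_prop
        exact this.continuousAt.eventually_lt continuousAt_const (by simpa using hη)
      filter_upwards [mem_nhdsWithin_of_mem_nhds hnear, self_mem_nhdsWithin] with z hz1 hz2
      rw [h0]
      simp only [sub_zero, zero_apply]
      have h2 : ‖z.2‖ ≤ ‖z - (t, 0)‖ := by
        simp [Prod.norm_def]
      have hMM : M ≤ |M| + 1 := (le_abs_self M).trans (by linarith)
      calc ‖f z‖ ≤ ‖z.2‖ ^ 2 * M := hb z hz2
        _ ≤ ‖z.2‖ ^ 2 * (|M| + 1) := by gcongr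
        _ = ‖z.2‖ * (|M| + 1) * ‖z.2‖ := by ring
        _ ≤ η * ‖z - (t, 0)‖ := by
          have hz1' : ‖z.2‖ * (|M| + 1) < η := hz1
          gcongr
    · have hs : 0 < ‖y‖ := norm_pos_iff.2 hy0
      set s := ‖y‖ with hsdef
      set N := Icc (0 : ℝ) 1 ×ˢ (Metric.ball (0 : V) r ∩ {0}ᶜ) with hN
      have hNm : N ∈ 𝓝[Icc (0 : ℝ) 1 ×ˢ Metric.ball (0 : V) r] (t, y) := by
        have h1 : (univ : Set ℝ) ×ˢ ({0}ᶜ : Set V) ∈ 𝓝 (t, y) :=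
          (isOpen_univ.prod isOpen_compl_singleton).mem_nhds ⟨mem_univ _, hy0⟩
        filter_upwards [self_mem_nhdsWithin, mem_nhdsWithin_of_mem_nhds h1] with z hz hz'
        exact ⟨hz.1, hz.2, hz'.2⟩
      refine HasFDerivWithinAt.mono_of_mem_nhdsWithin (t := N) ?_ hNm
      set P : ℝ × V → ℝ × ℝ × V := fun z => (z.1, s, s⁻¹ • z.2) with hP
      have hPm : ∀ z ∈ N, P z ∈ 𝒟 := by
        rintro ⟨t', y'⟩ ⟨ht', hy', hy0'⟩
        refine ⟨ht', hs.le, by simpa [hP, hs.ne'] using hy0', ?_⟩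
        simp only [hP, norm_smul, norm_inv, Real.norm_of_nonneg hs.le]
        rw [mul_inv_cancel_left₀ hs.ne']
        exact (mem_ball_zero_iff.1 hy').trans h
      have hfN : ∀ z ∈ N, f z = s ^ 2 • k (P z) := by
        rintro ⟨t', y'⟩ hz
        have := hf t' hz.1 s (s⁻¹ • y') (hPm _ hz).2
        rwa [smul_smul, mul_inv_cancel₀ hs.ne', one_smul] at this
      have hmem : ((t, y) : ℝ × V) ∈ N := ⟨ht, mem_ball_zero_iff.2 hy, hy0⟩
      have hPd : HasFDerivAt P (M₁ + s⁻¹ • M₂) (t, y) := by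
        have : P = fun z => (M₁ + s⁻¹ • M₂) z + (0, s, 0) := by
          ext z <;> simp [hP, hM₁, hM₂]
        rw [this]
        exact (ContinuousLinearMap.hasFDerivAt _).add_const _
      have hkd := (hk.differentiableOn (by simp) _ (hPm _ hmem)).hasFDerivWithinAt
      have hcomp := (hkd.comp (t, y) hPd.hasFDerivWithinAt hPm).const_smul (s ^ 2)
      have hfin : f' (t, y) = s ^ 2 • (fderivWithin ℝ k 𝒟 (P (t, y))).comp (M₁ + s⁻¹ • M₂) := by
        have hop : s • (s • M₁ + M₂) = s ^ 2 • (M₁ + s⁻¹ • M₂) := by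
          rw [smul_add, smul_add, smul_smul, smul_smul, sq, mul_assoc, mul_inv_cancel₀ hs.ne',
            mul_one]
        have h1 : f' (t, y) = s • (fderivWithin ℝ k 𝒟 (P (t, y))).comp (s • M₁ + M₂) := by
          simp only [hf', hy0, if_false, hκ, hP, ← hsdef]
        rw [h1]
        refine (ContinuousLinearMap.comp_smul _ s _).symm.trans ?_
        rw [hop]
        exact ContinuousLinearMap.comp_smul _ (s ^ 2) _
      rw [hfin]
      exact hcomp.congr (fun z hz => hfN z hz) (hfN _ hmem)
  · refine exists_lipschitzOnWith_of_polar hr h hκs ?_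
    intro t _ s hs v hv
    rcases hs.1.eq_or_lt with rfl | hs0
    · simp [hf']
    · have hv0 : v ≠ 0 := by rintro rfl; simp at hv
      have hn : ‖s • v‖ = s := by rw [norm_smul, hv, mul_one, Real.norm_of_nonneg hs.1]
      simp only [hf', hn, smul_eq_zero, hs0.ne', hv0, or_self, if_false, smul_smul,
        inv_mul_cancel₀ hs0.ne', one_smul]

/-- The derivative of the smooth part `b` is Lipschitz on a compact convex set, and the part
quadratic in the radius is covered by `exists_hasFDerivWithinAt_of_polar_sq`. -/
theorem exists_contDiffOn_one_lipschitz_fderivWithin [FiniteDimensional ℝ V] [Nontrivial V]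
    {r ε : ℝ} (hr : 0 < r) (h : r < ε) {k : ℝ × ℝ × V → W}
    (hk : ContDiffOn ℝ ∞ k (Icc (0 : ℝ) 1 ×ˢ polarDomain V ε)) {b : ℝ × V → W}
    (hb : ContDiffOn ℝ ∞ b (Icc (0 : ℝ) 1 ×ˢ univ)) {f : ℝ × V → W}
    (hf : ∀ t ∈ Icc (0 : ℝ) 1, ∀ s v, (s, v) ∈ polarDomain V ε →
      f (t, s • v) = b (t, s • v) + s ^ 2 • k (t, s, v))
    {Q : Set (ℝ × V)} (hQ : UniqueDiffOn ℝ Q)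
    (hQs : Q ⊆ Icc (0 : ℝ) 1 ×ˢ Metric.ball (0 : V) r) :
    ContDiffOn ℝ 1 f Q ∧ ∃ K : ℝ≥0, LipschitzOnWith K (fderivWithin ℝ f Q) Q := by
  obtain ⟨g', hg', K, hK⟩ := exists_hasFDerivWithinAt_of_polar_sq hr h hk
    (f := fun z => f z - b z) (fun t ht s v hsv => by rw [hf t ht s v hsv]; abel)
  have hU : UniqueDiffOn ℝ (Icc (0 : ℝ) 1 ×ˢ (univ : Set V)) :=
    (uniqueDiffOn_Icc zero_lt_one).prod uniqueDiffOn_univ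
  set b' := fderivWithin ℝ b (Icc (0 : ℝ) 1 ×ˢ (univ : Set V)) with hb'
  have hbs : ContDiffOn ℝ ∞ b' (Icc (0 : ℝ) 1 ×ˢ (univ : Set V)) :=
    hb.fderivWithin hU (m := ∞) le_rfl
  have := FiniteDimensional.proper ℝ V
  obtain ⟨K', hK'⟩ := (hbs.mono (prod_mono_right (subset_univ (Metric.closedBall (0 : V) r)))
    ).exists_lipschitzOnWith (by simp) ((convex_Icc _ _).prod (convex_closedBall _ _))
    (isCompact_Icc.prod (isCompact_closedBall _ _))
  have hQ' : Q ⊆ Icc (0 : ℝ) 1 ×ˢ Metric.closedBall (0 : V) r :=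
    hQs.trans (prod_mono_right Metric.ball_subset_closedBall)
  have hder : ∀ z ∈ Q, HasFDerivWithinAt f (g' z + b' z) Q z := by
    intro z hz
    have h1 := (hg' z (hQs hz)).mono hQs
    have h2 : HasFDerivWithinAt b (b' z) Q z :=
      ((hb.differentiableOn (by simp) z ⟨(hQs hz).1, mem_univ _⟩).hasFDerivWithinAt).mono
        (fun y hy => ⟨(hQs hy).1, mem_univ _⟩)
    have h3 := h1.add h2
    exact h3.congr (fun y _ => by simp) (by simp)
  have hfd : EqOn (fderivWithin ℝ f Q) (fun z => g' z + b' z) Q :=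
    fun z hz => (hder z hz).fderivWithin (hQ z hz)
  have hL : LipschitzOnWith (K + K') (fun z => g' z + b' z) Q :=
    (hK.mono hQs).add (hK'.mono hQ')
  have hL' : LipschitzOnWith (K + K') (fderivWithin ℝ f Q) Q := by
    intro x hx y hy
    rw [hfd hx, hfd hy]
    exact hL hx hy
  refine ⟨?_, _, hL'⟩
  rw [show (1 : WithTop ℕ∞) = 0 + 1 by rw [zero_add], contDiffOn_succ_iff_fderivWithin hQ]
  exact ⟨fun z hz => (hder z hz).differentiableWithinAt, by simp,
    contDiffOn_zero.2 hL'.continuousOn⟩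

end BlowupRegularity

/-! ### Isotopies of homogeneous maps -/

section Homogeneous

variable {V : Type} [NormedAddCommGroup V] [InnerProductSpace ℝ V]

/-- A smooth family of surjective positively homogeneous immersions of `V ∖ 0` that starts at the
identity. -/
structure IsHomogIsotopy (C : ℝ × V → V) : Prop where
  smooth : ContDiffOn ℝ ∞ C (Icc 0 1 ×ˢ {0}ᶜ)
  ne_zero : ∀ t ∈ Icc (0 : ℝ) 1, ∀ v, v ≠ 0 → C (t, v) ≠ 0
  homog : ∀ t ∈ Icc (0 : ℝ) 1, ∀ v, v ≠ 0 → ∀ a : ℝ, 0 < a → C (t, a • v) = a • C (t, v)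
  injective : ∀ t ∈ Icc (0 : ℝ) 1, ∀ v, v ≠ 0 →
    Function.Injective (spaceDeriv C (Icc 0 1) {0}ᶜ (t, v))
  surj : ∀ t ∈ Icc (0 : ℝ) 1, ∀ u, u ≠ 0 → ∃ v, v ≠ 0 ∧ C (t, v) = u
  zero_eq : ∀ v, v ≠ 0 → C (0, v) = v

theorem isCompact_Icc_prod_sphere [FiniteDimensional ℝ V] :
    IsCompact (Icc (0 : ℝ) 1 ×ˢ Metric.sphere (0 : V) 1) :=
  have := FiniteDimensional.proper ℝ V
  isCompact_Icc.prod (isCompact_sphere _ _)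

theorem Icc_prod_sphere_subset {V : Type} [NormedAddCommGroup V] :
    Icc (0 : ℝ) 1 ×ˢ Metric.sphere (0 : V) 1 ⊆ Icc (0 : ℝ) 1 ×ˢ {0}ᶜ :=
  prod_mono_right fun v hv => by
    rintro rfl
    simp at hv

/-- A positively homogeneous family is bounded above and below by multiples of the norm. -/
theorem exists_norm_bounds [FiniteDimensional ℝ V] [Nontrivial V] {C : ℝ × V → V}
    (hc : ContinuousOn C (Icc 0 1 ×ˢ {0}ᶜ))
    (hne : ∀ t ∈ Icc (0 : ℝ) 1, ∀ v, v ≠ 0 → C (t, v) ≠ 0)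
    (hom : ∀ t ∈ Icc (0 : ℝ) 1, ∀ v, v ≠ 0 → ∀ a : ℝ, 0 < a → C (t, a • v) = a • C (t, v)) :
    ∃ m > 0, ∃ M > 0, ∀ t ∈ Icc (0 : ℝ) 1, ∀ v, v ≠ 0 →
      m * ‖v‖ ≤ ‖C (t, v)‖ ∧ ‖C (t, v)‖ ≤ M * ‖v‖ := by
  have hcont : ContinuousOn (fun z => ‖C z‖) (Icc (0 : ℝ) 1 ×ˢ Metric.sphere (0 : V) 1) :=
    (hc.mono Icc_prod_sphere_subset).norm
  obtain ⟨v₁, hv₁⟩ := exists_norm_eq V zero_le_one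
  have hnon : (Icc (0 : ℝ) 1 ×ˢ Metric.sphere (0 : V) 1).Nonempty :=
    ⟨(0, v₁), by simp, by simp [hv₁]⟩
  obtain ⟨zm, hzm, hm⟩ := isCompact_Icc_prod_sphere.exists_isMinOn hnon hcont
  obtain ⟨zM, hzM, hM⟩ := isCompact_Icc_prod_sphere.exists_isMaxOn hnon hcont
  have hpos : ∀ z ∈ Icc (0 : ℝ) 1 ×ˢ Metric.sphere (0 : V) 1, 0 < ‖C z‖ := by
    rintro ⟨t, v⟩ hz
    exact norm_pos_iff.2 (hne t hz.1 v (Icc_prod_sphere_subset hz).2)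
  refine ⟨‖C zm‖, hpos _ hzm, ‖C zM‖, hpos _ hzM, fun t ht v hv => ?_⟩
  have hv' : 0 < ‖v‖ := norm_pos_iff.2 hv
  have hu : ‖‖v‖⁻¹ • v‖ = 1 := by simp [norm_smul, hv'.ne']
  have hu0 : ‖v‖⁻¹ • v ≠ 0 := by simp [hv]
  have hmem : (t, ‖v‖⁻¹ • v) ∈ Icc (0 : ℝ) 1 ×ˢ Metric.sphere (0 : V) 1 := ⟨ht, by simp [hu]⟩
  have h1 : C (t, v) = ‖v‖ • C (t, ‖v‖⁻¹ • v) := by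
    rw [← hom t ht _ hu0 _ hv', smul_smul, mul_inv_cancel₀ hv'.ne', one_smul]
  rw [h1, norm_smul, norm_norm, mul_comm _ ‖v‖, mul_comm _ ‖v‖]
  exact ⟨mul_le_mul_of_nonneg_left (hm hmem) hv'.le, mul_le_mul_of_nonneg_left (hM hmem) hv'.le⟩

namespace IsHomogIsotopy

variable {C : ℝ × V → V}

theorem continuousAt (hC : IsHomogIsotopy C) (t : Icc (0 : ℝ) 1) {v : V} (hv : v ≠ 0) :
    ContinuousAt (fun z : Icc (0 : ℝ) 1 × V => C (z.1, z.2)) (t, v) := by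
  have h1 := hC.smooth.continuousOn (t, v) ⟨t.2, hv⟩
  refine Tendsto.comp h1 (tendsto_nhdsWithin_iff.2 ⟨?_, ?_⟩)
  · have : Continuous fun z : Icc (0 : ℝ) 1 × V => ((z.1 : ℝ), z.2) := by fun_prop
    exact this.tendsto (t, v)
  · have : ∀ᶠ z : Icc (0 : ℝ) 1 × V in 𝓝 (t, v), z.2 ≠ 0 :=
      continuousAt_snd.eventually_ne hv
    filter_upwards [this] with z hz using ⟨z.1.2, hz⟩

theorem hasFDerivAt (hC : IsHomogIsotopy C) : ∀ t ∈ Icc (0 : ℝ) 1, ∀ v ∈ ({0}ᶜ : Set V),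
    HasFDerivAt (fun w => C (t, w)) (spaceDeriv C (Icc 0 1) {0}ᶜ (t, v)) v :=
  fun _ ht _ hv => hasFDerivAt_spaceDeriv isOpen_compl_singleton hC.smooth ht hv

theorem continuousOn_spaceDeriv (hC : IsHomogIsotopy C) :
    ContinuousOn (spaceDeriv C (Icc 0 1) {0}ᶜ) (Icc (0 : ℝ) 1 ×ˢ {0}ᶜ) :=
  (contDiffOn_spaceDeriv (uniqueDiffOn_Icc zero_lt_one) isOpen_compl_singleton
    hC.smooth).continuousOn

variable [FiniteDimensional ℝ V]

/-- Homogeneity reduces injectivity to a compact set of pairs. Near a diagonal pair it persists by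
local injectivity uniform in `t`, near any other pair by continuity. -/
theorem isOpen_setOf_injOn [Nontrivial V] (hC : IsHomogIsotopy C) :
    IsOpen {t : Icc (0 : ℝ) 1 | InjOn (fun v => C (t, v)) {0}ᶜ} := by
  have hprop := FiniteDimensional.proper ℝ V
  rw [isOpen_iff_mem_nhds]
  intro t₀ ht₀
  obtain ⟨m, hm, M, hM, hmM⟩ := exists_norm_bounds hC.smooth.continuousOn hC.ne_zero hC.homog
  -- After scaling, `v` is a unit vector. If `C (t, v) = C (t, w)`, the two norm bounds force `m / M
  -- ≤ ‖w‖ ≤ M / m`.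
  set K : Set (V × V) := Metric.sphere (0 : V) 1 ×ˢ
    (Metric.closedBall (0 : V) (M / m) ∩ {w | m / M ≤ ‖w‖}) with hK
  have hKc : IsCompact K := (isCompact_sphere _ _).prod
    ((isCompact_closedBall _ _).inter_right (isClosed_le continuous_const continuous_norm))
  have hloc : ∀ y ∈ K, ∀ᶠ z : Icc (0 : ℝ) 1 × V × V in 𝓝 (t₀, y),
      C (z.1, z.2.1) = C (z.1, z.2.2) → z.2.1 = z.2.2 := by
    rintro ⟨v, w⟩ ⟨hv, hw⟩
    have hv0 : v ≠ 0 := by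
      rintro rfl
      simp at hv
    have hw0 : w ≠ 0 := by
      rintro rfl
      have h1 : m / M ≤ ‖(0 : V)‖ := hw.2
      rw [norm_zero] at h1
      exact absurd h1 (not_le.2 (div_pos hm hM))
    by_cases hvw : v = w
    · subst hvw
      obtain ⟨e, he⟩ := exists_equiv_of_injective rfl (hC.injective t₀ t₀.2 v hv0)
      obtain ⟨δ, hδ, hinj⟩ := exists_eventually_injOn (c := fun t v => C (t, v))
        isOpen_compl_singleton hC.hasFDerivAt hC.continuousOn_spaceDeriv t₀.2 hv0 e he
      have h1 : ∀ᶠ t : Icc (0 : ℝ) 1 in 𝓝 t₀,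
          InjOn (fun v => C (t, v)) (Metric.closedBall v δ) :=
        (eventually_nhds_subtype_iff _ _ _).2 hinj
      have h2 : Metric.closedBall v δ ∈ 𝓝 v := Metric.closedBall_mem_nhds _ hδ
      rw [nhds_prod_eq]
      have h3 : ∀ᶠ y : V × V in 𝓝 (v, v),
          y.1 ∈ Metric.closedBall v δ ∧ y.2 ∈ Metric.closedBall v δ := by
        rw [nhds_prod_eq]
        exact Filter.prod_mem_prod h2 h2
      filter_upwards [h1.prod_mk h3] with z hz heq
      exact hz.1 hz.2.1 hz.2.2 heq
    · have hne : C (t₀, v) ≠ C (t₀, w) := fun h => hvw (ht₀ hv0 hw0 h)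
      have c1 : ContinuousAt (fun z : Icc (0 : ℝ) 1 × V × V => C (z.1, z.2.1)) (t₀, v, w) :=
        ContinuousAt.comp (g := fun z : Icc (0 : ℝ) 1 × V => C (z.1, z.2))
          (f := fun z : Icc (0 : ℝ) 1 × V × V => (z.1, z.2.1)) (hC.continuousAt t₀ hv0)
          (by fun_prop)
      have c2 : ContinuousAt (fun z : Icc (0 : ℝ) 1 × V × V => C (z.1, z.2.2)) (t₀, v, w) :=
        ContinuousAt.comp (g := fun z : Icc (0 : ℝ) 1 × V => C (z.1, z.2))
          (f := fun z : Icc (0 : ℝ) 1 × V × V => (z.1, z.2.2)) (hC.continuousAt t₀ hw0)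
          (by fun_prop)
      filter_upwards [c1.ne_iff_eventually_ne c2 |>.1 hne] with z hz h using absurd h hz
  filter_upwards [hKc.eventually_forall_of_forall_eventually
    (P := fun (t : Icc (0 : ℝ) 1) (y : V × V) => C (t, y.1) = C (t, y.2) → y.1 = y.2) hloc]
    with t ht
  intro v hv w hw hvw
  have hv' : 0 < ‖v‖ := norm_pos_iff.2 hv
  have hvn : ‖‖v‖⁻¹ • v‖ = 1 := by simp [norm_smul, hv'.ne']
  have hv1 : ‖v‖⁻¹ • v ≠ 0 := smul_ne_zero (inv_ne_zero hv'.ne') hv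
  have hw1 : ‖v‖⁻¹ • w ≠ 0 := smul_ne_zero (inv_ne_zero hv'.ne') hw
  have heq : C (t, ‖v‖⁻¹ • v) = C (t, ‖v‖⁻¹ • w) := by
    rw [hC.homog t t.2 v hv _ (inv_pos.2 hv'), hC.homog t t.2 w hw _ (inv_pos.2 hv')]
    exact congrArg _ hvw
  have b1 := hmM t t.2 _ hv1
  have b2 := hmM t t.2 _ hw1
  rw [hvn, mul_one] at b1
  rw [← heq] at b2
  have hmem : ((‖v‖⁻¹ • v, ‖v‖⁻¹ • w) : V × V) ∈ K := by
    refine ⟨by simp [hvn], ?_, ?_⟩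
    · rw [mem_closedBall_zero_iff, le_div_iff₀ hm, mul_comm]
      linarith [b1.2, b2.1]
    · change m / M ≤ ‖‖v‖⁻¹ • w‖
      rw [div_le_iff₀ hM, mul_comm]
      linarith [b1.1, b2.2]
  have := ht _ hmem heq
  exact smul_right_injective V (inv_ne_zero hv'.ne') this

/-- Failure of injectivity is stable: for nearby `t` a value taken at two distinct points is still
attained near each of them, by local surjectivity uniform in `t`. -/
theorem isClosed_setOf_injOn (hC : IsHomogIsotopy C) :
    IsClosed {t : Icc (0 : ℝ) 1 | InjOn (fun v => C (t, v)) {0}ᶜ} := by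
  have hcomplete : CompleteSpace V := FiniteDimensional.complete ℝ V
  rw [← isOpen_compl_iff, isOpen_iff_mem_nhds]
  intro t₀ ht₀
  have ht₀' : ¬ InjOn (fun v => C (t₀, v)) {0}ᶜ := ht₀
  simp only [InjOn, not_forall] at ht₀'
  obtain ⟨v, hv, w, hw, hvw, hne⟩ := ht₀'
  have hsolve : ∀ x : V, x ≠ 0 → ∀ η > 0, ∀ᶠ t in 𝓝[Icc (0 : ℝ) 1] (t₀ : ℝ),
      ∃ y ∈ Metric.closedBall x η, C (t, y) = C (t₀, x) := by
    intro x hx η hη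
    obtain ⟨e, he⟩ := exists_equiv_of_injective rfl (hC.injective t₀ t₀.2 x hx)
    have hct : ContinuousWithinAt (fun t => C (t, x)) (Icc 0 1) t₀ := by
      have : ContinuousOn (fun t => C (t, x)) (Icc (0 : ℝ) 1) :=
        hC.smooth.continuousOn.comp (by fun_prop) (fun t ht => ⟨ht, hx⟩)
      exact this t₀ t₀.2
    have := eventually_exists_eq (c := fun t v => C (t, v)) isOpen_compl_singleton
      hC.hasFDerivAt hC.continuousOn_spaceDeriv t₀.2 hx e he hct hη
    exact this.curry.mono fun t ht => ht.self_of_nhds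
  have hd : 0 < dist v w := dist_pos.2 hne
  -- A third of the distance keeps the two balls disjoint, and half of each norm keeps them away
  -- from the origin.
  set η := min (dist v w / 3) (min (‖v‖ / 2) (‖w‖ / 2)) with hη
  have hv' : 0 < ‖v‖ := norm_pos_iff.2 hv
  have hw' : 0 < ‖w‖ := norm_pos_iff.2 hw
  have hη0 : 0 < η := by positivity
  have hη1 : η ≤ dist v w / 3 := min_le_left _ _
  have hη2 : η ≤ ‖v‖ / 2 := (min_le_right _ _).trans (min_le_left _ _)
  have hη3 : η ≤ ‖w‖ / 2 := (min_le_right _ _).trans (min_le_right _ _)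
  have hev := (hsolve v hv η hη0).and (hsolve w hw η hη0)
  have hev' := (eventually_nhds_subtype_iff (Icc (0 : ℝ) 1) t₀ (fun t =>
    (∃ y ∈ Metric.closedBall v η, C (t, y) = C (t₀, v)) ∧
      ∃ y ∈ Metric.closedBall w η, C (t, y) = C (t₀, w))).2 hev
  filter_upwards [hev'] with t ht
  obtain ⟨⟨y, hy, hCy⟩, ⟨y', hy', hCy'⟩⟩ := ht
  rw [Metric.mem_closedBall] at hy hy'
  intro hinj
  have hball : ∀ x a : V, dist a x ≤ ‖x‖ / 2 → x ≠ 0 → a ≠ 0 := by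
    rintro x a h hx rfl
    rw [dist_zero_left] at h
    have := norm_pos_iff.2 hx
    linarith
  have := hinj (hball v y (hy.trans hη2) hv) (hball w y' (hy'.trans hη3) hw)
    (hCy.trans (hvw.trans hCy'.symm))
  subst this
  have := dist_triangle_left v w y
  linarith

/-- Connectedness of `[0, 1]`, starting from the identity. The starting condition matters: in the
plane, a homogeneous surjective immersion off the origin can be a nontrivial covering. -/
theorem injOn [Nontrivial V] (hC : IsHomogIsotopy C) {t : ℝ} (ht : t ∈ Icc (0 : ℝ) 1) :
    InjOn (fun v => C (t, v)) {0}ᶜ := by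
  have : PreconnectedSpace (Icc (0 : ℝ) 1) := Subtype.preconnectedSpace isPreconnected_Icc
  have h := IsClopen.eq_univ (s := {t : Icc (0 : ℝ) 1 | InjOn (fun v => C (t, v)) {0}ᶜ})
    ⟨hC.isClosed_setOf_injOn, hC.isOpen_setOf_injOn⟩
    ⟨⟨0, by simp⟩, by
      intro v hv w hw h
      simp only at h
      rwa [hC.zero_eq v hv, hC.zero_eq w hw] at h⟩
  have h1 : (⟨t, ht⟩ : Icc (0 : ℝ) 1) ∈ {t : Icc (0 : ℝ) 1 | InjOn (fun v => C (t, v)) {0}ᶜ} := by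
    rw [h]; trivial
  exact h1

/-- The inverse isotopy. -/
theorem exists_inverse [Nontrivial V] (hC : IsHomogIsotopy C) :
    ∃ D : ℝ × V → V, ContDiffOn ℝ ∞ D (Icc 0 1 ×ˢ {0}ᶜ) ∧
      (∀ t ∈ Icc (0 : ℝ) 1, ∀ u, u ≠ 0 → D (t, u) ≠ 0) ∧
      (∀ t ∈ Icc (0 : ℝ) 1, ∀ u, u ≠ 0 → C (t, D (t, u)) = u) ∧
      (∀ t ∈ Icc (0 : ℝ) 1, ∀ v, v ≠ 0 → D (t, C (t, v)) = v) ∧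
      ∀ t ∈ Icc (0 : ℝ) 1, ∀ u, u ≠ 0 → ∀ a : ℝ, 0 < a → D (t, a • u) = a • D (t, u) := by
  have hex : ∀ z : ℝ × V, ∃ v, z.1 ∈ Icc (0 : ℝ) 1 → z.2 ≠ 0 → v ≠ 0 ∧ C (z.1, v) = z.2 := by
    intro z
    by_cases h : z.1 ∈ Icc (0 : ℝ) 1 ∧ z.2 ≠ 0
    · obtain ⟨v, hv⟩ := hC.surj z.1 h.1 z.2 h.2
      exact ⟨v, fun _ _ => hv⟩
    · exact ⟨0, fun h1 h2 => absurd ⟨h1, h2⟩ h⟩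
  choose D hD using hex
  have hleft : ∀ t ∈ Icc (0 : ℝ) 1, ∀ v, v ≠ 0 → D (t, C (t, v)) = v := fun t ht v hv => by
    have := hD (t, C (t, v)) ht (hC.ne_zero t ht v hv)
    exact hC.injOn ht this.1 hv this.2
  refine ⟨D, ?_, fun t ht u hu => (hD (t, u) ht hu).1, fun t ht u hu => (hD (t, u) ht hu).2,
    hleft, fun t ht u hu a ha => ?_⟩
  · exact contDiffOn_fiberwise_inverse (uniqueDiffOn_Icc zero_lt_one) isOpen_compl_singleton
      isOpen_compl_singleton hC.smooth hC.injective (fun t ht => hC.injOn ht)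
      fun t ht u hu => hD (t, u) ht hu
  · obtain ⟨h1, h2⟩ := hD (t, u) ht hu
    have h3 : a • u = C (t, a • D (t, u)) := by
      rw [hC.homog t ht _ h1 a ha]; exact congrArg _ h2.symm
    rw [h3, hleft t ht _ (smul_ne_zero ha.ne' h1)]

end IsHomogIsotopy

end Homogeneous

/-! ### Interpolation between a homogeneous map near the origin and the identity far away. -/

section Cutoff

theorem exists_smooth_antitone_cutoff {r : ℝ} (hr : 0 < r) :
    ∃ χ : ℝ → ℝ, ContDiff ℝ ∞ χ ∧ Antitone χ ∧ (∀ x, χ x ∈ Icc (0 : ℝ) 1) ∧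
      (∀ x ≤ r / 2, χ x = 1) ∧ ∀ x, r ≤ x → χ x = 0 := by
  refine ⟨fun x => Real.smoothTransition ((r - x) / (r / 2)), ?_, ?_, ?_, ?_, ?_⟩
  · exact Real.smoothTransition.contDiff.comp (by fun_prop)
  · intro x y hxy
    refine Real.smoothTransition.monotone ?_
    gcongr
  · exact fun x => ⟨Real.smoothTransition.nonneg _, Real.smoothTransition.le_one _⟩
  · intro x hx
    refine Real.smoothTransition.one_of_one_le ?_
    rw [le_div_iff₀ (half_pos hr)]
    linarith
  · intro x hx
    refine Real.smoothTransition.zero_of_nonpos ?_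
    exact div_nonpos_of_nonpos_of_nonneg (by linarith) (half_pos hr).le

variable {V : Type} [NormedAddCommGroup V] [InnerProductSpace ℝ V]

/-- The map `x ↦ (1 - χ(|x|) (1 - l(x))) x` interpolates between `x ↦ l(x) x` near the origin and
the identity. -/
noncomputable def radialMap (χ : ℝ → ℝ) (l : ℝ × V → ℝ) (z : ℝ × V) : V :=
  (1 - χ ‖z.2‖ * (1 - l z)) • z.2

variable {χ : ℝ → ℝ} {l : ℝ × V → ℝ}

theorem contDiffOn_norm_snd : ContDiffOn ℝ ∞ (fun z : ℝ × V => ‖z.2‖) (Icc (0 : ℝ) 1 ×ˢ {0}ᶜ) :=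
  contDiffOn_snd.norm ℝ fun _ hz => hz.2

theorem contDiffOn_radialFactor (hχ : ContDiff ℝ ∞ χ)
    (hl : ContDiffOn ℝ ∞ l (Icc (0 : ℝ) 1 ×ˢ {0}ᶜ)) :
    ContDiffOn ℝ ∞ (fun z : ℝ × V => 1 - χ ‖z.2‖ * (1 - l z)) (Icc (0 : ℝ) 1 ×ˢ {0}ᶜ) :=
  contDiffOn_const.sub ((hχ.comp_contDiffOn contDiffOn_norm_snd).mul (contDiffOn_const.sub hl))

theorem contDiffOn_radialMap (hχ : ContDiff ℝ ∞ χ)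
    (hl : ContDiffOn ℝ ∞ l (Icc (0 : ℝ) 1 ×ˢ {0}ᶜ)) :
    ContDiffOn ℝ ∞ (radialMap χ l) (Icc (0 : ℝ) 1 ×ˢ {0}ᶜ) :=
  (contDiffOn_radialFactor hχ hl).smul contDiffOn_snd

theorem radialFactor_pos (hχ01 : ∀ x, χ x ∈ Icc (0 : ℝ) 1) {x a : ℝ} (ha : 0 < a) (ha' : a ≤ 1) :
    0 < 1 - χ x * (1 - a) := by
  have h1 := hχ01 x
  have : χ x * (1 - a) ≤ 1 * (1 - a) := mul_le_mul_of_nonneg_right h1.2 (by linarith)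
  linarith

theorem radialFactor_mono (hχa : Antitone χ) {x y a : ℝ} (ha' : a ≤ 1) (hxy : x ≤ y) :
    1 - χ x * (1 - a) ≤ 1 - χ y * (1 - a) := by
  have : χ y * (1 - a) ≤ χ x * (1 - a) := mul_le_mul_of_nonneg_right (hχa hxy) (by linarith)
  linarith

theorem radialMap_ne_zero (hχ01 : ∀ x, χ x ∈ Icc (0 : ℝ) 1)
    (hl01 : ∀ t ∈ Icc (0 : ℝ) 1, ∀ v, v ≠ 0 → 0 < l (t, v) ∧ l (t, v) ≤ 1) {t : ℝ}
    (ht : t ∈ Icc (0 : ℝ) 1) {v : V} (hv : v ≠ 0) : radialMap χ l (t, v) ≠ 0 :=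
  smul_ne_zero (radialFactor_pos hχ01 (hl01 t ht v hv).1 (hl01 t ht v hv).2).ne' hv

/-- Rays are preserved. Along a ray the positive factor is nondecreasing, because `χ` decreases and
`l ≤ 1` is constant there, so the radius of the image strictly increases. -/
theorem radialMap_injOn (hχ01 : ∀ x, χ x ∈ Icc (0 : ℝ) 1) (hχa : Antitone χ)
    (hl01 : ∀ t ∈ Icc (0 : ℝ) 1, ∀ v, v ≠ 0 → 0 < l (t, v) ∧ l (t, v) ≤ 1)
    (hlh : ∀ t ∈ Icc (0 : ℝ) 1, ∀ v, v ≠ 0 → ∀ a : ℝ, 0 < a → l (t, a • v) = l (t, v)) {t : ℝ}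
    (ht : t ∈ Icc (0 : ℝ) 1) : InjOn (fun v => radialMap χ l (t, v)) {0}ᶜ := by
  have key : ∀ v : V, v ≠ 0 → ∀ a : ℝ, 1 ≤ a →
      radialMap χ l (t, a • v) = radialMap χ l (t, v) → a = 1 := by
    intro v hv a ha h
    have ha0 : 0 < a := by linarith
    obtain ⟨h0, h1⟩ := hl01 t ht v hv
    simp only [radialMap, hlh t ht v hv a ha0, smul_smul] at h
    have h2 := smul_left_injective ℝ hv h
    have h3 : ‖v‖ ≤ ‖a • v‖ := by
      rw [norm_smul, Real.norm_of_nonneg ha0.le]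
      exact le_mul_of_one_le_left (norm_nonneg _) ha
    have h4 := radialFactor_mono hχa h1 h3
    have h5 := radialFactor_pos hχ01 (x := ‖v‖) h0 h1
    by_contra hne
    have h6 : 1 < a := lt_of_le_of_ne ha (Ne.symm hne)
    have h7 : (1 - χ ‖v‖ * (1 - l (t, v))) * 1 < (1 - χ ‖a • v‖ * (1 - l (t, v))) * a :=
      mul_lt_mul' h4 h6 zero_le_one (h5.trans_le h4)
    linarith
  intro v hv w hw h
  have hm1 := radialFactor_pos hχ01 (x := ‖v‖) (hl01 t ht v hv).1 (hl01 t ht v hv).2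
  have hm2 := radialFactor_pos hχ01 (x := ‖w‖) (hl01 t ht w hw).1 (hl01 t ht w hw).2
  obtain ⟨a, ha, rfl⟩ : ∃ a : ℝ, 0 < a ∧ w = a • v := by
    refine ⟨(1 - χ ‖w‖ * (1 - l (t, w)))⁻¹ * (1 - χ ‖v‖ * (1 - l (t, v))),
      mul_pos (inv_pos.2 hm2) hm1, ?_⟩
    have h' : (1 - χ ‖v‖ * (1 - l (t, v))) • v = (1 - χ ‖w‖ * (1 - l (t, w))) • w := h
    rw [mul_smul, h', smul_smul, inv_mul_cancel₀ hm2.ne', one_smul]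
  rcases le_total 1 a with h1 | h1
  · rw [key v hv a h1 h.symm, one_smul]
  · have := key (a • v) hw a⁻¹ ((one_le_inv₀ ha).2 h1) (by
      rw [smul_smul, inv_mul_cancel₀ ha.ne', one_smul]; exact h)
    rw [inv_eq_one.1 this, one_smul]

/-- The intermediate value theorem on the ray through `y`, since the factor is `1` beyond radius
`r`. -/
theorem radialMap_surj (hχ : Continuous χ) {r : ℝ} (hχ0 : ∀ x, r ≤ x → χ x = 0)
    (hlh : ∀ t ∈ Icc (0 : ℝ) 1, ∀ v, v ≠ 0 → ∀ a : ℝ, 0 < a → l (t, a • v) = l (t, v)) {t : ℝ}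
    (ht : t ∈ Icc (0 : ℝ) 1) {y : V} (hy : y ≠ 0) : ∃ x, x ≠ 0 ∧ radialMap χ l (t, x) = y := by
  have hy' : 0 < ‖y‖ := norm_pos_iff.2 hy
  set g : ℝ → ℝ := fun a => a * (1 - χ (a * ‖y‖) * (1 - l (t, y))) with hg
  have hgc : Continuous g := by fun_prop
  set R := max 1 (r / ‖y‖) with hR
  have hR1 : 1 ≤ R := le_max_left _ _
  have hgR : g R = R := by
    have : r ≤ R * ‖y‖ := by
      rw [← div_le_iff₀ hy']; exact le_max_right _ _
    simp [hg, hχ0 _ this]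
  have hg0 : g 0 = 0 := by simp [hg]
  obtain ⟨a, ha, hga⟩ := intermediate_value_Icc (zero_le_one.trans hR1) hgc.continuousOn
    (show (1 : ℝ) ∈ Icc (g 0) (g R) by rw [hg0, hgR]; exact ⟨zero_le_one, hR1⟩)
  have ha0 : 0 < a := by
    refine lt_of_le_of_ne ha.1 ?_
    rintro rfl
    rw [hg0] at hga
    exact zero_ne_one hga
  refine ⟨a • y, smul_ne_zero ha0.ne' hy, ?_⟩
  simp only [radialMap, hlh t ht y hy a ha0, norm_smul, Real.norm_of_nonneg ha0.le, smul_smul]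
  rw [mul_comm]
  simp only [hg] at hga
  rw [hga, one_smul]

/-- The derivative is `m • id` plus a rank one map onto the line of `x`, so a kernel vector is
radial. On radial vectors it is multiplication by `m x + m' x`, which is positive. -/
theorem radialMap_injective_spaceDeriv (hχ : ContDiff ℝ ∞ χ) (hχ01 : ∀ x, χ x ∈ Icc (0 : ℝ) 1)
    (hχa : Antitone χ) (hl : ContDiffOn ℝ ∞ l (Icc (0 : ℝ) 1 ×ˢ {0}ᶜ))
    (hl01 : ∀ t ∈ Icc (0 : ℝ) 1, ∀ v, v ≠ 0 → 0 < l (t, v) ∧ l (t, v) ≤ 1)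
    (hlh : ∀ t ∈ Icc (0 : ℝ) 1, ∀ v, v ≠ 0 → ∀ a : ℝ, 0 < a → l (t, a • v) = l (t, v)) {t : ℝ}
    (ht : t ∈ Icc (0 : ℝ) 1) {x : V} (hx : x ≠ 0) :
    Function.Injective (spaceDeriv (radialMap χ l) (Icc 0 1) {0}ᶜ (t, x)) := by
  set m : V → ℝ := fun w => 1 - χ ‖w‖ * (1 - l (t, w)) with hm
  have hmd := hasFDerivAt_spaceDeriv isOpen_compl_singleton (contDiffOn_radialFactor hχ hl) ht hx
  set m' := spaceDeriv (fun z : ℝ × V => 1 - χ ‖z.2‖ * (1 - l z)) (Icc 0 1) {0}ᶜ (t, x) with hm'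
  have hmd' : HasFDerivAt m m' x := hmd
  have hmpos : 0 < m x := radialFactor_pos hχ01 (hl01 t ht x hx).1 (hl01 t ht x hx).2
  have hder : HasFDerivAt (fun w => radialMap χ l (t, w))
      (m x • ContinuousLinearMap.id ℝ V + m'.smulRight x) x := hmd'.smul (hasFDerivAt_id x)
  have heq := (hasFDerivAt_spaceDeriv isOpen_compl_singleton (contDiffOn_radialMap hχ hl) ht
    hx).unique hder
  rw [heq]
  -- The right difference quotients along the ray are nonnegative because the factor is
  -- nondecreasing in the radius.
  have hm'x : 0 ≤ m' x := by
    have h1 : HasDerivAt (fun a : ℝ => m (x + a • x)) (m' x) 0 := by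
      have h2 : HasDerivAt (fun a : ℝ => x + a • x) x 0 := by
        simpa using ((hasDerivAt_id (0 : ℝ)).smul_const x).const_add x
      have h3 : HasFDerivAt m m' (x + (0 : ℝ) • x) := by simpa using hmd'
      exact h3.comp_hasDerivAt 0 h2
    have h4 := h1.tendsto_slope_zero_right
    refine ge_of_tendsto h4 ?_
    filter_upwards [self_mem_nhdsWithin] with a ha
    have ha' : 0 < a := ha
    simp only [zero_add, zero_smul, add_zero, smul_eq_mul]
    refine mul_nonneg (inv_nonneg.2 ha'.le) (sub_nonneg.2 ?_)
    have e1 : x + a • x = (1 + a) • x := by module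
    have h5 : ‖x‖ ≤ ‖(1 + a) • x‖ := by
      rw [norm_smul, Real.norm_of_nonneg (by linarith)]
      exact le_mul_of_one_le_left (norm_nonneg _) (by linarith)
    rw [e1]
    simp only [hm, hlh t ht x hx (1 + a) (by linarith)]
    exact radialFactor_mono hχa (hl01 t ht x hx).2 h5
  rw [injective_iff_map_eq_zero]
  intro w hw
  have hw' : m x • w + m' w • x = 0 := by simpa using hw
  obtain ⟨b, hw1⟩ : ∃ b : ℝ, w = b • x := by
    have : m x • w = -(m' w • x) := eq_neg_of_add_eq_zero_left hw'
    refine ⟨(m x)⁻¹ * -(m' w), ?_⟩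
    rw [mul_smul, neg_smul, ← this, smul_smul, inv_mul_cancel₀ hmpos.ne', one_smul]
  rw [hw1, map_smul, smul_eq_mul, smul_smul, ← add_smul] at hw'
  have h2 := (smul_eq_zero.1 hw').resolve_right hx
  have h3 : b * (m x + m' x) = 0 := by linarith
  have h4 : b = 0 := (mul_eq_zero.1 h3).resolve_right (by linarith)
  rw [hw1, h4, zero_smul]

theorem exists_radialMap_inverse [FiniteDimensional ℝ V] (hχ : ContDiff ℝ ∞ χ)
    (hχ01 : ∀ x, χ x ∈ Icc (0 : ℝ) 1) (hχa : Antitone χ) {r : ℝ} (hχ0 : ∀ x, r ≤ x → χ x = 0)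
    (hl : ContDiffOn ℝ ∞ l (Icc (0 : ℝ) 1 ×ˢ {0}ᶜ))
    (hl01 : ∀ t ∈ Icc (0 : ℝ) 1, ∀ v, v ≠ 0 → 0 < l (t, v) ∧ l (t, v) ≤ 1)
    (hlh : ∀ t ∈ Icc (0 : ℝ) 1, ∀ v, v ≠ 0 → ∀ a : ℝ, 0 < a → l (t, a • v) = l (t, v)) :
    ∃ R : ℝ × V → V, ContDiffOn ℝ ∞ R (Icc 0 1 ×ˢ {0}ᶜ) ∧
      (∀ t ∈ Icc (0 : ℝ) 1, ∀ u, u ≠ 0 → R (t, u) ≠ 0) ∧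
      (∀ t ∈ Icc (0 : ℝ) 1, ∀ u, u ≠ 0 → radialMap χ l (t, R (t, u)) = u) ∧
      (∀ t ∈ Icc (0 : ℝ) 1, ∀ v, v ≠ 0 → R (t, radialMap χ l (t, v)) = v) := by
  have hex : ∀ z : ℝ × V, ∃ v, z.1 ∈ Icc (0 : ℝ) 1 → z.2 ≠ 0 →
      v ≠ 0 ∧ radialMap χ l (z.1, v) = z.2 := by
    intro z
    by_cases h : z.1 ∈ Icc (0 : ℝ) 1 ∧ z.2 ≠ 0
    · obtain ⟨v, hv⟩ := radialMap_surj hχ.continuous hχ0 hlh h.1 h.2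
      exact ⟨v, fun _ _ => hv⟩
    · exact ⟨0, fun h1 h2 => absurd ⟨h1, h2⟩ h⟩
  choose R hR using hex
  refine ⟨R, ?_, fun t ht u hu => (hR (t, u) ht hu).1, fun t ht u hu => (hR (t, u) ht hu).2,
    fun t ht v hv => ?_⟩
  · exact contDiffOn_fiberwise_inverse (uniqueDiffOn_Icc zero_lt_one) isOpen_compl_singleton
      isOpen_compl_singleton (contDiffOn_radialMap hχ hl)
      (fun t ht v hv => radialMap_injective_spaceDeriv hχ hχ01 hχa hl hl01 hlh ht hv)
      (fun t ht => radialMap_injOn hχ01 hχa hl01 hlh ht)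
      fun t ht u hu => hR (t, u) ht hu
  · have := hR (t, radialMap χ l (t, v)) ht (radialMap_ne_zero hχ01 hl01 ht hv)
    exact radialMap_injOn hχ01 hχa hl01 hlh ht this.1 hv this.2

/-- The norm-preserving map with the direction of `C`, at a time that is cut off by `χ`. -/
noncomputable def angularMap (χ : ℝ → ℝ) (C : ℝ × V → V) (z : ℝ × V) : V :=
  (‖z.2‖ * ‖C (z.1 * χ ‖z.2‖, z.2)‖⁻¹) • C (z.1 * χ ‖z.2‖, z.2)

theorem mul_cutoff_mem (hχ01 : ∀ x, χ x ∈ Icc (0 : ℝ) 1) {t : ℝ} (ht : t ∈ Icc (0 : ℝ) 1) (x : ℝ) :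
    t * χ x ∈ Icc (0 : ℝ) 1 :=
  ⟨mul_nonneg ht.1 (hχ01 x).1, mul_le_one₀ ht.2 (hχ01 x).1 (hχ01 x).2⟩

theorem contDiffOn_angularMap {C : ℝ × V → V} (hχ : ContDiff ℝ ∞ χ)
    (hχ01 : ∀ x, χ x ∈ Icc (0 : ℝ) 1) (hC : ContDiffOn ℝ ∞ C (Icc (0 : ℝ) 1 ×ˢ {0}ᶜ))
    (hne : ∀ t ∈ Icc (0 : ℝ) 1, ∀ v, v ≠ 0 → C (t, v) ≠ 0) :
    ContDiffOn ℝ ∞ (angularMap χ C) (Icc (0 : ℝ) 1 ×ˢ {0}ᶜ) := by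
  have h1 : ContDiffOn ℝ ∞ (fun z : ℝ × V => C (z.1 * χ ‖z.2‖, z.2)) (Icc (0 : ℝ) 1 ×ˢ {0}ᶜ) := by
    refine hC.comp (f := fun z : ℝ × V => (z.1 * χ ‖z.2‖, z.2)) ?_ ?_
    · exact (contDiffOn_fst.mul (hχ.comp_contDiffOn contDiffOn_norm_snd)).prodMk contDiffOn_snd
    · exact fun z hz => ⟨mul_cutoff_mem hχ01 hz.1 _, hz.2⟩
  have h2 : ∀ z ∈ Icc (0 : ℝ) 1 ×ˢ ({0}ᶜ : Set V), C (z.1 * χ ‖z.2‖, z.2) ≠ 0 :=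
    fun z hz => hne _ (mul_cutoff_mem hχ01 hz.1 _) _ hz.2
  exact (contDiffOn_norm_snd.mul ((h1.norm ℝ h2).inv fun z hz => norm_ne_zero_iff.2 (h2 z hz))).smul
    h1

theorem norm_angularMap {C : ℝ × V → V} (hχ01 : ∀ x, χ x ∈ Icc (0 : ℝ) 1)
    (hne : ∀ t ∈ Icc (0 : ℝ) 1, ∀ v, v ≠ 0 → C (t, v) ≠ 0) {t : ℝ} (ht : t ∈ Icc (0 : ℝ) 1)
    {v : V} (hv : v ≠ 0) : ‖angularMap χ C (t, v)‖ = ‖v‖ := by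
  have : ‖C (t * χ ‖v‖, v)‖ ≠ 0 := norm_ne_zero_iff.2 (hne _ (mul_cutoff_mem hχ01 ht _) _ hv)
  simp [angularMap, norm_smul, this]

/-- Since norms are preserved, both maps use the same cut-off time `t * χ ‖u‖`. At that time `C`
inverts `D`, and homogeneity absorbs the rescalings. -/
theorem angularMap_angularMap {C D : ℝ × V → V} (hχ01 : ∀ x, χ x ∈ Icc (0 : ℝ) 1)
    (hCh : ∀ t ∈ Icc (0 : ℝ) 1, ∀ v, v ≠ 0 → ∀ a : ℝ, 0 < a → C (t, a • v) = a • C (t, v))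
    (hDne : ∀ t ∈ Icc (0 : ℝ) 1, ∀ v, v ≠ 0 → D (t, v) ≠ 0)
    (hCD : ∀ t ∈ Icc (0 : ℝ) 1, ∀ u, u ≠ 0 → C (t, D (t, u)) = u) {t : ℝ}
    (ht : t ∈ Icc (0 : ℝ) 1) {u : V} (hu : u ≠ 0) :
    angularMap χ C (t, angularMap χ D (t, u)) = u := by
  have hτ := mul_cutoff_mem hχ01 ht ‖u‖
  have hn := norm_angularMap hχ01 hDne ht hu
  set τ := t * χ ‖u‖ with hτdef
  have hd : 0 < ‖D (τ, u)‖ := norm_pos_iff.2 (hDne τ hτ u hu)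
  have hu' : 0 < ‖u‖ := norm_pos_iff.2 hu
  have h1 : C (τ, angularMap χ D (t, u)) = (‖u‖ * ‖D (τ, u)‖⁻¹) • u := by
    have : angularMap χ D (t, u) = (‖u‖ * ‖D (τ, u)‖⁻¹) • D (τ, u) := rfl
    rw [this, hCh τ hτ _ (hDne τ hτ u hu) _ (by positivity), hCD τ hτ u hu]
  have h2 : angularMap χ C (t, angularMap χ D (t, u)) =
      (‖u‖ * ‖C (τ, angularMap χ D (t, u))‖⁻¹) • C (τ, angularMap χ D (t, u)) := by
    simp only [angularMap] at hn ⊢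
    rw [hn]
  rw [h2, h1, norm_smul, smul_smul, Real.norm_of_nonneg (by positivity)]
  have : ‖u‖ * (‖u‖ * ‖D (τ, u)‖⁻¹ * ‖u‖)⁻¹ * (‖u‖ * ‖D (τ, u)‖⁻¹) = 1 := by
    field_simp
  rw [this, one_smul]

/-- An isotopy of homogeneous maps has, up to a constant factor, an inverse isotopy near the origin
that extends by the identity outside of a given ball. -/
theorem IsHomogIsotopy.exists_cutoff_inverse [FiniteDimensional ℝ V] [Nontrivial V]
    {C : ℝ × V → V} (hC : IsHomogIsotopy C) {r : ℝ} (hr : 0 < r) :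
    ∃ c > (0 : ℝ), ∃ r₁ > (0 : ℝ), ∃ M : ℝ, ∃ D φ ψ : ℝ × V → V,
      (ContDiffOn ℝ ∞ D (Icc 0 1 ×ˢ {0}ᶜ) ∧
        ∀ t ∈ Icc (0 : ℝ) 1, ∀ u, u ≠ 0 → D (t, u) ≠ 0 ∧ C (t, D (t, u)) = c • u ∧
          D (t, c⁻¹ • C (t, u)) = u ∧ ‖D (t, u)‖ ≤ M * ‖u‖) ∧
      (ContDiffOn ℝ ∞ φ (Icc 0 1 ×ˢ {0}ᶜ) ∧ ContDiffOn ℝ ∞ ψ (Icc 0 1 ×ˢ {0}ᶜ) ∧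
        ∀ t ∈ Icc (0 : ℝ) 1, ∀ u, u ≠ 0 → φ (t, u) ≠ 0 ∧ ψ (t, u) ≠ 0 ∧ φ (t, ψ (t, u)) = u ∧
          ψ (t, φ (t, u)) = u) ∧
      (∀ t ∈ Icc (0 : ℝ) 1, ∀ u, r ≤ ‖u‖ → φ (t, u) = u ∧ ψ (t, u) = u) ∧
      ∀ t ∈ Icc (0 : ℝ) 1, ∀ s : ℝ, 0 < s → ∀ v, v ≠ 0 → s * ‖v‖ < r₁ →
        φ (t, s • v) = s • D (t, v) ∧ ‖s • D (t, v)‖ < r := by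
  obtain ⟨D, hDs, hDne, hCD, hDC, hDh⟩ := hC.exists_inverse
  -- The constant `c` is an upper bound for `‖C (t, v)‖ / ‖v‖`. Dividing by it makes the radial
  -- factor `l` at most `1`, which the monotonicity of `radialMap` requires.
  obtain ⟨_, _, c, hc, hcb⟩ := exists_norm_bounds hC.smooth.continuousOn hC.ne_zero hC.homog
  obtain ⟨_, _, M, hM, hMb⟩ := exists_norm_bounds hDs.continuousOn hDne hDh
  obtain ⟨χ, hχ, hχa, hχ01, hχ1, hχ0⟩ := exists_smooth_antitone_cutoff hr
  set l : ℝ × V → ℝ := fun z => ‖C z‖ * (c * ‖z.2‖)⁻¹ with hl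
  have hls : ContDiffOn ℝ ∞ l (Icc (0 : ℝ) 1 ×ˢ {0}ᶜ) := by
    refine (hC.smooth.norm ℝ fun z hz => hC.ne_zero z.1 hz.1 z.2 hz.2).mul
      ((contDiffOn_const.mul contDiffOn_norm_snd).inv fun z hz => ?_)
    exact mul_ne_zero hc.ne' (norm_ne_zero_iff.2 hz.2)
  have hl01 : ∀ t ∈ Icc (0 : ℝ) 1, ∀ v, v ≠ 0 → 0 < l (t, v) ∧ l (t, v) ≤ 1 := by
    intro t ht v hv
    have h1 := norm_pos_iff.2 (hC.ne_zero t ht v hv)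
    have h2 := norm_pos_iff.2 hv
    refine ⟨by simp only [hl]; positivity, ?_⟩
    simp only [hl]
    rw [← div_eq_mul_inv, div_le_one (by positivity)]
    exact (hcb t ht v hv).2
  have hlh : ∀ t ∈ Icc (0 : ℝ) 1, ∀ v, v ≠ 0 → ∀ a : ℝ, 0 < a → l (t, a • v) = l (t, v) := by
    intro t ht v hv a ha
    have h2 := norm_pos_iff.2 hv
    simp only [hl, hC.homog t ht v hv a ha, norm_smul, Real.norm_of_nonneg ha.le]
    field_simp
  obtain ⟨R, hRs, hRne, hρR, hRρ⟩ := exists_radialMap_inverse hχ hχ01 hχa hχ0 hls hl01 hlh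
  have hαne : ∀ t ∈ Icc (0 : ℝ) 1, ∀ u, u ≠ 0 → angularMap χ D (t, u) ≠ 0 := fun t ht u hu => by
    rw [← norm_ne_zero_iff, norm_angularMap hχ01 hDne ht hu]; exact norm_ne_zero_iff.2 hu
  have hane : ∀ t ∈ Icc (0 : ℝ) 1, ∀ u, u ≠ 0 → angularMap χ C (t, u) ≠ 0 := fun t ht u hu => by
    rw [← norm_ne_zero_iff, norm_angularMap hχ01 hC.ne_zero ht hu]; exact norm_ne_zero_iff.2 hu
  have hρne : ∀ t ∈ Icc (0 : ℝ) 1, ∀ u, u ≠ 0 → radialMap χ l (t, u) ≠ 0 :=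
    fun t ht u hu => radialMap_ne_zero hχ01 hl01 ht hu
  have hφψ : ∀ t ∈ Icc (0 : ℝ) 1, ∀ u, u ≠ 0 →
      R (t, angularMap χ D (t, angularMap χ C (t, radialMap χ l (t, u)))) = u := by
    intro t ht u hu
    rw [angularMap_angularMap hχ01 hDh hC.ne_zero hDC ht (hρne t ht u hu), hRρ t ht u hu]
  have hD0 : ∀ u, u ≠ 0 → D (0, u) = u := fun u hu => by
    have := hDC 0 (by simp) u hu
    rwa [hC.zero_eq u hu] at this
  have hfar : ∀ (B : ℝ × V → V), (∀ u, u ≠ 0 → B (0, u) = u) → ∀ t, ∀ u, r ≤ ‖u‖ →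
      angularMap χ B (t, u) = u := by
    intro B hB t u hu
    have hu0 : 0 < ‖u‖ := hr.trans_le hu
    simp only [angularMap, hχ0 _ hu, mul_zero, hB u (norm_pos_iff.1 hu0)]
    rw [mul_inv_cancel₀ hu0.ne', one_smul]
  have hfarρ : ∀ t, ∀ u, r ≤ ‖u‖ → radialMap χ l (t, u) = u := by
    intro t u hu
    simp [radialMap, hχ0 _ hu]
  -- The map `ψ` rescales radially and then turns directions by `C`, and `φ` undoes this in reverse
  -- order. The radius `r₁` is such that `‖D (t, c • y)‖ ≤ r / 2` for `‖y‖ < r₁`, where the cutoff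
  -- equals `1`.
  refine ⟨c, hc, r / 2 / (M * c), by positivity, M * c, fun z => D (z.1, c • z.2),
    fun z => R (z.1, angularMap χ D z), fun z => angularMap χ C (z.1, radialMap χ l z),
    ⟨?_, ?_⟩, ⟨?_, ?_, ?_⟩, ?_, ?_⟩
  · refine hDs.comp (f := fun z : ℝ × V => (z.1, c • z.2)) (ContDiff.contDiffOn (by fun_prop)) ?_
    exact fun z hz => ⟨hz.1, smul_ne_zero hc.ne' hz.2⟩
  · intro t ht u hu
    have hcu : c • u ≠ 0 := smul_ne_zero hc.ne' hu
    refine ⟨hDne t ht _ hcu, hCD t ht _ hcu, ?_, ?_⟩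
    · simp only [smul_smul, mul_inv_cancel₀ hc.ne', one_smul]
      exact hDC t ht u hu
    · refine (hMb t ht _ hcu).2.trans (le_of_eq ?_)
      rw [norm_smul, Real.norm_of_nonneg hc.le, mul_assoc]
  · exact hRs.comp (f := fun z : ℝ × V => (z.1, angularMap χ D z))
      (contDiffOn_fst.prodMk (contDiffOn_angularMap hχ hχ01 hDs hDne))
      fun z hz => ⟨hz.1, hαne z.1 hz.1 z.2 hz.2⟩
  · exact (contDiffOn_angularMap hχ hχ01 hC.smooth hC.ne_zero).comp
      (f := fun z : ℝ × V => (z.1, radialMap χ l z))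
      (contDiffOn_fst.prodMk (contDiffOn_radialMap hχ hls))
      fun z hz => ⟨hz.1, hρne z.1 hz.1 z.2 hz.2⟩
  · intro t ht u hu
    refine ⟨hRne t ht _ (hαne t ht u hu), hane t ht _ (hρne t ht u hu), hφψ t ht u hu, ?_⟩
    simp only
    rw [hρR t ht _ (hαne t ht u hu), angularMap_angularMap hχ01 hC.homog hDne hCD ht hu]
  · intro t ht u hu
    have hu0 : u ≠ 0 := norm_pos_iff.1 (hr.trans_le hu)
    refine ⟨?_, ?_⟩
    · simp only
      rw [hfar D hD0 t u hu]
      have := hRρ t ht u hu0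
      rwa [hfarρ t u hu] at this
    · simp only
      rw [hfarρ t u hu, hfar C hC.zero_eq t u hu]
  · intro t ht s hs v hv hsv
    have hcv : c • v ≠ 0 := smul_ne_zero hc.ne' hv
    have hsD : s • D (t, c • v) = D (t, c • (s • v)) := by
      rw [smul_comm c s v, hDh t ht _ hcv s hs]
    set y := s • v with hy
    have hy0 : y ≠ 0 := smul_ne_zero hs.ne' hv
    have hyn : ‖y‖ < r / 2 / (M * c) := by
      rwa [hy, norm_smul, Real.norm_of_nonneg hs.le]
    have hcy : c • y ≠ 0 := smul_ne_zero hc.ne' hy0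
    set x := D (t, c • y) with hx
    have hx0 : x ≠ 0 := hDne t ht _ hcy
    have hx0' := norm_pos_iff.2 hx0
    have hxn : ‖x‖ ≤ r / 2 := by
      refine (hMb t ht _ hcy).2.trans ?_
      rw [norm_smul, Real.norm_of_nonneg hc.le, ← mul_assoc, mul_comm]
      rw [lt_div_iff₀ (by positivity)] at hyn
      exact hyn.le
    have hCx : C (t, x) = c • y := hCD t ht _ hcy
    have hlx := hl01 t ht x hx0
    have hρx : radialMap χ l (t, x) = l (t, x) • x := by
      simp [radialMap, hχ1 _ hxn]
    have hρn : ‖l (t, x) • x‖ ≤ r / 2 := by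
      rw [norm_smul, Real.norm_of_nonneg hlx.1.le]
      exact (mul_le_of_le_one_left (norm_nonneg _) hlx.2).trans hxn
    -- Where the cutoff is `1`, the radial map supplies the norm of `c⁻¹ • C (t, x)` and the angular
    -- map its direction.
    have hψx : angularMap χ C (t, radialMap χ l (t, x)) = y := by
      rw [hρx]
      simp only [angularMap, hχ1 _ hρn, mul_one, hC.homog t ht x hx0 _ hlx.1, hCx]
      rw [smul_smul, smul_smul, norm_smul, norm_smul, Real.norm_of_nonneg hlx.1.le,
        norm_smul, Real.norm_of_nonneg hc.le, mul_assoc _ (l (t, x)) c]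
      have hy' := norm_pos_iff.2 hy0
      have hlx' : l (t, x) = c * ‖y‖ * (c * ‖x‖)⁻¹ := by
        simp only [hl, hCx, norm_smul, Real.norm_of_nonneg hc.le]
      have h0 := hlx.1.ne'
      have : l (t, x) * ‖x‖ * (l (t, x) * (c * ‖y‖))⁻¹ * (l (t, x) * c) = 1 := by
        rw [hlx']; field_simp
      rw [this, one_smul]
    have := hφψ t ht x hx0
    rw [hψx] at this
    refine ⟨?_, ?_⟩
    · simp only
      rw [this, hsD]
    · simp only
      rw [hsD]
      linarith

end Cutoff

/-! ### Families of cones with linear images -/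

section LinearCones

variable {V : Type} [NormedAddCommGroup V] [NormedSpace ℝ V] [FiniteDimensional ℝ V]
  {W : Type*} [NormedAddCommGroup W] [NormedSpace ℝ W] [FiniteDimensional ℝ W]

/-- The least squares formula `(B* B)⁻¹ B*` depends smoothly on `t`. Here `T t : W → V*` plays the
role of `B*` for the inner product on `W` in which the chosen basis is orthonormal, and `B* B` is
injective as a Gram form. -/
theorem exists_contDiffOn_leftInverse {I : Set ℝ} {B : ℝ → V →L[ℝ] W} (hB : ContDiffOn ℝ ∞ B I)
    (hinj : ∀ t ∈ I, Function.Injective (B t)) :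
    ∃ Q : ℝ → W →L[ℝ] V, ContDiffOn ℝ ∞ Q I ∧ ∀ t ∈ I, ∀ v, Q t (B t v) = v := by
  have : CompleteSpace V := FiniteDimensional.complete ℝ V
  set b := Module.finBasis ℝ W
  set ξ : Fin (Module.finrank ℝ W) → W →L[ℝ] ℝ :=
    fun i => LinearMap.toContinuousLinearMap (b.coord i) with hξ
  set T : ℝ → W →L[ℝ] V →L[ℝ] ℝ := fun t => ∑ i, (ξ i).smulRight ((ξ i).comp (B t)) with hT
  have hTs : ContDiffOn ℝ ∞ T I := by
    refine ContDiffOn.sum fun i _ => ?_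
    exact contDiffOn_const.smulRight (contDiffOn_const.clm_comp hB)
  have hTB : ∀ t ∈ I, Function.Injective ((T t).comp (B t)) := by
    intro t ht
    rw [injective_iff_map_eq_zero]
    intro v hv
    have h1 : ((T t).comp (B t)) v v = 0 := by rw [hv]; rfl
    have h2 : ∑ i, ξ i (B t v) * ξ i (B t v) = 0 := by
      simpa [hT, sum_apply] using h1
    have h3 : ∀ i, ξ i (B t v) = 0 := fun i => by
      have := (Finset.sum_eq_zero_iff_of_nonneg (fun i _ => mul_self_nonneg _)).1 h2 i
        (Finset.mem_univ i)
      exact mul_self_eq_zero.1 this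
    have h4 : B t v = 0 := by
      refine b.ext_elem fun i => ?_
      simpa [hξ] using h3 i
    exact (injective_iff_map_eq_zero _).1 (hinj t ht) v h4
  have hd : Module.finrank ℝ V = Module.finrank ℝ (V →L[ℝ] ℝ) := by
    rw [← (LinearMap.toContinuousLinearMap (𝕜 := ℝ) (E := V) (F' := ℝ)).finrank_eq]
    exact (Subspace.dual_finrank_eq (K := ℝ) (V := V)).symm
  refine ⟨fun t => (ContinuousLinearMap.inverse ((T t).comp (B t))).comp (T t), ?_, ?_⟩
  · refine ContDiffOn.clm_comp (fun t ht => ?_) hTs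
    obtain ⟨e, he⟩ := exists_equiv_of_injective hd (hTB t ht)
    have h2 : ContDiffAt ℝ ∞ (ContinuousLinearMap.inverse (R := ℝ)) ((T t).comp (B t)) := by
      rw [← he]; exact contDiffAt_map_inverse e
    exact h2.comp_contDiffWithinAt t ((hTs.clm_comp hB) t ht)
  · intro t ht v
    obtain ⟨e, he⟩ := exists_equiv_of_injective hd (hTB t ht)
    have h1 : T t (B t v) = e v := by
      have := congrArg (fun f : V →L[ℝ] V →L[ℝ] ℝ => f v) he
      exact this.symm
    simp only [ContinuousLinearMap.comp_apply, h1, ← he, ContinuousLinearMap.inverse_equiv]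
    simp

/-- A `C¹` map does not raise Hausdorff dimension, and adding the single point `0` does not change
the bound. -/
theorem finrank_le_of_contDiffOn_surj {f : V → W} (hf : ContDiffOn ℝ 1 f {0}ᶜ) {P : Submodule ℝ W}
    (hP : ∀ w ∈ P, w ≠ 0 → ∃ v, v ≠ 0 ∧ f v = w) : Module.finrank ℝ P ≤ Module.finrank ℝ V := by
  have h1 : dimH (f '' {0}ᶜ) ≤ Module.finrank ℝ V := by
    refine (dimH_image_le_of_locally_lipschitzOn fun x hx => ?_).trans
      ((dimH_mono (subset_univ _)).trans (Real.dimH_univ_eq_finrank V).le)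
    obtain ⟨K, t, ht, hK⟩ :=
      (hf.contDiffAt (isOpen_compl_singleton.mem_nhds hx)).exists_lipschitzOnWith
    exact ⟨K, t, mem_nhdsWithin_of_mem_nhds ht, hK⟩
  have h2 : (P : Set W) ⊆ f '' {0}ᶜ ∪ {0} := by
    intro w hw
    by_cases h : w = 0
    · exact Or.inr h
    · obtain ⟨v, hv, hvw⟩ := hP w hw h
      exact Or.inl ⟨v, hv, hvw⟩
  have h3 : dimH (P : Set W) ≤ Module.finrank ℝ V := by
    refine (dimH_mono h2).trans ?_
    rw [dimH_union, dimH_singleton]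
    simpa using h1
  have h4 : dimH (P : Set W) = Module.finrank ℝ P := by
    have hi : Isometry (Subtype.val : P → W) := isometry_subtype_coe
    have := hi.dimH_image univ
    rw [image_univ, Subtype.range_coe_subtype, Real.dimH_univ_eq_finrank] at this
    exact this
  rw [h4] at h3
  exact_mod_cast h3

theorem apply_mem_of_hasFDerivAt {V : Type*} [NormedAddCommGroup V] [NormedSpace ℝ V] {f : V → W}
    {f' : V →L[ℝ] W} {v : V} (hf : HasFDerivAt f f' v)
    {P : Submodule ℝ W} (hP : ∀ᶠ w in 𝓝 v, f w ∈ P) (w : V) : f' w ∈ P := by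
  have h1 : HasDerivAt (fun s : ℝ => f (v + s • w)) (f' w) 0 := by
    have h2 : HasDerivAt (fun s : ℝ => v + s • w) w 0 := by
      simpa using ((hasDerivAt_id (0 : ℝ)).smul_const w).const_add v
    have h3 : HasFDerivAt f f' (v + (0 : ℝ) • w) := by simpa using hf
    exact h3.comp_hasDerivAt 0 h2
  refine P.closed_of_finiteDimensional.mem_of_tendsto h1.tendsto_slope_zero ?_
  have h4 : Tendsto (fun s : ℝ => v + s • w) (𝓝[≠] 0) (𝓝 v) := by
    have : Continuous fun s : ℝ => v + s • w := by fun_prop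
    have h5 := this.tendsto 0
    simp only [zero_smul, add_zero] at h5
    exact h5.mono_left nhdsWithin_le_nhds
  filter_upwards [h4.eventually hP] with s hs
  refine P.smul_mem _ (P.sub_mem (by simpa using hs) ?_)
  simpa using hP.self_of_nhds

/-- Euler's identity, obtained by differentiating the homogeneity relation in the scale at `1`. -/
theorem spaceDeriv_apply_self {V : Type*} [NormedAddCommGroup V] [NormedSpace ℝ V] {W : Type*}
    [NormedAddCommGroup W] [NormedSpace ℝ W] {I : Set ℝ} {A : ℝ × V → W}
    (hA : ContDiffOn ℝ ∞ A (I ×ˢ {0}ᶜ))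
    (hom : ∀ t ∈ I, ∀ v, v ≠ 0 → ∀ a : ℝ, 0 < a → A (t, a • v) = a • A (t, v)) {t : ℝ} (ht : t ∈ I)
    {v : V} (hv : v ≠ 0) : spaceDeriv A I {0}ᶜ (t, v) v = A (t, v) := by
  have h0 := hasFDerivAt_spaceDeriv isOpen_compl_singleton hA ht hv
  have h1 : HasDerivAt (fun s : ℝ => A (t, s • v)) (spaceDeriv A I {0}ᶜ (t, v) v) 1 := by
    have h2 : HasDerivAt (fun s : ℝ => s • v) v 1 := by
      simpa using (hasDerivAt_id (1 : ℝ)).smul_const v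
    have h3 : HasFDerivAt (fun w => A (t, w)) (spaceDeriv A I {0}ᶜ (t, v)) ((1 : ℝ) • v) := by
      simpa using h0
    exact HasFDerivAt.comp_hasDerivAt (f := fun s : ℝ => s • v) 1 h3 h2
  have h4 : HasDerivAt (fun s : ℝ => s • A (t, v)) (A (t, v)) 1 := by
    simpa using (hasDerivAt_id (1 : ℝ)).smul_const (A (t, v))
  refine h1.unique (h4.congr_of_eventuallyEq ?_)
  filter_upwards [lt_mem_nhds (zero_lt_one : (0 : ℝ) < 1)] with s hs
  exact hom t ht v hv s hs

end LinearCones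

/-- A family of homogeneous immersions with linear images, starting at a linear map, is the
composition of a family of linear maps and an isotopy. -/
theorem exists_isHomogIsotopy {V : Type} [NormedAddCommGroup V] [InnerProductSpace ℝ V]
    [FiniteDimensional ℝ V] [Nontrivial V] {W : Type*} [NormedAddCommGroup W] [NormedSpace ℝ W]
    [FiniteDimensional ℝ W] {A : ℝ × V → W} (hA : ContDiffOn ℝ ∞ A (Icc 0 1 ×ˢ {0}ᶜ))
    (hom : ∀ t ∈ Icc (0 : ℝ) 1, ∀ v, v ≠ 0 → ∀ a : ℝ, 0 < a → A (t, a • v) = a • A (t, v))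
    (hinj : ∀ t ∈ Icc (0 : ℝ) 1, ∀ v, v ≠ 0 →
      Function.Injective (spaceDeriv A (Icc 0 1) {0}ᶜ (t, v)))
    (hlin : ∀ t ∈ Icc (0 : ℝ) 1, ∃ P : Submodule ℝ W, (∀ v, v ≠ 0 → A (t, v) ∈ P) ∧
      ∀ w ∈ P, w ≠ 0 → ∃ v, v ≠ 0 ∧ A (t, v) = w)
    {ℓ : V →L[ℝ] W} (h0 : ∀ v, v ≠ 0 → A (0, v) = ℓ v) :
    ∃ (B : ℝ → V →L[ℝ] W) (C : ℝ × V → V), ContDiffOn ℝ ∞ B (Icc 0 1) ∧ IsHomogIsotopy C ∧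
      ∀ t ∈ Icc (0 : ℝ) 1, ∀ v, v ≠ 0 → A (t, v) = B t (C (t, v)) := by
  have hI : UniqueDiffOn ℝ (Icc (0 : ℝ) 1) := uniqueDiffOn_Icc zero_lt_one
  have hO : IsOpen ({0}ᶜ : Set V) := isOpen_compl_singleton
  -- At a fixed time all derivatives of `A` have the same range: it lies in `P` because `A` does,
  -- and the Hausdorff dimension bound on `P` gives equality.
  have hrange : ∀ t ∈ Icc (0 : ℝ) 1, ∃ P : Submodule ℝ W, (∀ v, v ≠ 0 → A (t, v) ∈ P) ∧
      (∀ w ∈ P, w ≠ 0 → ∃ v, v ≠ 0 ∧ A (t, v) = w) ∧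
      ∀ v, v ≠ 0 → LinearMap.range (spaceDeriv A (Icc 0 1) {0}ᶜ (t, v) : V →ₗ[ℝ] W) = P := by
    intro t ht
    obtain ⟨P, hP1, hP2⟩ := hlin t ht
    refine ⟨P, hP1, hP2, fun v hv => ?_⟩
    have hft : ContDiffOn ℝ 1 (fun w => A (t, w)) {0}ᶜ :=
      (hA.of_le (by norm_cast)).comp (f := fun w : V => (t, w))
        (ContDiff.contDiffOn (by fun_prop)) fun w hw => ⟨ht, hw⟩
    have hfin := finrank_le_of_contDiffOn_surj hft hP2
    refine Submodule.eq_of_le_of_finrank_le ?_ ?_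
    · rintro _ ⟨w, rfl⟩
      refine apply_mem_of_hasFDerivAt (hasFDerivAt_spaceDeriv hO hA ht hv) ?_ w
      filter_upwards [hO.mem_nhds hv] with x hx using hP1 x hx
    · rw [LinearMap.finrank_range_of_inj (hinj t ht v hv)]
      exact hfin
  obtain ⟨v₀, hv₀⟩ := exists_ne (0 : V)
  -- The derivative at one fixed vector is a smoothly varying linear parametrization of the plane
  -- `P`. The isotopy `C` is `A` read in it.
  set B : ℝ → V →L[ℝ] W := fun t => spaceDeriv A (Icc 0 1) {0}ᶜ (t, v₀) with hB
  have hBs : ContDiffOn ℝ ∞ B (Icc 0 1) :=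
    (contDiffOn_spaceDeriv hI hO hA).comp (f := fun t : ℝ => (t, v₀))
      (ContDiff.contDiffOn (by fun_prop)) fun t ht => ⟨ht, hv₀⟩
  obtain ⟨Q, hQs, hQB⟩ := exists_contDiffOn_leftInverse hBs fun t ht => hinj t ht v₀ hv₀
  set C : ℝ × V → V := fun z => Q z.1 (A z) with hC
  have hBQ : ∀ t ∈ Icc (0 : ℝ) 1, ∀ P : Submodule ℝ W,
      LinearMap.range (B t : V →ₗ[ℝ] W) = P → ∀ w ∈ P, B t (Q t w) = w := by
    rintro t ht P rfl _ ⟨x, rfl⟩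
    exact congrArg (B t) (hQB t ht x)
  have hABC : ∀ t ∈ Icc (0 : ℝ) 1, ∀ v, v ≠ 0 → A (t, v) = B t (C (t, v)) := by
    intro t ht v hv
    obtain ⟨P, hP1, -, hP3⟩ := hrange t ht
    exact (hBQ t ht P (hP3 v₀ hv₀) _ (hP1 v hv)).symm
  have hCs : ContDiffOn ℝ ∞ C (Icc 0 1 ×ˢ {0}ᶜ) :=
    ContDiffOn.clm_apply (hQs.comp contDiffOn_fst fun z hz => hz.1) hA
  refine ⟨B, C, hBs, ⟨hCs, ?_, ?_, ?_, ?_, ?_⟩, hABC⟩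
  -- If `C (t, v) = 0` then `A (t, v) = 0`, which Euler's identity and injectivity of the derivative
  -- exclude.
  · intro t ht v hv h
    have h1 := hABC t ht v hv
    rw [h, map_zero, ← spaceDeriv_apply_self hA hom ht hv] at h1
    exact hv ((injective_iff_map_eq_zero _).1 (hinj t ht v hv) v h1)
  · intro t ht v hv a ha
    simp only [hC, hom t ht v hv a ha, map_smul]
  · intro t ht v hv
    obtain ⟨P, hP1, -, hP3⟩ := hrange t ht
    have hd : spaceDeriv C (Icc 0 1) {0}ᶜ (t, v) =
        (Q t).comp (spaceDeriv A (Icc 0 1) {0}ᶜ (t, v)) :=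
      (hasFDerivAt_spaceDeriv hO hCs ht hv).unique
        ((Q t).hasFDerivAt.comp v (hasFDerivAt_spaceDeriv hO hA ht hv))
    rw [hd, injective_iff_map_eq_zero]
    intro w hw
    have hmem : spaceDeriv A (Icc 0 1) {0}ᶜ (t, v) w ∈ P := by
      rw [← hP3 v hv]; exact ⟨w, rfl⟩
    have h1 := hBQ t ht P (hP3 v₀ hv₀) _ hmem
    have h2 : Q t (spaceDeriv A (Icc 0 1) {0}ᶜ (t, v) w) = 0 := hw
    rw [h2, map_zero] at h1
    exact (injective_iff_map_eq_zero _).1 (hinj t ht v hv) w h1.symm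
  · intro t ht u hu
    obtain ⟨P, -, hP2, hP3⟩ := hrange t ht
    have hmem : B t u ∈ P := by rw [← hP3 v₀ hv₀]; exact ⟨u, rfl⟩
    have hne : B t u ≠ 0 := fun h =>
      hu ((injective_iff_map_eq_zero _).1 (hinj t ht v₀ hv₀) u h)
    obtain ⟨v, hv, hvu⟩ := hP2 _ hmem hne
    exact ⟨v, hv, by simp only [hC, hvu, hQB t ht u]⟩
  · intro v hv
    have h0I : (0 : ℝ) ∈ Icc (0 : ℝ) 1 := by simp
    -- A linear map is its own derivative, whatever `v₀` is, so the isotopy starts at the identity.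
    have hB0 : B 0 = ℓ := by
      refine (hasFDerivAt_spaceDeriv hO hA h0I hv₀).unique ?_
      refine ℓ.hasFDerivAt.congr_of_eventuallyEq ?_
      filter_upwards [hO.mem_nhds hv₀] with x hx using h0 x hx
    simp only [hC, h0 v hv, ← hB0, hQB 0 h0I v]

/-! ### Charts -/

section RealStructure

variable {E : Type*} [NormedAddCommGroup E] [NormedSpace ℂ E]
  {X : Type*} [TopologicalSpace X] [ChartedSpace E X]

/-- A complex manifold is a smooth manifold. -/
theorem isManifold_real [IsManifold 𝓘(ℂ, E) ω X] : IsManifold 𝓘(ℝ, E) ∞ X := by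
  refine isManifold_of_contDiffOn _ _ _ fun e e' he he' => ?_
  have h := contMDiffOn_of_mem_contDiffGroupoid
    (HasGroupoid.compatible (G := contDiffGroupoid ω 𝓘(ℂ, E)) he he')
  have h1 : ContDiffOn ℂ ω (e.symm ≫ₕ e') (e.symm ≫ₕ e').source := h.contDiffOn
  have h2 : ContDiffOn ℝ ∞ (e.symm ≫ₕ e') (e.symm ≫ₕ e').source :=
    (h1.restrict_scalars ℝ).of_le le_top
  simpa using h2

end RealStructure

section Charts

variable {V : Type} [NormedAddCommGroup V] [NormedSpace ℝ V]
  {M : Type*} [TopologicalSpace M] [ChartedSpace V M]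
  {W : Type*} [NormedAddCommGroup W] [NormedSpace ℝ W]
  {N : Type*} [TopologicalSpace N] [ChartedSpace W N]

@[simp] theorem polar_zero (p : M) (v : V) : polar p 0 v = p := by
  simp [polar]

@[simp] theorem polar_zero_right (p : M) (s : ℝ) : polar p s (0 : V) = p := by
  simp [polar]

theorem polar_smul (p : M) (s a : ℝ) (v : V) : polar p s (a • v) = polar p (s * a) v := by
  simp [polar, smul_smul]

theorem exists_ball_subset_target {V : Type} [NormedAddCommGroup V] {M : Type*}
    [TopologicalSpace M] [ChartedSpace V M] (p : M) :
    ∃ ε > 0, Metric.ball (chartAt V p p) ε ⊆ (chartAt V p).target :=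
  Metric.isOpen_iff.1 (chartAt V p).open_target _ (mem_chart_target V p)

theorem contDiffOn_chart_comp [IsManifold 𝓘(ℝ, W) ∞ N] {Z : Type*} [NormedAddCommGroup Z]
    [NormedSpace ℝ Z] {F : Z → N} {s : Set Z} (hF : ContMDiffOn 𝓘(ℝ, Z) 𝓘(ℝ, W) ∞ F s) (q : N)
    (hs : MapsTo F s (chartAt W q).source) : ContDiffOn ℝ ∞ (fun z => chartAt W q (F z)) s := by
  have h1 : ContMDiffOn 𝓘(ℝ, W) 𝓘(ℝ, W) ∞ (chartAt W q) (chartAt W q).source := contMDiffOn_chart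
  exact (h1.comp hF hs).contDiffOn

theorem mfderivWithin_eq_of_hasFDerivWithinAt {Z : Type*} [NormedAddCommGroup Z] [NormedSpace ℝ Z]
    {F : Z → N} {s : Set Z} {z : Z} {d : Z →L[ℝ] W} (hc : ContinuousWithinAt F s z)
    (hd : HasFDerivWithinAt (fun y => chartAt W (F z) (F y)) d s z)
    (hs : UniqueDiffWithinAt ℝ s z) : mfderivWithin 𝓘(ℝ, Z) 𝓘(ℝ, W) F s z = d := by
  have h : HasMFDerivWithinAt 𝓘(ℝ, Z) 𝓘(ℝ, W) F s z d := by
    refine ⟨hc, ?_⟩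
    simp only [writtenInExtChartAt, extChartAt_model_space_eq_id, PartialEquiv.refl_symm,
      PartialEquiv.refl_coe, preimage_id, modelWithCornersSelf_coe, range_id, inter_univ,
      Function.comp_id, id, extChartAt_coe, Function.id_comp]
    exact hd
  exact h.mfderivWithin hs.uniqueMDiffWithinAt

theorem coneDeriv_eq {f : M → N} {p : M} {v : V} {d : W}
    (hc : ContinuousWithinAt (fun s : ℝ => f (polar p s v)) (Ici 0) 0)
    (hd : HasDerivWithinAt (fun s : ℝ => chartAt W (f p) (f (polar p s v))) d (Ici 0) 0) :
    (coneDeriv V W f p v : W) = d := by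
  have h := mfderivWithin_eq_of_hasFDerivWithinAt (N := N) hc
    (d := ContinuousLinearMap.toSpanSingleton ℝ d)
    (by simpa only [polar_zero] using hd.hasFDerivWithinAt) (uniqueDiffWithinAt_Ici 0)
  have h1 := congrArg (fun A : ℝ →L[ℝ] W => A 1) h
  simp only [ContinuousLinearMap.toSpanSingleton_apply, one_smul] at h1
  exact h1

theorem coneDeriv_zero (f : M → N) (p : M) : (coneDeriv V W f p (0 : V) : W) = 0 := by
  refine coneDeriv_eq ?_ ?_
  · simpa using continuousWithinAt_const
  · simp only [polar_zero_right]
    exact hasDerivWithinAt_const _ _ _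

theorem eventually_mem_polarDomain {V : Type} [NormedAddCommGroup V] {ε : ℝ} (hε : 0 < ε) {v : V}
    (hv : v ≠ 0) :
    ∀ᶠ s : ℝ in 𝓝[≥] 0, (s, v) ∈ polarDomain V ε := by
  have h1 : ∀ᶠ s : ℝ in 𝓝 0, s * ‖v‖ < ε := by
    have : ContinuousAt (fun s : ℝ => s * ‖v‖) 0 := by fun_prop
    exact this.eventually_lt continuousAt_const (by simpa using hε)
  filter_upwards [mem_nhdsWithin_of_mem_nhds h1, self_mem_nhdsWithin] with s hs hs0
  exact ⟨hs0, hv, hs⟩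

theorem hasDerivWithinAt_of_expansion {V : Type} [NormedAddCommGroup V] {ε : ℝ} (hε : 0 < ε)
    {v : V} (hv : v ≠ 0) {g k : ℝ → W} {q : W}
    (hk : ContinuousWithinAt k (Ici 0) 0)
    (hg : ∀ s, (s, v) ∈ polarDomain V ε → g s = q + s • k s) :
    HasDerivWithinAt g (k 0) (Ici 0) 0 := by
  have hev : ∀ᶠ s in 𝓝[≥] (0 : ℝ), g s = q + s • k s :=
    (eventually_mem_polarDomain hε hv).mono hg
  have h0 : g 0 = q := by
    have := hg 0 ⟨le_rfl, hv, by simpa using hε⟩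
    simpa using this
  rw [hasDerivWithinAt_iff_tendsto_slope]
  have h1 : Tendsto k (𝓝[Ici 0 \ {0}] 0) (𝓝 (k 0)) := hk.mono_left (nhdsWithin_mono _ sdiff_subset)
  refine h1.congr' ?_
  filter_upwards [nhdsWithin_mono _ sdiff_subset hev, self_mem_nhdsWithin] with s hs hs'
  have hs0 : s ≠ 0 := hs'.2
  rw [slope_def_module, hs, h0]
  simp [smul_smul, hs0]

/-- The first order expansion in polar coordinates of a cone-smooth family that maps `p` to `q`. -/
theorem exists_polar_expansion [FiniteDimensional ℝ V] [CompleteSpace W] [IsManifold 𝓘(ℝ, W) ∞ N]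
    {Ψ : ℝ → M → N} {p : M} {q : N} (hq : ∀ t ∈ Icc (0 : ℝ) 1, Ψ t p = q) {ε : ℝ} (hε : 0 < ε)
    (hΨ : ContMDiffOn 𝓘(ℝ, ℝ × ℝ × V) 𝓘(ℝ, W) ∞
      (fun z : ℝ × ℝ × V => Ψ z.1 (polar p z.2.1 z.2.2)) (Icc 0 1 ×ˢ polarDomain V ε)) :
    ∃ δ > 0, δ ≤ ε ∧ ∃ k : ℝ × ℝ × V → W, ContDiffOn ℝ ∞ k (Icc 0 1 ×ˢ polarDomain V δ) ∧
      (∀ t ∈ Icc (0 : ℝ) 1, ∀ s v, (s, v) ∈ polarDomain V δ →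
        Ψ t (polar p s v) ∈ (chartAt W q).source ∧
        chartAt W q (Ψ t (polar p s v)) = chartAt W q q + s • k (t, s, v)) ∧
      ∀ t ∈ Icc (0 : ℝ) 1, ∀ v : V, v ≠ 0 → (coneDeriv V W (Ψ t) p v : W) = k (t, 0, v) := by
  have := FiniteDimensional.proper ℝ V
  set G : ℝ × ℝ × V → N := fun z => Ψ z.1 (polar p z.2.1 z.2.2) with hG
  set 𝒟 := Icc (0 : ℝ) 1 ×ˢ polarDomain V ε with h𝒟
  have hKc : IsCompact (Icc (0 : ℝ) 1 ×ˢ Metric.sphere (0 : V) 1) :=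
    isCompact_Icc.prod (isCompact_sphere _ _)
  -- The whole exceptional sphere is mapped to `q` at all times, so compactness of `[0, 1]` times
  -- the sphere gives one radius on which the family stays in the chart around `q`.
  have hloc : ∀ y ∈ Icc (0 : ℝ) 1 ×ˢ Metric.sphere (0 : V) 1, ∀ᶠ z : ℝ × (ℝ × V) in 𝓝 (0, y),
      ((z.2.1, z.1, z.2.2) : ℝ × ℝ × V) ∈ 𝒟 → G (z.2.1, z.1, z.2.2) ∈ (chartAt W q).source := by
    rintro ⟨t, v⟩ ⟨ht, hv⟩
    have hv0 : v ≠ 0 := by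
      rintro rfl
      simp at hv
    have hmem : ((t, 0, v) : ℝ × ℝ × V) ∈ 𝒟 := ⟨ht, le_rfl, hv0, by simpa using hε⟩
    have hval : G (t, 0, v) = q := by simp [hG, hq t ht]
    have h1 := hΨ.continuousOn (t, 0, v) hmem
    have h2 : ∀ᶠ z in 𝓝[𝒟] ((t, 0, v) : ℝ × ℝ × V), G z ∈ (chartAt W q).source := by
      refine h1.eventually_mem ((chartAt W q).open_source.mem_nhds ?_)
      rw [hval]
      exact mem_chart_source W q
    have h3 := eventually_nhdsWithin_iff.1 h2
    have h4 : Continuous fun z : ℝ × (ℝ × V) => ((z.2.1, z.1, z.2.2) : ℝ × ℝ × V) := by fun_prop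
    exact (h4.tendsto (0, (t, v))).eventually h3
  have hev := hKc.eventually_forall_of_forall_eventually (P := fun (s : ℝ) (y : ℝ × V) =>
    ((y.1, s, y.2) : ℝ × ℝ × V) ∈ 𝒟 → G (y.1, s, y.2) ∈ (chartAt W q).source) hloc
  obtain ⟨δ₀, hδ₀, hδ₀s⟩ := Metric.eventually_nhds_iff.1 hev
  set δ := min δ₀ ε with hδ
  have hδ0 : 0 < δ := lt_min hδ₀ hε
  have hsub : polarDomain V δ ⊆ polarDomain V ε :=
    fun z hz => ⟨hz.1, hz.2.1, hz.2.2.trans_le (min_le_right _ _)⟩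
  have hsource : ∀ t ∈ Icc (0 : ℝ) 1, ∀ s v, (s, v) ∈ polarDomain V δ →
      G (t, s, v) ∈ (chartAt W q).source := by
    intro t ht s v hsv
    obtain ⟨hs, hv, hsv'⟩ := hsv
    simp only at hs hv hsv'
    have hv' : 0 < ‖v‖ := norm_pos_iff.2 hv
    have hn : ‖‖v‖⁻¹ • v‖ = 1 := by simp [norm_smul, hv'.ne']
    -- Polar coordinates are redundant, so it is enough to know the unit directions.
    have heq : G (t, s, v) = G (t, s * ‖v‖, ‖v‖⁻¹ • v) := by
      simp only [hG, polar_smul, mul_assoc, mul_inv_cancel₀ hv'.ne', mul_one]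
    rw [heq]
    refine hδ₀s (y := s * ‖v‖) ?_ (t, ‖v‖⁻¹ • v) ⟨ht, by simp [hn]⟩ ⟨ht, ?_⟩
    · rw [Real.dist_eq, sub_zero, abs_of_nonneg (by positivity)]
      exact hsv'.trans_le (min_le_left _ _)
    · refine ⟨by positivity, by simpa using hv, ?_⟩
      simp only [hn, mul_one]
      exact hsv'.trans_le (min_le_right _ _)
  have hg : ContDiffOn ℝ ∞ (fun z => chartAt W q (G z)) (Icc 0 1 ×ˢ polarDomain V δ) :=
    contDiffOn_chart_comp (hΨ.mono (prod_mono_right hsub)) q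
      fun z hz => hsource z.1 hz.1 z.2.1 z.2.2 hz.2
  obtain ⟨k, hk, hgk⟩ := exists_contDiffOn_eq_add_smul hg
  have hgk' : ∀ t ∈ Icc (0 : ℝ) 1, ∀ s v, (s, v) ∈ polarDomain V δ →
      chartAt W q (G (t, s, v)) = chartAt W q q + s • k (t, s, v) := by
    intro t ht s v hsv
    have := hgk t ht s v hsv
    rw [this]
    simp [hG, hq t ht]
  refine ⟨δ, hδ0, min_le_right _ _, k, hk, fun t ht s v hsv =>
    ⟨hsource t ht s v hsv, hgk' t ht s v hsv⟩, fun t ht v hv => ?_⟩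
  have hline : ∀ s : ℝ, (s, v) ∈ polarDomain V δ → ((t, s, v) : ℝ × ℝ × V) ∈
      Icc (0 : ℝ) 1 ×ˢ polarDomain V δ := fun s hs => ⟨ht, hs⟩
  have h0 : (0, v) ∈ polarDomain V δ := ⟨le_rfl, hv, by simpa using hδ0⟩
  have htend : Tendsto (fun s : ℝ => ((t, s, v) : ℝ × ℝ × V)) (𝓝[≥] 0)
      (𝓝[Icc (0 : ℝ) 1 ×ˢ polarDomain V δ] (t, 0, v)) := by
    refine tendsto_nhdsWithin_iff.2 ⟨?_, (eventually_mem_polarDomain hδ0 hv).mono hline⟩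
    have : Continuous fun s : ℝ => ((t, s, v) : ℝ × ℝ × V) := by fun_prop
    exact (this.tendsto 0).mono_left nhdsWithin_le_nhds
  refine coneDeriv_eq ?_ ?_
  · exact ((hΨ.continuousOn.mono (prod_mono_right hsub)) (t, 0, v) (hline 0 h0)).tendsto.comp htend
  · rw [hq t ht]
    exact hasDerivWithinAt_of_expansion (k := fun s => k (t, s, v)) hδ0 hv
      ((hk.continuousOn (t, 0, v) (hline 0 h0)).tendsto.comp htend) fun s hs => hgk' t ht s v hs

theorem convex_localDomain (t₀ : ℝ) (x₀ : M) (r : ℝ) : Convex ℝ (localDomain V t₀ x₀ r) :=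
  ((convex_Icc _ _).inter (convex_ball _ _)).prod (convex_ball _ _)

theorem uniqueDiffOn_localDomain {t₀ : ℝ} (x₀ : M) (r : ℝ) :
    UniqueDiffOn ℝ (localDomain V t₀ x₀ r) :=
  ((uniqueDiffOn_Icc zero_lt_one).inter Metric.isOpen_ball).prod Metric.isOpen_ball.uniqueDiffOn

theorem localDomain_mono {V : Type} [NormedAddCommGroup V] {M : Type*} [TopologicalSpace M]
    [ChartedSpace V M] {t₀ : ℝ} {x₀ : M} {r r' : ℝ} (h : r ≤ r') :
    localDomain V t₀ x₀ r ⊆ localDomain V t₀ x₀ r' :=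
  prod_mono (inter_subset_inter_right _ (Metric.ball_subset_ball h)) (Metric.ball_subset_ball h)

theorem localDomain_subset_ball {V : Type} [NormedAddCommGroup V] {M : Type*} [TopologicalSpace M]
    [ChartedSpace V M] {t₀ : ℝ} {x₀ : M} {r : ℝ} :
    localDomain V t₀ x₀ r ⊆ Metric.ball (t₀, chartAt V x₀ x₀) r := by
  rintro ⟨t, y⟩ ⟨⟨-, ht⟩, hy⟩
  rw [← ball_prod_same]
  exact ⟨ht, hy⟩

/-- Smooth families are of class `C^{1,1}`. -/
theorem isC11At_of_contMDiffOn [IsManifold 𝓘(ℝ, V) ∞ M] [IsManifold 𝓘(ℝ, W) ∞ N] {Ψ : ℝ → M → N}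
    {O : Set M} (hO : IsOpen O) (hΨ : ContMDiffOn (𝓘(ℝ, ℝ).prod 𝓘(ℝ, V)) 𝓘(ℝ, W) ∞
      (fun z : ℝ × M => Ψ z.1 z.2) (Icc 0 1 ×ˢ O)) {t : ℝ} (ht : t ∈ Icc (0 : ℝ) 1) {x : M}
    (hx : x ∈ O) : IsC11At V W Ψ t x := by
  set e := chartAt V x with he
  set T : Set V := e.target ∩ e.symm ⁻¹' O with hT
  have hTo : IsOpen T := e.isOpen_inter_preimage_symm hO
  have hxT : e x ∈ T := ⟨mem_chart_target V x, by
    rw [mem_preimage, e.left_inv (mem_chart_source V x)]; exact hx⟩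
  set G : ℝ × V → N := fun z => Ψ z.1 (e.symm z.2) with hG
  have hGs : ContMDiffOn 𝓘(ℝ, ℝ × V) 𝓘(ℝ, W) ∞ G (Icc 0 1 ×ˢ T) := by
    have h1 : ContMDiffOn 𝓘(ℝ, ℝ × V) 𝓘(ℝ, ℝ) ∞ (fun z : ℝ × V => z.1) (Icc 0 1 ×ˢ T) :=
      contDiffOn_fst.contMDiffOn
    have h2 : ContMDiffOn 𝓘(ℝ, ℝ × V) 𝓘(ℝ, V) ∞ (fun z : ℝ × V => z.2) (Icc 0 1 ×ˢ T) :=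
      contDiffOn_snd.contMDiffOn
    have h3 : ContMDiffOn 𝓘(ℝ, V) 𝓘(ℝ, V) ∞ e.symm e.target := contMDiffOn_chart_symm
    have h4 : ContMDiffOn 𝓘(ℝ, ℝ × V) 𝓘(ℝ, V) ∞ (fun z : ℝ × V => e.symm z.2) (Icc 0 1 ×ˢ T) :=
      h3.comp h2 fun z hz => hz.2.1
    exact hΨ.comp (h1.prodMk h4) fun z hz => ⟨hz.1, hz.2.2⟩
  have hval : G (t, e x) = Ψ t x := by simp [hG, he]
  have hev : ∀ᶠ z in 𝓝[Icc 0 1 ×ˢ T] (t, e x), G z ∈ (chartAt W (Ψ t x)).source := by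
    refine (hGs.continuousOn (t, e x) ⟨ht, hxT⟩).eventually_mem
      ((chartAt W (Ψ t x)).open_source.mem_nhds ?_)
    rw [hval]; exact mem_chart_source W _
  obtain ⟨r₁, hr₁, h₁⟩ := Metric.mem_nhdsWithin_iff.1 hev
  obtain ⟨r₂, hr₂, h₂⟩ := Metric.isOpen_iff.1 hTo _ hxT
  set r₃ := min r₁ r₂ with hr₃
  have hr₃0 : 0 < r₃ := lt_min hr₁ hr₂
  have hsubT : localDomain V t x r₃ ⊆ Icc 0 1 ×ˢ T := fun z hz =>
    ⟨hz.1.1, h₂ (Metric.ball_subset_ball (min_le_right _ _) hz.2)⟩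
  have hsrc : ∀ z ∈ localDomain V t x r₃, G z ∈ (chartAt W (Ψ t x)).source := fun z hz =>
    h₁ ⟨Metric.ball_subset_ball (min_le_left _ _) (localDomain_subset_ball hz), hsubT hz⟩
  have hs : ContDiffOn ℝ ∞ (localFamily V W Ψ t x) (localDomain V t x r₃) :=
    contDiffOn_chart_comp (hGs.mono hsubT) (Ψ t x) hsrc
  have hU := uniqueDiffOn_localDomain (V := V) (t₀ := t) x r₃
  have hmem : (t, e x) ∈ localDomain V t x r₃ :=
    ⟨⟨ht, Metric.mem_ball_self hr₃0⟩, Metric.mem_ball_self hr₃0⟩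
  have hfd := hs.fderivWithin hU (m := 1) (by norm_cast)
  obtain ⟨K, Q, hQ, hK⟩ := (hfd _ hmem).exists_lipschitzOnWith (convex_localDomain t x r₃)
  obtain ⟨r₄, hr₄, h₄⟩ := Metric.mem_nhdsWithin_iff.1 hQ
  set r := min r₃ r₄ with hr
  have hr0 : 0 < r := lt_min hr₃0 hr₄
  have hsub : localDomain V t x r ⊆ localDomain V t x r₃ := localDomain_mono (min_le_left _ _)
  have hsubQ : localDomain V t x r ⊆ Q := fun z hz =>
    h₄ ⟨Metric.ball_subset_ball (min_le_right _ _) (localDomain_subset_ball hz), hsub hz⟩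
  refine ⟨r, hr0, ?_, fun z hz => hsrc z (hsub hz), (hs.mono hsub).of_le (by norm_cast), K, ?_⟩
  · intro y hy
    exact (h₂ (Metric.ball_subset_ball ((min_le_left _ _).trans (min_le_right _ _)) hy)).1
  · have heq : EqOn (fderivWithin ℝ (localFamily V W Ψ t x) (localDomain V t x r))
        (fderivWithin ℝ (localFamily V W Ψ t x) (localDomain V t x r₃)) (localDomain V t x r) :=
      fun z hz => ((hs.differentiableOn (by simp) z (hsub hz)).hasFDerivWithinAt.mono
        hsub).fderivWithin (uniqueDiffOn_localDomain x r z hz)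
    intro z hz z' hz'
    rw [heq hz, heq hz']
    exact hK (hsubQ hz) (hsubQ hz')

end Charts

/-! ### Expansion at a cone point -/

section ConeDiffeo

variable {V : Type} [NormedAddCommGroup V] [NormedSpace ℝ V]
  {M : Type*} [TopologicalSpace M] [ChartedSpace V M]

theorem IsConeDiffeo.injective {S : Set M} {φ : M → M} (hφ : IsConeDiffeo V S φ) :
    Function.Injective φ := by
  obtain ⟨χ, -, hχ, -⟩ := hφ.exists_inverse
  intro x y hxy
  by_cases hx : x ∈ S <;> by_cases hy : y ∈ S
  · rwa [hφ.fix x hx, hφ.fix y hy] at hxy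
  · rw [hφ.fix x hx] at hxy
    exact absurd (hxy ▸ hx) (hφ.mapsTo hy)
  · rw [hφ.fix y hy] at hxy
    exact absurd (hxy ▸ hy) (hφ.mapsTo hx)
  · rw [← hχ.1 hx, ← hχ.1 hy, hxy]

theorem IsConeDiffeo.surjective {S : Set M} {φ : M → M} (hφ : IsConeDiffeo V S φ) :
    Function.Surjective φ := by
  obtain ⟨χ, -, hχ, -⟩ := hφ.exists_inverse
  intro y
  by_cases hy : y ∈ S
  · exact ⟨y, hφ.fix y hy⟩
  · exact ⟨χ y, hχ.2 hy⟩

end ConeDiffeo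

section Expansion

variable {V : Type} [NormedAddCommGroup V] [NormedSpace ℝ V]
  {M : Type*} [TopologicalSpace M] [ChartedSpace V M]
  {W : Type*} [NormedAddCommGroup W] [NormedSpace ℝ W]
  {N : Type*} [TopologicalSpace N] [ChartedSpace W N]

theorem tendsto_line_polarDomain {V : Type} [NormedAddCommGroup V] {δ : ℝ} (hδ : 0 < δ) {t : ℝ}
    (ht : t ∈ Icc (0 : ℝ) 1) {v : V} (hv : v ≠ 0) : Tendsto (fun s : ℝ => ((t, s, v) : ℝ × ℝ × V)) (𝓝[≥] 0)
      (𝓝[Icc (0 : ℝ) 1 ×ˢ polarDomain V δ] (t, 0, v)) := by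
  refine tendsto_nhdsWithin_iff.2
    ⟨?_, (eventually_mem_polarDomain hδ hv).mono fun s hs => ⟨ht, hs⟩⟩
  have : Continuous fun s : ℝ => ((t, s, v) : ℝ × ℝ × V) := by fun_prop
  exact (this.tendsto 0).mono_left nhdsWithin_le_nhds

/-- The first order coefficient of an expansion in polar coordinates is positively homogeneous. -/
theorem homogeneous_of_expansion {δ : ℝ} (hδ : 0 < δ) {k : ℝ × ℝ × V → W}
    (hk : ContinuousOn k (Icc 0 1 ×ˢ polarDomain V δ)) {g : V → W} {q : W} {t : ℝ}
    (ht : t ∈ Icc (0 : ℝ) 1)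
    (hg : ∀ s v, (s, v) ∈ polarDomain V δ → g (s • v) = q + s • k (t, s, v)) {v : V} (hv : v ≠ 0)
    {a : ℝ} (ha : 0 < a) : k (t, 0, a • v) = a • k (t, 0, v) := by
  have h0 : ∀ w : V, w ≠ 0 → HasDerivWithinAt (fun s : ℝ => g (s • w)) (k (t, 0, w)) (Ici 0) 0 :=
    fun w hw => hasDerivWithinAt_of_expansion (k := fun s => k (t, s, w)) hδ hw
      ((hk (t, 0, w) ⟨ht, le_rfl, hw, by simpa using hδ⟩).tendsto.comp
        (tendsto_line_polarDomain hδ ht hw)) fun s hs => hg s w hs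
  have h1 := h0 (a • v) (smul_ne_zero ha.ne' hv)
  have h2 : HasDerivWithinAt (fun s : ℝ => s * a) a (Ici 0) 0 := by
    simpa using (hasDerivWithinAt_id (0 : ℝ) (Ici 0)).mul_const a
  have h3 : HasDerivWithinAt (fun s : ℝ => g (s • v)) (k (t, 0, v)) (Ici 0) (0 * a) := by
    rw [zero_mul]; exact h0 v hv
  have h4 := h3.scomp (0 : ℝ) h2 fun s (hs : 0 ≤ s) => mul_nonneg hs ha.le
  have h5 : ((fun s : ℝ => g (s • v)) ∘ fun s : ℝ => s * a) = fun s : ℝ => g (s • a • v) := by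
    funext s; simp [smul_smul]
  rw [h5] at h4
  exact (uniqueDiffWithinAt_Ici (0 : ℝ)).eq_deriv _ h1 h4

variable [FiniteDimensional ℝ V] [CompleteSpace W] [IsManifold 𝓘(ℝ, W) ∞ N]
  [IsManifold 𝓘(ℝ, V) ∞ M]

/-- A cone-diffeomorphism in polar coordinates around a cone point. -/
theorem IsConeDiffeo.exists_polar_eq {S : Set M} {φ : M → M} (hφ : IsConeDiffeo V S φ) {p : M}
    (hp : p ∈ S) {ε : ℝ} (hε : 0 < ε) :
    ∃ δ > 0, Metric.ball (chartAt V p p) δ ⊆ (chartAt V p).target ∧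
      ∃ a : ℝ × V → V, ContDiffOn ℝ ∞ a (polarDomain V δ) ∧
      (∀ s v, (s, v) ∈ polarDomain V δ → (s, a (s, v)) ∈ polarDomain V ε ∧
        φ (polar p s v) = polar p s (a (s, v))) ∧
      ∀ v : V, v ≠ 0 → (coneDeriv V V φ p v : V) = a (0, v) := by
  have : CompleteSpace V := FiniteDimensional.complete ℝ V
  obtain ⟨ε₁, hε₁, h₁⟩ := hφ.coneSmooth p hp
  -- A cone-diffeomorphism is regarded as a family that is constant in time, so that the expansion
  -- for families applies.
  have hsm : ContMDiffOn 𝓘(ℝ, ℝ × ℝ × V) 𝓘(ℝ, V) ∞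
      (fun z : ℝ × ℝ × V => (fun _ : ℝ => φ) z.1 (polar p z.2.1 z.2.2))
      (Icc 0 1 ×ˢ polarDomain V ε₁) := by
    have h2 : ContMDiffOn 𝓘(ℝ, ℝ × ℝ × V) 𝓘(ℝ, ℝ × V) ∞ (fun z : ℝ × ℝ × V => z.2)
      (Icc 0 1 ×ˢ polarDomain V ε₁) := contDiffOn_snd.contMDiffOn
    exact h₁.comp h2 fun z hz => hz.2
  obtain ⟨δ₁, hδ₁, -, k, hk, hexp, hder⟩ :=
    exists_polar_expansion (Ψ := fun _ => φ) (fun _ _ => hφ.fix p hp) hε₁ hsm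
  obtain ⟨δ₂, hδ₂, hball⟩ := exists_ball_subset_target (V := V) p
  have hcont : ContinuousAt (fun y : V => chartAt V p (φ ((chartAt V p).symm y)))
      (chartAt V p p) := by
    have e1 : (chartAt V p).symm (chartAt V p p) = p :=
      (chartAt V p).left_inv (mem_chart_source V p)
    refine ContinuousAt.comp (f := fun y : V => φ ((chartAt V p).symm y)) (g := chartAt V p) ?_ ?_
    · rw [e1, hφ.fix p hp]
      exact (chartAt V p).continuousAt (mem_chart_source V p)
    · exact hφ.continuous.continuousAt.comp
        ((chartAt V p).continuousAt_symm (mem_chart_target V p))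
  obtain ⟨δ₃, hδ₃, hδ₃'⟩ := Metric.continuousAt_iff.1 hcont ε hε
  rw [(chartAt V p).left_inv (mem_chart_source V p), hφ.fix p hp] at hδ₃'
  have hz : (0 : ℝ) ∈ Icc (0 : ℝ) 1 := ⟨le_rfl, zero_le_one⟩
  set δ := min δ₁ (min δ₂ δ₃) with hδ
  have hle1 : δ ≤ δ₁ := min_le_left _ _
  have hle2 : δ ≤ δ₂ := (min_le_right _ _).trans (min_le_left _ _)
  have hle3 : δ ≤ δ₃ := (min_le_right _ _).trans (min_le_right _ _)
  have hsub : polarDomain V δ ⊆ polarDomain V δ₁ :=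
    fun z hz => ⟨hz.1, hz.2.1, hz.2.2.trans_le hle1⟩
  refine ⟨δ, lt_min hδ₁ (lt_min hδ₂ hδ₃), (Metric.ball_subset_ball hle2).trans hball,
    fun z => k (0, z.1, z.2), ?_, ?_, fun v hv => hder 0 hz v hv⟩
  · exact hk.comp (f := fun z : ℝ × V => ((0, z.1, z.2) : ℝ × ℝ × V))
      (ContDiff.contDiffOn (by fun_prop)) fun z hz' => ⟨hz, hsub hz'⟩
  · intro s v hsv
    obtain ⟨hs, hv, hsv'⟩ := id hsv
    simp only at hs hv hsv'
    obtain ⟨e1, e2⟩ := hexp 0 hz s v (hsub hsv)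
    have e3 : φ (polar p s v) = polar p s (k (0, s, v)) := by
      have e4 : polar p s (k (0, s, v)) = (chartAt V p).symm (chartAt V p (φ (polar p s v))) := by
        rw [e2, polar]
      rw [e4, (chartAt V p).left_inv e1]
    refine ⟨⟨hs, ?_, ?_⟩, e3⟩
    -- The lifted direction is nonzero for different reasons: on the exceptional sphere it is a
    -- cone-derivative, off it a zero would contradict injectivity of `φ`.
    · rcases hs.eq_or_lt with rfl | hs
      · simp only
        rw [← hder 0 hz v hv]
        exact hφ.coneDeriv_ne_zero p hp hv
      · intro h0
        simp only at h0
        rw [h0, polar_zero_right] at e3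
        have e4 : polar p s v = p := hφ.injective (e3.trans (hφ.fix p hp).symm)
        have hmem : chartAt V p p + s • v ∈ (chartAt V p).target := by
          refine hball ?_
          rw [Metric.mem_ball, dist_self_add_left, norm_smul, Real.norm_of_nonneg hs.le]
          exact hsv'.trans_le hle2
        have e5 := congrArg (chartAt V p) e4
        rw [polar, (chartAt V p).right_inv hmem] at e5
        simp [hs.ne', hv] at e5
    · have h5 := @hδ₃' (chartAt V p p + s • v) (by
        rw [dist_self_add_left, norm_smul, Real.norm_of_nonneg hs]
        exact hsv'.trans_le hle3)
      have e6 : chartAt V p (φ ((chartAt V p).symm (chartAt V p p + s • v))) =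
        chartAt V p p + s • k (0, s, v) := e2
      rw [e6, dist_self_add_left, norm_smul, Real.norm_of_nonneg hs] at h5
      exact h5

/-- The first order expansion in polar coordinates of a cone-smooth family after a change of
parametrization. -/
theorem exists_polar_expansion_comp {S : Set M} {φ : M → M} (hφ : IsConeDiffeo V S φ) {p : M}
    (hp : p ∈ S) {Ψ : ℝ → M → N} {q : N} (hq : ∀ t ∈ Icc (0 : ℝ) 1, Ψ t p = q)
    (hΨ : IsConeSmoothFamily V W S Ψ) (hinj : ∀ t ∈ Icc (0 : ℝ) 1, ∀ v : V, v ≠ 0 →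
      Function.Injective (blowupDeriv V W (Ψ t) p v)) :
    ∃ δ > 0, Metric.ball (chartAt V p p) δ ⊆ (chartAt V p).target ∧
      ∃ k : ℝ × ℝ × V → W, ContDiffOn ℝ ∞ k (Icc 0 1 ×ˢ polarDomain V δ) ∧
      (∀ t ∈ Icc (0 : ℝ) 1, ∀ s v, (s, v) ∈ polarDomain V δ →
        Ψ t (φ (polar p s v)) ∈ (chartAt W q).source ∧
        chartAt W q (Ψ t (φ (polar p s v))) = chartAt W q q + s • k (t, s, v)) ∧
      (∀ t ∈ Icc (0 : ℝ) 1, ∀ v : V, v ≠ 0 →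
        (coneDeriv V W (Ψ t) p (coneDeriv V V φ p v) : W) = k (t, 0, v)) ∧
      ∀ t ∈ Icc (0 : ℝ) 1, ∀ v : V, v ≠ 0 → ∃ D : V →L[ℝ] W, Function.Injective D ∧
        HasFDerivAt (fun w => k (t, 0, w)) D v := by
  obtain ⟨ε₀, hε₀, h₀⟩ := hΨ.coneSmooth p hp
  obtain ⟨ε, hε, -, k, hk, hexp, hder⟩ := exists_polar_expansion hq hε₀ h₀
  obtain ⟨δ, hδ, hball, a, ha, hpol, hcone⟩ := hφ.exists_polar_eq hp hε
  have hsmooth : ContDiffOn ℝ ∞ (fun z : ℝ × ℝ × V => k (z.1, z.2.1, a z.2))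
      (Icc 0 1 ×ˢ polarDomain V δ) := by
    refine hk.comp (f := fun z : ℝ × ℝ × V => ((z.1, z.2.1, a z.2) : ℝ × ℝ × V)) ?_
      fun z hz => ⟨hz.1, (hpol z.2.1 z.2.2 hz.2).1⟩
    refine contDiffOn_fst.prodMk (ContDiffOn.prodMk (ContDiff.contDiffOn (by fun_prop)) ?_)
    exact ha.comp contDiffOn_snd fun z hz => hz.2
  have hmem0 : ∀ v : V, v ≠ 0 → ((0 : ℝ), v) ∈ polarDomain V δ :=
    fun v hv => ⟨le_rfl, hv, by simpa using hδ⟩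
  have hane : ∀ v : V, v ≠ 0 → a (0, v) ≠ 0 := fun v hv => (hpol 0 v (hmem0 v hv)).1.2.1
  refine ⟨δ, hδ, hball, fun z => k (z.1, z.2.1, a z.2), hsmooth, ?_, ?_, ?_⟩
  · intro t ht s v hsv
    obtain ⟨h1, h2⟩ := hpol s v hsv
    rw [h2]
    exact hexp t ht s _ h1
  · intro t ht v hv
    have h1 := hder t ht (a (0, v)) (hane v hv)
    rw [← hcone v hv] at h1
    simp only
    rw [← hcone v hv]
    exact h1
  · intro t ht v hv
    have hO : IsOpen ({0}ᶜ : Set V) := isOpen_compl_singleton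
    have ha0 : DifferentiableAt ℝ (fun w : V => a (0, w)) v := by
      have h1 : ContDiffOn ℝ ∞ (fun w : V => a (0, w)) {0}ᶜ :=
        ha.comp (f := fun w : V => ((0 : ℝ), w)) (ContDiff.contDiffOn (by fun_prop))
          fun w hw => hmem0 w hw
      exact (h1.contDiffAt (hO.mem_nhds hv)).differentiableAt (by simp)
    have hk0 : ∀ w : V, w ≠ 0 → DifferentiableAt ℝ (fun w : V => k (t, 0, w)) w := by
      intro w hw
      have h1 : ContDiffOn ℝ ∞ (fun w : V => k (t, 0, w)) {0}ᶜ :=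
        hk.comp (f := fun w : V => ((t, 0, w) : ℝ × ℝ × V)) (ContDiff.contDiffOn (by fun_prop))
          fun w hw => ⟨ht, le_rfl, hw, by simpa using hε⟩
      exact (h1.contDiffAt (hO.mem_nhds hw)).differentiableAt (by simp)
    have hD1 := (hk0 _ (hane v hv)).hasFDerivAt
    have hblow : Function.Injective (fderiv ℝ (fun w : V => k (t, 0, w)) (a (0, v))) := by
      have h1 := hinj t ht (a (0, v)) (hane v hv)
      have h2 : (coneDeriv V W (Ψ t) p : V → W) =ᶠ[𝓝 (a (0, v))] fun w : V => k (t, 0, w) := by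
        filter_upwards [hO.mem_nhds (hane v hv)] with w hw
        exact hder t ht w hw
      have h3 := h2.fderiv_eq (𝕜 := ℝ)
      exact h3 ▸ h1
    -- Differentiating `B ∘ a (0, ·) = id` shows that the derivative of the cone-derivative of `φ`
    -- is injective.
    obtain ⟨B, -, hBinv, hB⟩ := hφ.exists_coneDeriv_inverse p hp
    have hBd := ((hB.contDiffAt (hO.mem_nhds (hane v hv))).differentiableAt (by simp)).hasFDerivAt
    have hBa : HasFDerivAt (fun w : V => B (a (0, w)))
        ((fderiv ℝ B (a (0, v))).comp (fderiv ℝ (fun w : V => a (0, w)) v)) v :=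
      HasFDerivAt.comp (f := fun w : V => a (0, w)) v hBd ha0.hasFDerivAt
    have hid : (fun w : V => B (a (0, w))) =ᶠ[𝓝 v] id := by
      filter_upwards [hO.mem_nhds hv] with w hw
      rw [← hcone w hw]
      exact hBinv.1 hw
    have hcomp := hBa.unique ((hasFDerivAt_id v).congr_of_eventuallyEq hid)
    refine ⟨(fderiv ℝ (fun w : V => k (t, 0, w)) (a (0, v))).comp
      (fderiv ℝ (fun w : V => a (0, w)) v), ?_,
      HasFDerivAt.comp (f := fun w : V => a (0, w)) v hD1 ha0.hasFDerivAt⟩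
    rw [ContinuousLinearMap.coe_comp]
    refine hblow.comp ?_
    intro x y hxy
    have h3 := congrArg (fun A : V →L[ℝ] V => A x) hcomp
    have h4 := congrArg (fun A : V →L[ℝ] V => A y) hcomp
    simp only [ContinuousLinearMap.comp_apply, ContinuousLinearMap.id_apply] at h3 h4
    rw [← h3, ← h4, hxy]

end Expansion

section LinearExpansion

variable {V : Type} [NormedAddCommGroup V] [InnerProductSpace ℝ V] [FiniteDimensional ℝ V]
  [Nontrivial V] {M : Type*} [TopologicalSpace M] [ChartedSpace V M] [IsManifold 𝓘(ℝ, V) ∞ M]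
  {W : Type*} [NormedAddCommGroup W] [NormedSpace ℝ W] [FiniteDimensional ℝ W]
  {N : Type*} [TopologicalSpace N] [ChartedSpace W N] [IsManifold 𝓘(ℝ, W) ∞ N]

/-- The second order expansion in polar coordinates of a family of cone-immersions with linear
tangent cones. -/
theorem exists_linear_polar_expansion {S : Set M} {φ : M → M} (hφ : IsConeDiffeo V S φ) {p : M}
    (hp : p ∈ S) {Ψ : ℝ → M → N} {q : N} (hq : ∀ t ∈ Icc (0 : ℝ) 1, Ψ t p = q)
    (hΨ : IsConeSmoothFamily V W S Ψ) (hinj : ∀ t ∈ Icc (0 : ℝ) 1, ∀ v : V, v ≠ 0 →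
      Function.Injective (blowupDeriv V W (Ψ t) p v))
    (hlin : ∀ t ∈ Icc (0 : ℝ) 1, ∃ P : Submodule ℝ W,
      range (coneDeriv V W (Ψ t) p : V → W) = (P : Set W))
    (hf : ContMDiffAt 𝓘(ℝ, V) 𝓘(ℝ, W) ∞ (fun x => Ψ 0 (φ x)) p) :
    ∃ δ > 0, Metric.ball (chartAt V p p) δ ⊆ (chartAt V p).target ∧
      ∃ (B : ℝ → V →L[ℝ] W) (C : ℝ × V → V) (k : ℝ × ℝ × V → W),
      ContDiffOn ℝ ∞ B (Icc 0 1) ∧ IsHomogIsotopy C ∧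
      ContDiffOn ℝ ∞ k (Icc 0 1 ×ˢ polarDomain V δ) ∧
      ∀ t ∈ Icc (0 : ℝ) 1, ∀ s v, (s, v) ∈ polarDomain V δ →
        Ψ t (φ (polar p s v)) ∈ (chartAt W q).source ∧
        chartAt W q (Ψ t (φ (polar p s v))) =
          chartAt W q q + s • B t (C (t, v)) + s ^ 2 • k (t, s, v) := by
  have : CompleteSpace W := FiniteDimensional.complete ℝ W
  have hz : (0 : ℝ) ∈ Icc (0 : ℝ) 1 := ⟨le_rfl, zero_le_one⟩
  obtain ⟨δ, hδ, hball, k, hk, hexp, hder, hD⟩ := exists_polar_expansion_comp hφ hp hq hΨ hinj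
  have hmem0 : ∀ v : V, v ≠ 0 → ((0 : ℝ), v) ∈ polarDomain V δ :=
    fun v hv => ⟨le_rfl, hv, by simpa using hδ⟩
  set A : ℝ × V → W := fun z => k (z.1, 0, z.2) with hA
  have hAs : ContDiffOn ℝ ∞ A (Icc 0 1 ×ˢ {0}ᶜ) :=
    hk.comp (f := fun z : ℝ × V => ((z.1, 0, z.2) : ℝ × ℝ × V)) (ContDiff.contDiffOn (by fun_prop))
      fun z hz => ⟨hz.1, hmem0 z.2 hz.2⟩
  have hom : ∀ t ∈ Icc (0 : ℝ) 1, ∀ v, v ≠ 0 → ∀ a : ℝ, 0 < a → A (t, a • v) = a • A (t, v) :=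
    fun t ht v hv a ha => homogeneous_of_expansion hδ hk.continuousOn ht
      (g := fun y => chartAt W q (Ψ t (φ ((chartAt V p).symm (chartAt V p p + y)))))
      (fun s v hsv => (hexp t ht s v hsv).2) hv ha
  have hAinj : ∀ t ∈ Icc (0 : ℝ) 1, ∀ v, v ≠ 0 →
      Function.Injective (spaceDeriv A (Icc 0 1) {0}ᶜ (t, v)) := by
    intro t ht v hv
    obtain ⟨D, hDi, hD'⟩ := hD t ht v hv
    have := (hasFDerivAt_spaceDeriv isOpen_compl_singleton hAs ht hv).unique hD'
    rw [this]
    exact hDi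
  have hAlin : ∀ t ∈ Icc (0 : ℝ) 1, ∃ P : Submodule ℝ W, (∀ v, v ≠ 0 → A (t, v) ∈ P) ∧
      ∀ w ∈ P, w ≠ 0 → ∃ v, v ≠ 0 ∧ A (t, v) = w := by
    intro t ht
    obtain ⟨P, hP⟩ := hlin t ht
    refine ⟨P, fun v hv => ?_, fun w hw hw0 => ?_⟩
    · have h1 : A (t, v) ∈ (P : Set W) := by
        rw [← hP]
        exact ⟨_, hder t ht v hv⟩
      exact h1
    · have h1 : w ∈ range (coneDeriv V W (Ψ t) p : V → W) := by rw [hP]; exact hw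
      obtain ⟨u, hu⟩ := h1
      have hu0 : u ≠ 0 := by
        rintro rfl
        exact hw0 (hu.symm.trans (coneDeriv_zero (Ψ t) p))
      -- Reparametrization does not change the image of the cone-derivative: a preimage under that
      -- of `Ψ t` is pulled back by the inverse of that of `φ`.
      obtain ⟨G, hG0, hG, -⟩ := hφ.exists_coneDeriv_inverse p hp
      refine ⟨G u, hG0 hu0, ?_⟩
      have h2 := hder t ht (G u) (hG0 hu0)
      rw [hG.2 hu0] at h2
      exact h2.symm.trans hu
  set F : V → W := fun y => chartAt W q (Ψ 0 (φ ((chartAt V p).symm y))) with hF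
  have hFd : DifferentiableAt ℝ F (chartAt V p p) := by
    have e1 : (chartAt V p).symm (chartAt V p p) = p :=
      (chartAt V p).left_inv (mem_chart_source V p)
    have h1 : ContMDiffAt 𝓘(ℝ, V) 𝓘(ℝ, V) ∞ (chartAt V p).symm (chartAt V p p) :=
      (contMDiffOn_chart_symm (I := 𝓘(ℝ, V)) (x := p)).contMDiffAt
        ((chartAt V p).open_target.mem_nhds (mem_chart_target V p))
    have h2 : ContMDiffAt 𝓘(ℝ, W) 𝓘(ℝ, W) ∞ (chartAt W q) q :=
      (contMDiffOn_chart (I := 𝓘(ℝ, W)) (x := q)).contMDiffAt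
        ((chartAt W q).open_source.mem_nhds (mem_chart_source W q))
    have hfp : Ψ 0 (φ p) = q := by rw [hφ.fix p hp, hq 0 hz]
    have h3 : ContMDiffAt 𝓘(ℝ, V) 𝓘(ℝ, W) ∞ (fun y => Ψ 0 (φ ((chartAt V p).symm y)))
        (chartAt V p p) :=
      ContMDiffAt.comp (g := fun x => Ψ 0 (φ x)) (chartAt V p p) (by rw [e1]; exact hf) h1
    have h4 : ContMDiffAt 𝓘(ℝ, V) 𝓘(ℝ, W) ∞ F (chartAt V p p) :=
      ContMDiffAt.comp (g := chartAt W q) (chartAt V p p) (by rw [e1, hfp]; exact h2) h3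
    exact h4.contDiffAt.differentiableAt (by simp)
  -- Smoothness of the initial representative enters here: its one-sided derivatives along rays are
  -- values of an honest differential.
  have hA0 : ∀ v, v ≠ 0 → A (0, v) = fderiv ℝ F (chartAt V p p) v := by
    intro v hv
    have h1 : HasDerivWithinAt (fun s : ℝ => F (chartAt V p p + s • v)) (k (0, 0, v)) (Ici 0) 0 :=
      hasDerivWithinAt_of_expansion (k := fun s => k (0, s, v)) hδ hv
        ((hk.continuousOn (0, 0, v) ⟨hz, hmem0 v hv⟩).tendsto.comp
          (tendsto_line_polarDomain hδ hz hv)) fun s hs => (hexp 0 hz s v hs).2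
    have h2 : HasDerivAt (fun s : ℝ => chartAt V p p + s • v) v 0 := by
      simpa using ((hasDerivAt_id (0 : ℝ)).smul_const v).const_add (chartAt V p p)
    have h3 : HasFDerivAt F (fderiv ℝ F (chartAt V p p)) (chartAt V p p + (0 : ℝ) • v) := by
      simpa using hFd.hasFDerivAt
    have h4 : HasDerivAt (fun s : ℝ => F (chartAt V p p + s • v))
        (fderiv ℝ F (chartAt V p p) v) 0 :=
      h3.comp_hasDerivAt (f := fun s : ℝ => chartAt V p p + s • v) (0 : ℝ) h2
    exact (uniqueDiffWithinAt_Ici (0 : ℝ)).eq_deriv _ h1 h4.hasDerivWithinAt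
  obtain ⟨B, C, hB, hC, hAC⟩ := exists_isHomogIsotopy hAs hom hAinj hAlin hA0
  -- A second division by `s` isolates the quadratic remainder.
  obtain ⟨k₂, hk₂, hkk⟩ := exists_contDiffOn_eq_add_smul hk
  refine ⟨δ, hδ, hball, B, C, k₂, hB, hC, hk₂, fun t ht s v hsv => ⟨(hexp t ht s v hsv).1, ?_⟩⟩
  rw [(hexp t ht s v hsv).2, hkk t ht s v hsv, ← hAC t ht v hsv.2.1, smul_add, smul_smul, ← sq,
    add_assoc]

end LinearExpansion

/-! ### Constructions of cone-diffeomorphisms -/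

section Constructions

variable {V : Type} [NormedAddCommGroup V] [NormedSpace ℝ V]
  {M : Type*} [TopologicalSpace M] [ChartedSpace V M] [IsManifold 𝓘(ℝ, V) ∞ M]

theorem add_smul_mem_target {V : Type} [NormedAddCommGroup V] [NormedSpace ℝ V] {M : Type*}
    [TopologicalSpace M] [ChartedSpace V M] {p : M} {ε : ℝ}
    (hε : Metric.ball (chartAt V p p) ε ⊆ (chartAt V p).target) {s : ℝ} {v : V} (hs : 0 ≤ s)
    (h : s * ‖v‖ < ε) : chartAt V p p + s • v ∈ (chartAt V p).target := by
  refine hε ?_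
  rw [Metric.mem_ball, dist_self_add_left, norm_smul, Real.norm_of_nonneg hs]
  exact h

/-- A map given in polar coordinates around a fixed point by a smooth map of the blowup. -/
theorem coneSmoothAt_of_polar_eq {p : M} {ε δ : ℝ} (hδ : 0 < δ)
    (hε : Metric.ball (chartAt V p p) ε ⊆ (chartAt V p).target) {a : ℝ × V → V}
    (ha : ContDiffOn ℝ ∞ a (polarDomain V δ)) {f : M → M} (hfp : f p = p)
    (h : ∀ s v, (s, v) ∈ polarDomain V δ →
      s * ‖a (s, v)‖ < ε ∧ f (polar p s v) = polar p s (a (s, v))) :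
    ConeSmoothAt V V f p ∧ ∀ v : V, v ≠ 0 → (coneDeriv V V f p v : V) = a (0, v) := by
  have hsm : ContMDiffOn 𝓘(ℝ, ℝ × V) 𝓘(ℝ, V) ∞ (fun z : ℝ × V => f (polar p z.1 z.2))
      (polarDomain V δ) := by
    have h1 : ContMDiffOn 𝓘(ℝ, V) 𝓘(ℝ, V) ∞ (chartAt V p).symm (chartAt V p).target :=
      contMDiffOn_chart_symm
    have h2 : ContDiffOn ℝ ∞ (fun z : ℝ × V => chartAt V p p + z.1 • a z) (polarDomain V δ) :=
      contDiffOn_const.add (contDiffOn_fst.smul ha)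
    refine (h1.comp h2.contMDiffOn fun z hz => ?_).congr fun z hz => (h z.1 z.2 hz).2
    exact add_smul_mem_target hε hz.1 (h z.1 z.2 hz).1
  refine ⟨⟨δ, hδ, hsm⟩, fun v hv => ?_⟩
  have h0 : ((0 : ℝ), v) ∈ polarDomain V δ := ⟨le_rfl, hv, by simpa using hδ⟩
  have htend : Tendsto (fun s : ℝ => (s, v)) (𝓝[≥] 0) (𝓝[polarDomain V δ] (0, v)) := by
    refine tendsto_nhdsWithin_iff.2 ⟨?_, eventually_mem_polarDomain hδ hv⟩
    have : Continuous fun s : ℝ => (s, v) := by fun_prop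
    exact (this.tendsto 0).mono_left nhdsWithin_le_nhds
  refine coneDeriv_eq ((hsm.continuousOn _ h0).tendsto.comp htend) ?_
  rw [hfp]
  refine hasDerivWithinAt_of_expansion (k := fun s => a (s, v)) (q := chartAt V p p) hδ hv
    ((ha.continuousOn _ h0).tendsto.comp htend) fun s hs => ?_
  rw [(h s v hs).2, polar, (chartAt V p).right_inv (add_smul_mem_target hε hs.1 (h s v hs).1)]

theorem isConeDiffeo_id (S : Set M) : IsConeDiffeo V S (id : M → M) := by
  have key : ∀ p : M, ConeSmoothAt V V (id : M → M) p ∧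
      ∀ v : V, v ≠ 0 → (coneDeriv V V (id : M → M) p v : V) = v := by
    intro p
    obtain ⟨ε, hε0, hε⟩ := exists_ball_subset_target (V := V) p
    exact coneSmoothAt_of_polar_eq hε0 hε (a := fun z => z.2) contDiffOn_snd rfl
      fun s v hsv => ⟨hsv.2.2, rfl⟩
  exact
    { continuous := continuous_id
      smooth := contMDiffOn_id
      coneSmooth := fun p _ => (key p).1
      fix := fun _ _ => rfl
      mapsTo := mapsTo_id _
      exists_inverse := ⟨id, mapsTo_id _, ⟨fun _ _ => rfl, fun _ _ => rfl⟩, contMDiffOn_id⟩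
      coneDeriv_ne_zero := fun p _ v hv => by
        rw [(key p).2 v hv]
        exact hv
      exists_coneDeriv_inverse := fun p _ =>
        ⟨id, mapsTo_id _, ⟨fun v hv => (key p).2 v hv, fun v hv => (key p).2 v hv⟩, contDiffOn_id⟩ }

/-- On the blowup the lifts `(s, v) ↦ (s, a (s, v))` compose, and restricting to `s = 0` gives the
chain rule for cone-derivatives. -/
theorem IsConeDiffeo.comp [FiniteDimensional ℝ V] {S : Set M} {φ ψ : M → M}
    (hφ : IsConeDiffeo V S φ) (hψ : IsConeDiffeo V S ψ) : IsConeDiffeo V S (φ ∘ ψ) := by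
  have key : ∀ p ∈ S, ConeSmoothAt V V (φ ∘ ψ) p ∧ ∀ v : V, v ≠ 0 →
      (coneDeriv V V (φ ∘ ψ) p v : V) = coneDeriv V V φ p (coneDeriv V V ψ p v : V) := by
    intro p hp
    obtain ⟨ε, hε0, hε⟩ := exists_ball_subset_target (V := V) p
    obtain ⟨δ₁, hδ₁, -, a, ha, hapol, had⟩ := hφ.exists_polar_eq hp hε0
    obtain ⟨δ, hδ, -, b, hb, hbpol, hbd⟩ := hψ.exists_polar_eq hp hδ₁
    have h1 := coneSmoothAt_of_polar_eq (f := φ ∘ ψ) hδ hε (a := fun z => a (z.1, b z))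
      (ha.comp (contDiffOn_fst.prodMk hb) fun z hz => (hbpol z.1 z.2 hz).1)
      (by simp [hψ.fix p hp, hφ.fix p hp]) fun s v hsv => by
        obtain ⟨h2, h3⟩ := hbpol s v hsv
        obtain ⟨h4, h5⟩ := hapol s _ h2
        exact ⟨h4.2.2, by rw [Function.comp_apply, h3, h5]⟩
    refine ⟨h1.1, fun v hv => ?_⟩
    have hne : b (0, v) ≠ 0 := (hbpol 0 v ⟨le_rfl, hv, by simpa using hδ⟩).1.2.1
    rw [h1.2 v hv, hbd v hv, had _ hne]
  obtain ⟨χ, hχm, hχ, hχs⟩ := hφ.exists_inverse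
  obtain ⟨η, hηm, hη, hηs⟩ := hψ.exists_inverse
  exact
    { continuous := hφ.continuous.comp hψ.continuous
      smooth := hφ.smooth.comp hψ.smooth hψ.mapsTo
      coneSmooth := fun p hp => (key p hp).1
      fix := fun p hp => by simp [hψ.fix p hp, hφ.fix p hp]
      mapsTo := hφ.mapsTo.comp hψ.mapsTo
      exists_inverse := ⟨η ∘ χ, hηm.comp hχm, hη.comp hχ hψ.mapsTo hχm, hηs.comp hχs hχm⟩
      coneDeriv_ne_zero := fun p hp v hv => by
        rw [(key p hp).2 v hv]
        exact hφ.coneDeriv_ne_zero p hp (hψ.coneDeriv_ne_zero p hp hv)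
      exists_coneDeriv_inverse := fun p hp => by
        obtain ⟨B, hBm, hB, hBs⟩ := hφ.exists_coneDeriv_inverse p hp
        obtain ⟨B', hBm', hB', hBs'⟩ := hψ.exists_coneDeriv_inverse p hp
        refine ⟨B' ∘ B, hBm'.comp hBm, ⟨fun v hv => ?_, fun v hv => ?_⟩, hBs'.comp hBs hBm⟩
        · have h1 : B (coneDeriv V V φ p (coneDeriv V V ψ p v : V)) = coneDeriv V V ψ p v :=
            hB.1 (hψ.coneDeriv_ne_zero p hp hv)
          rw [(key p hp).2 v hv]
          exact (congrArg B' h1).trans (hB'.1 hv)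
        · rw [Function.comp_apply, (key p hp).2 _ (hBm' (hBm hv)), hB'.2 (hBm hv)]
          exact hB.2 hv }

end Constructions

/-! ### Self-maps of a manifold supported in a coordinate ball. -/

section Transplant

variable {V : Type} [NormedAddCommGroup V]
  {M : Type*} [TopologicalSpace M] [ChartedSpace V M]

open Classical in
/-- The family of self-maps of `M` that fixes `p` and is given by `g` in the chart around `p`. -/
noncomputable def transplant (p : M) (g : ℝ × V → V) (t : ℝ) (x : M) : M :=
  if x ∈ (chartAt V p).source ∧ x ≠ p then
    (chartAt V p).symm (chartAt V p p + g (t, chartAt V p x - chartAt V p p)) else x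

variable {p : M} {g : ℝ × V → V} {t : ℝ}

theorem transplant_self (p : M) (g : ℝ × V → V) (t : ℝ) : transplant p g t p = p := by
  simp [transplant]

theorem transplant_of_mem {x : M} (hx : x ∈ (chartAt V p).source) (hxp : x ≠ p) :
    transplant p g t x =
      (chartAt V p).symm (chartAt V p p + g (t, chartAt V p x - chartAt V p p)) := by
  simp [transplant, hx, hxp]

theorem transplant_of_notMem {x : M} (hx : x ∉ (chartAt V p).source) :
    transplant p g t x = x := by
  simp [transplant, hx]

theorem chart_sub_ne_zero {x : M} (hx : x ∈ (chartAt V p).source) (hxp : x ≠ p) :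
    chartAt V p x - chartAt V p p ≠ 0 := by
  rw [sub_ne_zero]
  exact fun h => hxp ((chartAt V p).injOn hx (mem_chart_source V p) h)

theorem transplant_symm {u : V} (hu : u ≠ 0) (hut : chartAt V p p + u ∈ (chartAt V p).target) :
    transplant p g t ((chartAt V p).symm (chartAt V p p + u)) =
      (chartAt V p).symm (chartAt V p p + g (t, u)) := by
  have h1 := (chartAt V p).map_target hut
  have h2 : (chartAt V p).symm (chartAt V p p + u) ≠ p := by
    intro h3
    have h4 := congrArg (chartAt V p) h3
    rw [(chartAt V p).right_inv hut] at h4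
    exact hu (by simpa using h4)
  rw [transplant_of_mem h1 h2, (chartAt V p).right_inv hut, add_sub_cancel_left]

theorem exists_transplant_eq (g : ℝ × V → V) (t : ℝ) {x : M}
    (hx : x ∈ (chartAt V p).source) (hxp : x ≠ p) :
    ∃ u, u ≠ 0 ∧ chartAt V p p + u ∈ (chartAt V p).target ∧
      (chartAt V p).symm (chartAt V p p + u) = x ∧
      transplant p g t x = (chartAt V p).symm (chartAt V p p + g (t, u)) := by
  refine ⟨chartAt V p x - chartAt V p p, chart_sub_ne_zero hx hxp, ?_, ?_,
    transplant_of_mem hx hxp⟩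
  · rw [add_sub_cancel]
    exact (chartAt V p).map_source hx
  · rw [add_sub_cancel]
    exact (chartAt V p).left_inv hx

variable [NormedSpace ℝ V]

/-- A family of self-maps of `V ∖ 0` that are supported in the ball of radius `r`. -/
structure IsSupportedFamily (g : ℝ × V → V) (r : ℝ) : Prop where
  smooth : ContDiffOn ℝ ∞ g (Icc 0 1 ×ˢ {0}ᶜ)
  ne_zero : ∀ t ∈ Icc (0 : ℝ) 1, ∀ u, u ≠ 0 → g (t, u) ≠ 0
  eq_self : ∀ t ∈ Icc (0 : ℝ) 1, ∀ u, r ≤ ‖u‖ → g (t, u) = u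
  norm_lt : ∀ t ∈ Icc (0 : ℝ) 1, ∀ u, u ≠ 0 → ‖u‖ < r → ‖g (t, u)‖ < r

variable {h : ℝ × V → V} {r : ℝ}

theorem IsSupportedFamily.add_mem_target (hg : IsSupportedFamily g r)
    (hr : Metric.closedBall (chartAt V p p) r ⊆ (chartAt V p).target) (ht : t ∈ Icc (0 : ℝ) 1)
    {u : V} (hu : u ≠ 0) (hut : chartAt V p p + u ∈ (chartAt V p).target) :
    chartAt V p p + g (t, u) ∈ (chartAt V p).target := by
  rcases lt_or_ge ‖u‖ r with h | h
  · refine hr (Metric.ball_subset_closedBall ?_)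
    rw [Metric.mem_ball, dist_self_add_left]
    exact hg.norm_lt t ht u hu h
  · rwa [hg.eq_self t ht u h]

theorem IsSupportedFamily.transplant_eq_self (hg : IsSupportedFamily g r)
    (ht : t ∈ Icc (0 : ℝ) 1) {x : M}
    (hx : x ∉ (chartAt V p).symm '' Metric.closedBall (chartAt V p p) r) :
    transplant p g t x = x := by
  by_cases hxs : x ∈ (chartAt V p).source
  · by_cases hxp : x = p
    · rw [hxp, transplant_self]
    · obtain ⟨u, hu, hut, hux, h⟩ := exists_transplant_eq g t hxs hxp
      rw [h, hg.eq_self t ht u, hux]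
      by_contra hlt
      refine hx ⟨_, ?_, hux⟩
      rw [Metric.mem_closedBall, dist_self_add_left]
      exact (not_le.1 hlt).le
  · exact transplant_of_notMem hxs

theorem IsSupportedFamily.transplant_transplant (hg : IsSupportedFamily g r)
    (hr : Metric.closedBall (chartAt V p p) r ⊆ (chartAt V p).target) (ht : t ∈ Icc (0 : ℝ) 1)
    (hgh : ∀ u, u ≠ 0 → h (t, g (t, u)) = u) (x : M) :
    transplant p h t (transplant p g t x) = x := by
  by_cases hxs : x ∈ (chartAt V p).source
  · by_cases hxp : x = p
    · rw [hxp, transplant_self, transplant_self]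
    · obtain ⟨u, hu, hut, hux, h'⟩ := exists_transplant_eq g t hxs hxp
      rw [h', transplant_symm (hg.ne_zero t ht u hu) (hg.add_mem_target hr ht hu hut),
        hgh u hu, hux]
  · rw [transplant_of_notMem hxs, transplant_of_notMem hxs]

/-- Two open sets cover the complement of `p`: the punctured chart domain, and the complement of the
image of the closed ball, where the map is the identity. That image is compact, hence closed since
`M` is Hausdorff. -/
theorem IsSupportedFamily.contMDiffOn_transplant [FiniteDimensional ℝ V] [T2Space M]
    [IsManifold 𝓘(ℝ, V) ∞ M]
    (hr : Metric.closedBall (chartAt V p p) r ⊆ (chartAt V p).target)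
    (hg : IsSupportedFamily g r) :
    ContMDiffOn (𝓘(ℝ, ℝ).prod 𝓘(ℝ, V)) 𝓘(ℝ, V) ∞ (fun z : ℝ × M => transplant p g z.1 z.2)
      (Icc 0 1 ×ˢ {p}ᶜ) := by
  have := FiniteDimensional.proper ℝ V
  set e := chartAt V p with he
  have hO : IsOpen (e.source ∩ {p}ᶜ) := e.open_source.inter isOpen_compl_singleton
  have h1 : ContMDiffOn (𝓘(ℝ, ℝ).prod 𝓘(ℝ, V)) 𝓘(ℝ, V) ∞
      (fun z : ℝ × M => transplant p g z.1 z.2) (Icc 0 1 ×ˢ (e.source ∩ {p}ᶜ)) := by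
    have a1 : ContMDiffOn (𝓘(ℝ, ℝ).prod 𝓘(ℝ, V)) 𝓘(ℝ, V) ∞ (fun z : ℝ × M => e z.2)
        (Icc 0 1 ×ˢ (e.source ∩ {p}ᶜ)) :=
      (contMDiffOn_chart (I := 𝓘(ℝ, V)) (x := p)).comp contMDiffOn_snd fun z hz => hz.2.1
    have a2 : ContMDiffOn (𝓘(ℝ, ℝ).prod 𝓘(ℝ, V)) 𝓘(ℝ, ℝ × V) ∞
        (fun z : ℝ × M => (z.1, e z.2 - e p)) (Icc 0 1 ×ˢ (e.source ∩ {p}ᶜ)) :=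
      contMDiffOn_fst.prodMk_space (a1.sub contMDiffOn_const)
    have a3 : ContMDiffOn (𝓘(ℝ, ℝ).prod 𝓘(ℝ, V)) 𝓘(ℝ, V) ∞
        (fun z : ℝ × M => e p + g (z.1, e z.2 - e p)) (Icc 0 1 ×ˢ (e.source ∩ {p}ᶜ)) :=
      contMDiffOn_const.add (hg.smooth.contMDiffOn.comp a2
        fun z hz => ⟨hz.1, chart_sub_ne_zero hz.2.1 hz.2.2⟩)
    refine ((contMDiffOn_chart_symm (I := 𝓘(ℝ, V)) (x := p)).comp a3 fun z hz => ?_).congr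
      fun z hz => transplant_of_mem hz.2.1 hz.2.2
    refine hg.add_mem_target hr hz.1 (chart_sub_ne_zero hz.2.1 hz.2.2) ?_
    rw [add_sub_cancel]
    exact e.map_source hz.2.1
  have hK : IsClosed (e.symm '' Metric.closedBall (e p) r) :=
    ((isCompact_closedBall _ _).image_of_continuousOn (e.continuousOn_symm.mono hr)).isClosed
  have h2 : ContMDiffOn (𝓘(ℝ, ℝ).prod 𝓘(ℝ, V)) 𝓘(ℝ, V) ∞
      (fun z : ℝ × M => transplant p g z.1 z.2)
      (Icc 0 1 ×ˢ (e.symm '' Metric.closedBall (e p) r)ᶜ) :=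
    contMDiffOn_snd.congr fun z hz => hg.transplant_eq_self hz.1 hz.2
  have hnhds : ∀ {O : Set M} {z : ℝ × M}, IsOpen O → z ∈ Icc (0 : ℝ) 1 ×ˢ ({p}ᶜ : Set M) →
      z.2 ∈ O → Icc (0 : ℝ) 1 ×ˢ O ∈ 𝓝[Icc (0 : ℝ) 1 ×ˢ ({p}ᶜ : Set M)] z := by
    intro O z hO' hz hzO
    rw [mem_nhdsWithin]
    exact ⟨univ ×ˢ O, isOpen_univ.prod hO', ⟨mem_univ _, hzO⟩, fun y hy => ⟨hy.2.1, hy.1.2⟩⟩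
  intro z hz
  by_cases hzs : z.2 ∈ e.source
  · exact (h1 z ⟨hz.1, hzs, hz.2⟩).mono_of_mem_nhdsWithin (hnhds hO hz ⟨hzs, hz.2⟩)
  · have hzK : z.2 ∈ (e.symm '' Metric.closedBall (e p) r)ᶜ := by
      rintro ⟨y, hy, hyz⟩
      exact hzs (hyz ▸ e.map_target (hr hy))
    exact (h2 z ⟨hz.1, hzK⟩).mono_of_mem_nhdsWithin (hnhds hK.isOpen_compl hz hzK)

end Transplant

/-! ### Cone-diffeomorphisms with prescribed cone-derivatives. -/

section Families

variable {V : Type} [NormedAddCommGroup V] [InnerProductSpace ℝ V] [FiniteDimensional ℝ V]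
  [Nontrivial V] {M : Type*} [TopologicalSpace M] [ChartedSpace V M] [IsManifold 𝓘(ℝ, V) ∞ M]

/-- A family of cone-diffeomorphisms with given cone-derivatives at a cone point `p`, and the
identity at the other cone points. -/
theorem IsHomogIsotopy.exists_coneDiffeo [T2Space M] {S : Set M} (hS : S.Finite) {p : M}
    (hp : p ∈ S) {C : ℝ × V → V} (hC : IsHomogIsotopy C) {ε : ℝ} (hε : 0 < ε) :
    ∃ c > (0 : ℝ), ∃ δ > (0 : ℝ), ∃ (D : ℝ × V → V) (θ : ℝ → M → M),
      ContDiffOn ℝ ∞ D (Icc 0 1 ×ˢ {0}ᶜ) ∧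
      (∀ t ∈ Icc (0 : ℝ) 1, ∀ u, u ≠ 0 → D (t, u) ≠ 0 ∧ C (t, D (t, u)) = c • u) ∧
      (∀ t ∈ Icc (0 : ℝ) 1, IsConeDiffeo V S (θ t)) ∧
      ContMDiffOn (𝓘(ℝ, ℝ).prod 𝓘(ℝ, V)) 𝓘(ℝ, V) ∞ (fun z : ℝ × M => θ z.1 z.2)
        (Icc 0 1 ×ˢ {p}ᶜ) ∧
      ∀ t ∈ Icc (0 : ℝ) 1, ∀ s v, (s, v) ∈ polarDomain V δ →
        s * ‖D (t, v)‖ < ε ∧ θ t (polar p s v) = polar p s (D (t, v)) := by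
  classical
  have hprop := FiniteDimensional.proper ℝ V
  set e := chartAt V p with he
  obtain ⟨r₀, hr₀, hball⟩ := exists_ball_subset_target (V := V) p
  have hev : ∀ᶠ y in 𝓝 (e p), e.symm y ∈ (S \ {p})ᶜ := by
    have h1 : (S \ {p})ᶜ ∈ 𝓝 (e.symm (e p)) := by
      rw [e.left_inv (mem_chart_source V p)]
      exact (hS.subset sdiff_subset).isClosed.isOpen_compl.mem_nhds (by simp)
    exact (e.continuousAt_symm (mem_chart_target V p)).eventually_mem h1
  obtain ⟨r₂, hr₂, hS₂⟩ := Metric.eventually_nhds_iff.1 hev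
  -- Small enough that the closed ball lies in the chart and contains no other cone point. The bound
  -- by `ε` becomes the smallness of `s * ‖D (t, v)‖`.
  set r := min (min r₀ r₂ / 2) ε with hrdef
  have hr0 : 0 < r := lt_min (half_pos (lt_min hr₀ hr₂)) hε
  have hr0' : r < min r₀ r₂ := (min_le_left _ _).trans_lt (half_lt_self (lt_min hr₀ hr₂))
  have hr : Metric.closedBall (e p) r ⊆ e.target :=
    (Metric.closedBall_subset_ball (hr0'.trans_le (min_le_left _ _))).trans hball
  have hSK : ∀ p' ∈ S, p' ≠ p → p' ∉ e.symm '' Metric.closedBall (e p) r := by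
    rintro p' hp' hne ⟨y, hy, rfl⟩
    refine hS₂ (y := y) ?_ ⟨hp', hne⟩
    exact (Metric.mem_closedBall.1 hy).trans_lt (hr0'.trans_le (min_le_right _ _))
  obtain ⟨c, hc, r₁, hr₁, m, D, φ, ψ, ⟨hDs, hD⟩, ⟨hφs, hψs, hφψ⟩, hid, hpol⟩ :=
    hC.exists_cutoff_inverse hr0
  have hφ : IsSupportedFamily φ r :=
    ⟨hφs, fun t ht u hu => (hφψ t ht u hu).1, fun t ht u hu => (hid t ht u hu).1, by
      intro t ht u hu hur
      by_contra hge
      -- If `φ` moved `u` out of the ball, `ψ` would fix the image, while `ψ` must send it back to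
      -- `u`.
      have h1 := (hid t ht _ (not_lt.1 hge)).2
      rw [(hφψ t ht u hu).2.2.2] at h1
      exact hge (h1 ▸ hur)⟩
  have hψ : IsSupportedFamily ψ r :=
    ⟨hψs, fun t ht u hu => (hφψ t ht u hu).2.1, fun t ht u hu => (hid t ht u hu).2, by
      intro t ht u hu hur
      by_contra hge
      have h1 := (hid t ht _ (not_lt.1 hge)).1
      rw [(hφψ t ht u hu).2.2.1] at h1
      exact hge (h1 ▸ hur)⟩
  set δ := min r₁ r with hδdef
  have hδ : 0 < δ := lt_min hr₁ hr0
  have hθpol : ∀ t ∈ Icc (0 : ℝ) 1, ∀ s v, (s, v) ∈ polarDomain V δ →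
      s * ‖D (t, v)‖ < r ∧ transplant p φ t (polar p s v) = polar p s (D (t, v)) := by
    rintro t ht s v ⟨hs, hv, hsv⟩
    simp only at hs hv hsv
    rcases hs.eq_or_lt with rfl | hs'
    · simp [transplant_self, hr0]
    · obtain ⟨h1, h2⟩ := hpol t ht s hs' v hv (hsv.trans_le (min_le_left _ _))
      rw [norm_smul, Real.norm_of_nonneg hs] at h2
      refine ⟨h2, ?_⟩
      rw [polar, transplant_symm (smul_ne_zero hs'.ne' hv), h1, polar]
      exact add_smul_mem_target (Metric.ball_subset_closedBall.trans hr) hs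
        (hsv.trans_le (min_le_right _ _))
  have hD1 : ∀ t ∈ Icc (0 : ℝ) 1, ContDiffOn ℝ ∞ (fun u => D (t, u)) {0}ᶜ := fun t ht =>
    hDs.comp (f := fun u : V => (t, u)) (ContDiff.contDiffOn (by fun_prop)) fun u hu => ⟨ht, hu⟩
  have hC1 : ∀ t ∈ Icc (0 : ℝ) 1, ContDiffOn ℝ ∞ (fun u => C (t, u)) {0}ᶜ := fun t ht =>
    hC.smooth.comp (f := fun u : V => (t, u)) (ContDiff.contDiffOn (by fun_prop))
      fun u hu => ⟨ht, hu⟩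
  have keyp : ∀ t ∈ Icc (0 : ℝ) 1, ConeSmoothAt V V (transplant p φ t) p ∧
      ∀ v : V, v ≠ 0 → (coneDeriv V V (transplant p φ t) p v : V) = D (t, v) := fun t ht =>
    coneSmoothAt_of_polar_eq hδ (Metric.ball_subset_closedBall.trans hr)
      (a := fun z => D (t, z.2)) ((hD1 t ht).comp contDiffOn_snd fun z hz => hz.2.1)
      (transplant_self p φ t) (hθpol t ht)
  have hK : IsClosed (e.symm '' Metric.closedBall (e p) r) :=
    ((isCompact_closedBall _ _).image_of_continuousOn (e.continuousOn_symm.mono hr)).isClosed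
  have keyp' : ∀ t ∈ Icc (0 : ℝ) 1, ∀ p' ∈ S, p' ≠ p → ConeSmoothAt V V (transplant p φ t) p' ∧
      ∀ v : V, v ≠ 0 → (coneDeriv V V (transplant p φ t) p' v : V) = v := by
    intro t ht p' hp' hne
    obtain ⟨ρ₀, hρ₀, hball'⟩ := exists_ball_subset_target (V := V) p'
    have h1 : ∀ᶠ y in 𝓝 (chartAt V p' p'), (chartAt V p').symm y ∈
        (e.symm '' Metric.closedBall (e p) r)ᶜ := by
      refine ((chartAt V p').continuousAt_symm (mem_chart_target V p')).eventually_mem ?_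
      rw [(chartAt V p').left_inv (mem_chart_source V p')]
      exact hK.isOpen_compl.mem_nhds (hSK p' hp' hne)
    obtain ⟨ρ₁, hρ₁, h2⟩ := Metric.eventually_nhds_iff.1 h1
    refine coneSmoothAt_of_polar_eq (lt_min hρ₀ hρ₁) hball' (a := fun z => z.2) contDiffOn_snd
      (hφ.transplant_eq_self ht (hSK p' hp' hne)) fun s v hsv =>
        ⟨hsv.2.2.trans_le (min_le_left _ _), hφ.transplant_eq_self ht (h2 ?_)⟩
    rw [dist_self_add_left, norm_smul, Real.norm_of_nonneg hsv.1]
    exact hsv.2.2.trans_le (min_le_right _ _)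
  have hfix : ∀ t ∈ Icc (0 : ℝ) 1, ∀ g : ℝ × V → V, IsSupportedFamily g r → ∀ p' ∈ S,
      transplant p g t p' = p' := by
    intro t ht g hg p' hp'
    by_cases hne : p' = p
    · rw [hne, transplant_self]
    · exact hg.transplant_eq_self ht (hSK p' hp' hne)
  have hinv1 : ∀ t ∈ Icc (0 : ℝ) 1, ∀ x, transplant p ψ t (transplant p φ t x) = x := fun t ht =>
    hφ.transplant_transplant hr ht fun u hu => (hφψ t ht u hu).2.2.2
  have hinv2 : ∀ t ∈ Icc (0 : ℝ) 1, ∀ x, transplant p φ t (transplant p ψ t x) = x := fun t ht =>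
    hψ.transplant_transplant hr ht fun u hu => (hφψ t ht u hu).2.2.1
  have hmap1 : ∀ t ∈ Icc (0 : ℝ) 1, MapsTo (transplant p φ t) Sᶜ Sᶜ := by
    intro t ht x hx hxS
    have h1 := hfix t ht ψ hψ _ hxS
    rw [hinv1 t ht] at h1
    exact hx (h1 ▸ hxS)
  have hmap2 : ∀ t ∈ Icc (0 : ℝ) 1, MapsTo (transplant p ψ t) Sᶜ Sᶜ := by
    intro t ht x hx hxS
    have h1 := hfix t ht φ hφ _ hxS
    rw [hinv2 t ht] at h1
    exact hx (h1 ▸ hxS)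
  have hslice : ∀ t ∈ Icc (0 : ℝ) 1, ∀ g : ℝ × V → V, IsSupportedFamily g r →
      ContMDiffOn 𝓘(ℝ, V) 𝓘(ℝ, V) ∞ (transplant p g t) {p}ᶜ := by
    intro t ht g hg
    have h1 : ContMDiffOn 𝓘(ℝ, V) (𝓘(ℝ, ℝ).prod 𝓘(ℝ, V)) ∞ (fun x : M => (t, x)) {p}ᶜ :=
      contMDiffOn_const.prodMk contMDiffOn_id
    exact (hg.contMDiffOn_transplant hr).comp h1 fun x hx => ⟨ht, hx⟩
  have hSp : Sᶜ ⊆ ({p}ᶜ : Set M) := compl_subset_compl.2 (singleton_subset_iff.2 hp)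
  refine ⟨c, hc, δ, hδ, D, fun t => transplant p φ t, hDs,
    fun t ht u hu => ⟨(hD t ht u hu).1, (hD t ht u hu).2.1⟩, fun t ht => ?_,
    hφ.contMDiffOn_transplant hr, fun t ht s v hsv =>
      ⟨(hθpol t ht s v hsv).1.trans_le (min_le_right _ _), (hθpol t ht s v hsv).2⟩⟩
  -- Smoothness is only known off `p`. Continuity at `p` comes from the linear bound on `D`, which
  -- agrees with `φ` near the origin.
  have hcp : ContinuousAt (transplant p φ t) p := by
    have h1 : ContinuousAt (fun u : V => if u = 0 then 0 else φ (t, u)) 0 := by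
      rw [Metric.continuousAt_iff]
      intro η hη
      refine ⟨min r₁ (η / (|m| + 1)), lt_min hr₁ (by positivity), fun {u} hu => ?_⟩
      rw [dist_zero_right] at hu
      by_cases hu0 : u = 0
      · simpa [hu0] using hη
      · have h2 := (hpol t ht 1 one_pos u hu0 (by
          rw [one_mul]; exact hu.trans_le (min_le_left _ _))).1
        rw [one_smul, one_smul] at h2
        simp only [hu0, if_true, if_false]
        rw [dist_zero_right, h2]
        calc ‖D (t, u)‖ ≤ m * ‖u‖ := (hD t ht u hu0).2.2.2
          _ ≤ (|m| + 1) * ‖u‖ := by gcongr; linarith [le_abs_self m]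
          _ < (|m| + 1) * (η / (|m| + 1)) := by
            gcongr; exact hu.trans_le (min_le_right _ _)
          _ = η := by field_simp
    have h2 : ContinuousAt (fun x : M => e x - e p) p :=
      (e.continuousAt (mem_chart_source V p)).sub continuousAt_const
    have h3 : ContinuousAt (fun x : M => e.symm (e p +
        (if e x - e p = 0 then 0 else φ (t, e x - e p)))) p := by
      have h4 : ContinuousAt (fun x : M => e p +
          (if e x - e p = 0 then 0 else φ (t, e x - e p))) p :=
        continuousAt_const.add (ContinuousAt.comp (f := fun x : M => e x - e p)
          (g := fun u : V => if u = 0 then 0 else φ (t, u)) (by simpa using h1) h2)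
      refine ContinuousAt.comp (g := e.symm) ?_ h4
      simpa using e.continuousAt_symm (mem_chart_target V p)
    refine h3.congr ?_
    filter_upwards [e.open_source.mem_nhds (mem_chart_source V p)] with x hx
    by_cases hxp : x = p
    · simp [hxp, transplant_self, he]
    · rw [transplant_of_mem hx hxp, if_neg (chart_sub_ne_zero hx hxp)]
  exact
    { continuous := by
        refine continuous_iff_continuousAt.2 fun x => ?_
        by_cases hxp : x = p
        · rw [hxp]; exact hcp
        · exact (hslice t ht φ hφ).continuousOn.continuousAt
            (isOpen_compl_singleton.mem_nhds hxp)
      smooth := (hslice t ht φ hφ).mono hSp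
      coneSmooth := fun p' hp' => by
        by_cases hne : p' = p
        · rw [hne]; exact (keyp t ht).1
        · exact (keyp' t ht p' hp' hne).1
      fix := hfix t ht φ hφ
      mapsTo := hmap1 t ht
      exists_inverse := ⟨transplant p ψ t, hmap2 t ht,
        ⟨fun x _ => hinv1 t ht x, fun x _ => hinv2 t ht x⟩, (hslice t ht ψ hψ).mono hSp⟩
      coneDeriv_ne_zero := fun p' hp' v hv => by
        by_cases hne : p' = p
        · subst hne
          rw [(keyp t ht).2 v hv]
          exact (hD t ht v hv).1
        · rw [(keyp' t ht p' hp' hne).2 v hv]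
          exact hv
      exists_coneDeriv_inverse := fun p' hp' => by
        by_cases hne : p' = p
        · subst hne
          -- The cone-derivative at `p` is `D t`, whose inverse is `c⁻¹ • C t`.
          have hCne : ∀ v : V, v ≠ 0 → c⁻¹ • C (t, v) ≠ 0 := fun v hv =>
            smul_ne_zero (inv_ne_zero hc.ne') (hC.ne_zero t ht v hv)
          refine ⟨fun u => c⁻¹ • C (t, u), fun u hu => hCne u hu,
            ⟨fun v hv => ?_, fun v hv => ?_⟩, contDiffOn_const.smul (hC1 t ht)⟩
          · rw [(keyp t ht).2 v hv]
            simp only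
            rw [(hD t ht v hv).2.1, smul_smul, inv_mul_cancel₀ hc.ne', one_smul]
          · rw [(keyp t ht).2 _ (hCne v hv)]
            exact (hD t ht v hv).2.2.1
        · exact ⟨id, mapsTo_id _, ⟨fun v hv => (keyp' t ht p' hp' hne).2 v hv,
            fun v hv => (keyp' t ht p' hp' hne).2 v hv⟩, contDiffOn_id⟩ }

end Families

/-! ### Regularity at cone points with linear tangent cones -/

section ConePoint

/-- Once the coordinates of `p` are translated to the origin, the constant and linear terms are
jointly smooth in `(t, y)` and the remainder is quadratic in the radius. -/
theorem isC11At_of_polar_expansion {V : Type} [NormedAddCommGroup V] [NormedSpace ℝ V]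
    [FiniteDimensional ℝ V] [Nontrivial V] {M : Type*} [TopologicalSpace M] [ChartedSpace V M]
    {W : Type*} [NormedAddCommGroup W] [NormedSpace ℝ W] {N : Type*} [TopologicalSpace N]
    [ChartedSpace W N] {Φ : ℝ → M → N} {p : M} {q : N} {t₀ : ℝ}
    (hq : Φ t₀ p = q) {δ : ℝ} (hδ : 0 < δ)
    (hball : Metric.ball (chartAt V p p) δ ⊆ (chartAt V p).target) {B : ℝ → V →L[ℝ] W}
    (hB : ContDiffOn ℝ ∞ B (Icc 0 1)) {k : ℝ × ℝ × V → W}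
    (hk : ContDiffOn ℝ ∞ k (Icc 0 1 ×ˢ polarDomain V δ))
    (hexp : ∀ t ∈ Icc (0 : ℝ) 1, ∀ s v, (s, v) ∈ polarDomain V δ →
      Φ t (polar p s v) ∈ (chartAt W q).source ∧
      chartAt W q (Φ t (polar p s v)) = chartAt W q q + s • B t v + s ^ 2 • k (t, s, v)) :
    IsC11At V W Φ t₀ p := by
  subst hq
  have hr : 0 < δ / 2 := half_pos hδ
  set P := chartAt V p p with hP
  set Q : Set (ℝ × V) := (Icc 0 1 ∩ Metric.ball t₀ (δ / 2)) ×ˢ Metric.ball (0 : V) (δ / 2) with hQ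
  set F := localFamily V W Φ t₀ p with hF
  set f : ℝ × V → W := fun z => F (z + (0, P)) with hf
  have hQu : UniqueDiffOn ℝ Q :=
    ((uniqueDiffOn_Icc zero_lt_one).inter Metric.isOpen_ball).prod Metric.isOpen_ball.uniqueDiffOn
  have hb : ContDiffOn ℝ ∞ (fun z : ℝ × V => chartAt W (Φ t₀ p) (Φ t₀ p) + B z.1 z.2)
      (Icc (0 : ℝ) 1 ×ˢ univ) :=
    contDiffOn_const.add ((hB.comp contDiffOn_fst fun z hz => hz.1).clm_apply contDiffOn_snd)
  obtain ⟨h1, K, hK⟩ := exists_contDiffOn_one_lipschitz_fderivWithin hr (half_lt_self hδ) hk hb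
    (f := f) (fun t ht s v hsv => by
      have h2 := (hexp t ht s v hsv).2
      simp only [hf, hF, localFamily, Prod.mk_add_mk, add_zero, map_smul]
      rw [add_comm (s • v)]
      exact h2) hQu (prod_mono_left inter_subset_left)
  have hmem : ∀ z : ℝ × V, z ∈ localDomain V t₀ p (δ / 2) → z - (0, P) ∈ Q := by
    rintro ⟨t, y⟩ ⟨ht, hy⟩
    refine ⟨by simpa using ht, ?_⟩
    simp only [Prod.snd_sub, Metric.mem_ball, dist_zero_right]
    rwa [Metric.mem_ball, dist_eq_norm] at hy
  have hFf : F = fun z => f (z - (0, P)) := by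
    funext z
    simp [hf]
  have hder : ∀ z ∈ localDomain V t₀ p (δ / 2),
      fderivWithin ℝ F (localDomain V t₀ p (δ / 2)) z = fderivWithin ℝ f Q (z - (0, P)) := by
    intro z hz
    have h2 := (h1.differentiableOn (by simp) _ (hmem z hz)).hasFDerivWithinAt
    have h3 := h2.comp z ((hasFDerivWithinAt_id z _).sub_const ((0 : ℝ), P)) hmem
    rw [hFf]
    exact h3.fderivWithin (uniqueDiffOn_localDomain p _ z hz)
  refine ⟨δ / 2, hr, (Metric.ball_subset_ball (half_le_self hδ.le)).trans hball, ?_, ?_, K, ?_⟩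
  · rintro ⟨t, y⟩ ⟨ht, hy⟩
    obtain ⟨v, hv, hvy⟩ := exists_unit_smul_eq (y - P)
    have hv0 : v ≠ 0 := by
      rintro rfl
      simp at hv
    have h2 := (hexp t ht.1 ‖y - P‖ v ⟨norm_nonneg _, hv0, by
      simp only [hv, mul_one]
      rw [← dist_eq_norm]
      exact (Metric.mem_ball.1 hy).trans (half_lt_self hδ)⟩).1
    rw [polar, hvy, add_sub_cancel] at h2
    exact h2
  · rw [← hF, hFf]
    exact h1.comp (ContDiff.contDiffOn (by fun_prop)) hmem
  · intro z hz z' hz'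
    rw [hder z hz, hder z' hz']
    refine (hK (hmem z hz) (hmem z' hz')).trans_eq ?_
    rw [edist_sub_right]

variable {V : Type} [NormedAddCommGroup V] [InnerProductSpace ℝ V] [FiniteDimensional ℝ V]
  [Nontrivial V] {M : Type*} [TopologicalSpace M] [ChartedSpace V M] [IsManifold 𝓘(ℝ, V) ∞ M]
  {W : Type*} [NormedAddCommGroup W] [NormedSpace ℝ W] [FiniteDimensional ℝ W]
  {N : Type*} [TopologicalSpace N] [ChartedSpace W N] [IsManifold 𝓘(ℝ, W) ∞ N]

/-- A family of cone-immersions whose tangent cones at a cone point are linear has a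
reparametrization that is of class `C^{1,1}` there. -/
theorem exists_c11_reparametrization [T2Space M] {S : Set M} (hS : S.Finite) {φ : M → M}
    (hφ : IsConeDiffeo V S φ) {p : M} (hp : p ∈ S) {Ψ : ℝ → M → N} {q : N}
    (hq : ∀ t ∈ Icc (0 : ℝ) 1, Ψ t p = q) (hΨ : IsConeSmoothFamily V W S Ψ)
    (hinj : ∀ t ∈ Icc (0 : ℝ) 1, ∀ v : V, v ≠ 0 →
      Function.Injective (blowupDeriv V W (Ψ t) p v))
    (hlin : ∀ t ∈ Icc (0 : ℝ) 1, ∃ P : Submodule ℝ W,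
      range (coneDeriv V W (Ψ t) p : V → W) = (P : Set W))
    (hf : ContMDiffAt 𝓘(ℝ, V) 𝓘(ℝ, W) ∞ (fun x => Ψ 0 (φ x)) p) :
    ∃ Φ : ℝ → M → N, (∀ t ∈ Icc (0 : ℝ) 1, Φ t ∈ coneOrbit V S (Ψ t)) ∧
      (∀ t ∈ Icc (0 : ℝ) 1, ∀ x ∈ S, Φ t x = Ψ t x) ∧
      ∀ t ∈ Icc (0 : ℝ) 1, ∀ x, (x ∈ S → x = p) → IsC11At V W Φ t x := by
  obtain ⟨δ, hδ, hball, B, C, k, hB, hC, hk, hexp⟩ :=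
    exists_linear_polar_expansion hφ hp hq hΨ hinj hlin hf
  obtain ⟨c, hc, δ', hδ', D, θ, hD, hCD, hθ, hθs, hpol⟩ := hC.exists_coneDiffeo hS hp hδ
  refine ⟨fun t x => Ψ t (φ (θ t x)), fun t ht => ⟨φ ∘ θ t, hφ.comp (hθ t ht), rfl⟩,
    fun t ht x hx => by simp only [(hθ t ht).fix x hx, hφ.fix x hx], fun t ht x hx => ?_⟩
  by_cases hxS : x ∈ S
  · obtain rfl := hx hxS
    have hsub : polarDomain V (min δ δ') ⊆ polarDomain V δ' :=
      fun z hz => ⟨hz.1, hz.2.1, hz.2.2.trans_le (min_le_right _ _)⟩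
    have hmem : ∀ t ∈ Icc (0 : ℝ) 1, ∀ s v, (s, v) ∈ polarDomain V (min δ δ') →
        (s, D (t, v)) ∈ polarDomain V δ := fun t ht s v hsv =>
      ⟨hsv.1, (hCD t ht v hsv.2.1).1, (hpol t ht s v (hsub hsv)).1⟩
    -- The identity `C (t, D (t, v)) = c • v` turns the homogeneous first order term into the linear
    -- map `c • B t`. The remainder stays smooth on the blowup, since only its direction variable is
    -- changed by `D`.
    refine isC11At_of_polar_expansion (q := q) (B := fun t => c • B t)
      (k := fun z => k (z.1, z.2.1, D (z.1, z.2.2))) ?_ (lt_min hδ hδ')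
      ((Metric.ball_subset_ball (min_le_left _ _)).trans hball) (hB.const_smul c) ?_ ?_
    · rw [(hθ t ht).fix x hxS, hφ.fix x hxS, hq t ht]
    · refine hk.comp (f := fun z : ℝ × ℝ × V => ((z.1, z.2.1, D (z.1, z.2.2)) : ℝ × ℝ × V)) ?_
        fun z hz => ⟨hz.1, hmem z.1 hz.1 z.2.1 z.2.2 hz.2⟩
      refine contDiffOn_fst.prodMk (ContDiffOn.prodMk (ContDiff.contDiffOn (by fun_prop)) ?_)
      exact hD.comp (f := fun z : ℝ × ℝ × V => (z.1, z.2.2)) (ContDiff.contDiffOn (by fun_prop))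
        fun z hz => ⟨hz.1, hz.2.2.1⟩
    · intro t ht s v hsv
      have h1 := hexp t ht s _ (hmem t ht s v hsv)
      rw [← (hpol t ht s v (hsub hsv)).2, (hCD t ht v hsv.2.1).2, map_smul] at h1
      exact h1
  · have hSo : IsOpen Sᶜ := hS.isClosed.isOpen_compl
    refine isC11At_of_contMDiffOn hSo ?_ ht hxS
    have h1 : ContMDiffOn (𝓘(ℝ, ℝ).prod 𝓘(ℝ, V)) 𝓘(ℝ, V) ∞ (fun z : ℝ × M => φ (θ z.1 z.2))
        (Icc 0 1 ×ˢ Sᶜ) := by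
      refine hφ.smooth.comp (hθs.mono (prod_mono_right ?_)) fun z hz => (hθ z.1 hz.1).mapsTo hz.2
      exact compl_subset_compl.2 (singleton_subset_iff.2 hp)
    have h2 : ContMDiffOn (𝓘(ℝ, ℝ).prod 𝓘(ℝ, V)) 𝓘(ℝ, ℝ) ∞ (fun z : ℝ × M => z.1)
        (Icc 0 1 ×ˢ Sᶜ) := contMDiffOn_fst
    exact hΨ.smooth.comp (h2.prodMk h1)
      fun z hz => ⟨hz.1, hφ.mapsTo ((hθ z.1 hz.1).mapsTo hz.2)⟩

end ConePoint

/-! ### Linear algebra of positive Lagrangian subspaces -/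

section LinearAlgebra

theorem alternating_two_add {G : Type*} [NormedAddCommGroup G] [NormedSpace ℝ G]
    (σ : G [⋀^Fin 2]→L[ℝ] ℝ) (a b c : G) : σ ![a + b, c] = σ ![a, c] + σ ![b, c] :=
  σ.toAlternatingMap.map_vecCons_add ![c] a b

theorem alternating_two_swap {G : Type*} [NormedAddCommGroup G] [NormedSpace ℝ G]
    (σ : G [⋀^Fin 2]→L[ℝ] ℝ) (a b : G) : σ ![a, b] = -σ ![b, a] := by
  have h := σ.toAlternatingMap.map_swap ![b, a] (i := 0) (j := 1) (by decide)
  have h2 : (![b, a] : Fin 2 → G) ∘ ⇑(Equiv.swap (0 : Fin 2) 1) = ![a, b] := by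
    funext i; fin_cases i <;> simp
  rw [h2] at h
  exact h

variable {V : Type*} [NormedAddCommGroup V] [NormedSpace ℝ V] [FiniteDimensional ℝ V]
  {E : Type*} [NormedAddCommGroup E] [NormedSpace ℂ E] [FiniteDimensional ℂ E]

/-- A Lagrangian subspace is its own symplectic complement. -/
theorem exists_eq_of_isotropic {σ : E [⋀^Fin 2]→L[ℝ] ℝ}
    (hσ : ∀ u : E, u ≠ 0 → 0 < σ ![u, Complex.I • u]) {A : V →L[ℝ] E}
    (hd : Module.finrank ℂ E = Module.finrank ℝ V) (hA : Function.Injective A)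
    (hiso : ∀ u v, σ ![A u, A v] = 0) {ξ : E} (hξ : ∀ v, σ ![ξ, A v] = 0) : ∃ u, A u = ξ := by
  have : FiniteDimensional ℝ E := FiniteDimensional.complexToReal E
  -- The image of `A` and its rotation by `i` span `E`: they are independent by positivity of `σ`,
  -- and the dimensions add up. Pairing with `A v` then kills the rotated component of `ξ`.
  set T : V × V →ₗ[ℝ] E := LinearMap.coprod (A : V →ₗ[ℝ] E)
    ((LinearMap.lsmul ℂ E Complex.I).restrictScalars ℝ ∘ₗ (A : V →ₗ[ℝ] E)) with hT
  have hTa : ∀ u v, T (u, v) = A u + Complex.I • A v := fun u v => by simp [hT]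
  have hker : ∀ u v, σ ![A u + Complex.I • A v, A v] = 0 → v = 0 := by
    intro u v h
    rw [alternating_two_add, hiso, zero_add, alternating_two_swap, neg_eq_zero] at h
    by_contra hv
    exact (hσ (A v) fun h0 => hv (hA (by rw [h0, map_zero]))).ne' h
  have hTi : Function.Injective T := by
    rw [← LinearMap.ker_eq_bot, LinearMap.ker_eq_bot']
    rintro ⟨u, v⟩ h
    rw [hTa] at h
    have hv : v = 0 := by
      refine hker u v ?_
      rw [h]
      have := hiso 0 v
      rwa [map_zero] at this
    rw [hv, map_zero, smul_zero, add_zero] at h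
    rw [hv, hA (h.trans (map_zero A).symm)]
    rfl
  have hTs : Function.Surjective T := by
    refine (LinearMap.injective_iff_surjective_of_finrank_eq_finrank ?_).1 hTi
    rw [Module.finrank_prod, finrank_real_of_complex, hd, two_mul]
  obtain ⟨⟨u, v⟩, h⟩ := hTs ξ
  rw [hTa] at h
  have hv := hker u v (by rw [h]; exact hξ v)
  refine ⟨u, ?_⟩
  rw [← h, hv, map_zero, smul_zero, add_zero]

/-- Every nonzero vector is part of a positive frame, up to a real multiple. -/
theorem exists_update_pos {V : Type*} [NormedAddCommGroup V] [NormedSpace ℝ V] {n : ℕ}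
    (b : Module.Basis (Fin n) ℝ V) {o : V [⋀^Fin n]→L[ℝ] ℝ} (ho : o ≠ 0) {u : V} (hu : u ≠ 0) :
    ∃ (w : Fin n → V) (i : Fin n) (c : ℝ), 0 < o (Function.update w i (c • u)) := by
  have hb : o b ≠ 0 := by
    refine (AlternatingMap.map_basis_ne_zero_iff b o.toAlternatingMap).2 fun h => ho ?_
    exact ContinuousAlternatingMap.toAlternatingMap_injective h
  obtain ⟨i, hi⟩ : ∃ i, b.repr u i ≠ 0 := by
    by_contra! h
    exact hu (b.repr.map_eq_zero_iff.1 (Finsupp.ext h))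
  have h1 : o (Function.update b i u) = b.repr u i * o b := by
    have h2 := o.toAlternatingMap.map_update_sum Finset.univ i (fun j => b.repr u j • b j) b
    rw [b.sum_repr u, Finset.sum_eq_single i] at h2
    · rw [AlternatingMap.map_update_smul, Function.update_eq_self] at h2
      exact h2
    · intro j _ hj
      rw [AlternatingMap.map_update_smul, AlternatingMap.map_update_self _ _ hj.symm, smul_zero]
    · simp
  -- Replacing the `i`-th basis vector by `u` multiplies `o b` by the `i`-th coordinate of `u`.
  -- Scaling by this same product makes the value a square.
  refine ⟨b, i, b.repr u i * o b, ?_⟩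
  rw [ContinuousAlternatingMap.map_update_smul, h1, smul_eq_mul]
  exact mul_self_pos.2 (mul_ne_zero hi hb)

/-- A nonzero `u` could be completed, up to a scalar, to a positive frame, on which the real part of
`R` would be both positive and zero. -/
theorem eq_zero_of_contraction_eq_zero {V : Type*} [NormedAddCommGroup V] [NormedSpace ℝ V]
    {E : Type*} [NormedAddCommGroup E] [NormedSpace ℂ E] {n : ℕ} (b : Module.Basis (Fin n) ℝ V)
    {o : V [⋀^Fin n]→L[ℝ] ℝ} (ho : o ≠ 0) {A : V →L[ℝ] E} {R : E [⋀^Fin n]→L[ℂ] ℂ}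
    (hpos : ∀ w, 0 < o w → 0 < (R fun i => A (w i)).re) {u : V}
    (hu : ∀ (w : Fin n → V) (i : Fin n), (R (Function.update (fun j => A (w j)) i (A u))).re = 0) :
    u = 0 := by
  by_contra hne
  obtain ⟨w, i, c, hw⟩ := exists_update_pos b ho hne
  have h1 := hpos _ hw
  have h3 : (fun j => A (Function.update w i (c • u) j)) =
      Function.update (fun j => A (w j)) i ((c : ℂ) • A u) := by
    funext j
    by_cases hj : j = i
    · subst hj
      simp
    · simp [Function.update_of_ne hj]
  rw [h3, ContinuousAlternatingMap.map_update_smul, smul_eq_mul, Complex.re_ofReal_mul, hu,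
    mul_zero] at h1
  exact lt_irrefl _ h1

end LinearAlgebra

/-! ### Curves and families in charts -/

section Curves

variable {V : Type} [NormedAddCommGroup V] [NormedSpace ℝ V]
  {M : Type*} [TopologicalSpace M] [ChartedSpace V M]
  {W : Type*} [NormedAddCommGroup W] [NormedSpace ℝ W]
  {N : Type*} [TopologicalSpace N] [ChartedSpace W N]

theorem eq_of_continuousOn_of_finite [T2Space N] {c : ℝ → N} (hc : ContinuousOn c (Icc 0 1))
    {F : Set N} (hF : F.Finite) (hcF : MapsTo c (Icc 0 1) F) {s t : ℝ} (hs : s ∈ Icc (0 : ℝ) 1)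
    (ht : t ∈ Icc (0 : ℝ) 1) : c s = c t := by
  have h1 : IsPreconnected (c '' Icc 0 1) := isPreconnected_Icc.image c hc
  by_contra hne
  exact h1.infinite_of_nontrivial ⟨_, mem_image_of_mem c hs, _, mem_image_of_mem c ht, hne⟩
    (hF.subset hcF.image_subset)

/-- A curve with vanishing velocity is constant. -/
theorem eq_of_mfderivWithin_eq_zero [T2Space N] [IsManifold 𝓘(ℝ, W) ∞ N] {c : ℝ → N}
    (hc : ContMDiffOn 𝓘(ℝ, ℝ) 𝓘(ℝ, W) ∞ c (Icc 0 1))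
    (h0 : ∀ t ∈ Icc (0 : ℝ) 1, (mfderivWithin 𝓘(ℝ, ℝ) 𝓘(ℝ, W) c (Icc 0 1) t (1 : ℝ) : W) = 0)
    {t : ℝ} (ht : t ∈ Icc (0 : ℝ) 1) : c t = c 0 := by
  have hcl : IsClosed ({t | c t = c 0} ∩ Icc (0 : ℝ) 1) := by
    have := hc.continuousOn.preimage_isClosed_of_isClosed isClosed_Icc
      (isClosed_singleton (x := c 0))
    rwa [inter_comm] at this
  -- Continuous induction on the interval: within the chart around `c x` the curve has zero
  -- derivative, so it stays constant a little to the right of `x`.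
  refine hcl.Icc_subset_of_forall_mem_nhdsWithin rfl ?_ ht
  rintro x ⟨hx : c x = c 0, hx1⟩
  set e := chartAt W (c x) with he
  have hev : ∀ᶠ τ in 𝓝[Icc 0 1] x, c τ ∈ e.source :=
    (hc.continuousOn x (Ico_subset_Icc_self hx1)).eventually_mem
      (e.open_source.mem_nhds (mem_chart_source W _))
  obtain ⟨η, hη, hs⟩ := Metric.mem_nhdsWithin_iff.1 hev
  set y := min (x + η / 2) 1 with hy
  have hxy : x < y := lt_min (by linarith) hx1.2
  have hsub : Icc x y ⊆ Icc 0 1 := Icc_subset_Icc hx1.1 (min_le_right _ _)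
  have hsrc : ∀ τ ∈ Icc x y, c τ ∈ e.source := by
    intro τ hτ
    refine hs ⟨?_, hsub hτ⟩
    have h1 := hτ.2.trans (min_le_left _ _)
    rw [Metric.mem_ball, Real.dist_eq, abs_of_nonneg (sub_nonneg.2 hτ.1)]
    linarith
  have hder : ∀ τ ∈ Icc x y, HasDerivWithinAt (fun τ => e (c τ)) 0 (Icc 0 1) τ := by
    intro τ hτ
    have h1 := ((hc τ (hsub hτ)).mdifferentiableWithinAt (by simp)).hasMFDerivWithinAt
    have h2 : MDifferentiableAt 𝓘(ℝ, W) 𝓘(ℝ, W) e (c τ) :=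
      ((contMDiffOn_chart (I := 𝓘(ℝ, W)) (n := ∞) (x := c x)).contMDiffAt
        (e.open_source.mem_nhds (hsrc τ hτ))).mdifferentiableAt (by simp)
    have h3 := (h2.hasMFDerivAt.comp_hasMFDerivWithinAt τ h1).hasFDerivWithinAt
    obtain ⟨A, hA⟩ : ∃ A : W →L[ℝ] W, mfderiv 𝓘(ℝ, W) 𝓘(ℝ, W) e (c τ) = A := ⟨_, rfl⟩
    obtain ⟨B, hB⟩ : ∃ B : ℝ →L[ℝ] W, mfderivWithin 𝓘(ℝ, ℝ) 𝓘(ℝ, W) c (Icc 0 1) τ = B := ⟨_, rfl⟩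
    rw [hA, hB] at h3
    have hB1 : B 1 = 0 := by rw [← hB]; exact h0 τ (hsub hτ)
    have h4 : HasFDerivWithinAt (fun τ => e (c τ)) (A.comp B) (Icc 0 1) τ := h3
    simpa [hB1] using h4.hasDerivWithinAt
  have hconst := constant_of_derivWithin_zero (f := fun τ => e (c τ)) (a := x) (b := y)
    (fun τ hτ => ((hder τ hτ).mono hsub).differentiableWithinAt)
    (fun τ hτ => ((hder τ (Ico_subset_Icc_self hτ)).mono hsub).derivWithin
      (uniqueDiffOn_Icc hxy τ (Ico_subset_Icc_self hτ)))
  filter_upwards [Ioo_mem_nhdsGT hxy] with τ hτ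
  have hτ' := Ioo_subset_Icc_self hτ
  exact (e.injOn (hsrc τ hτ') (hsrc x (left_mem_Icc.2 hxy.le)) (hconst τ hτ')).trans hx

theorem mfderiv_eq_of_hasFDerivAt {f : M → N} {x : M} {d : V →L[ℝ] W} (hc : ContinuousAt f x)
    (hd : HasFDerivAt (fun y => chartAt W (f x) (f ((chartAt V x).symm y))) d (chartAt V x x)) :
    mfderiv 𝓘(ℝ, V) 𝓘(ℝ, W) f x = d := by
  have h : HasMFDerivAt 𝓘(ℝ, V) 𝓘(ℝ, W) f x d := by
    refine ⟨hc, ?_⟩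
    simp only [writtenInExtChartAt, modelWithCornersSelf_coe, range_id]
    exact hd.hasFDerivWithinAt
  exact h.mfderiv

/-- If the velocity is transverse to the image, then the point of intersection is isolated. -/
theorem eventually_ne_of_transverse [FiniteDimensional ℝ V] [IsManifold 𝓘(ℝ, V) ∞ M]
    [IsManifold 𝓘(ℝ, W) ∞ N] {Ψ : ℝ → M → N} {O : Set M} (hO : IsOpen O)
    (hΨ : ContMDiffOn (𝓘(ℝ, ℝ).prod 𝓘(ℝ, V)) 𝓘(ℝ, W) ∞ (fun z : ℝ × M => Ψ z.1 z.2)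
      (Icc 0 1 ×ˢ O)) {t : ℝ} (ht : t ∈ Icc (0 : ℝ) 1) {x : M} (hx : x ∈ O)
    (hinj : Function.Injective (mfderiv 𝓘(ℝ, V) 𝓘(ℝ, W) (Ψ t) x : V → W))
    (htr : ∀ v : V, (mfderiv 𝓘(ℝ, V) 𝓘(ℝ, W) (Ψ t) x : V →L[ℝ] W) v ≠ timeDeriv W Ψ t x) :
    ∀ᶠ z in 𝓝[≠] (t, x), z.1 ∈ Icc (0 : ℝ) 1 → Ψ z.1 z.2 ≠ Ψ t x := by
  set e := chartAt V x with he
  set q := Ψ t x with hqdef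
  set T : Set V := e.target ∩ e.symm ⁻¹' O with hT
  have hTo : IsOpen T := e.isOpen_inter_preimage_symm hO
  have hex : e.symm (e x) = x := e.left_inv (mem_chart_source V x)
  have hxT : e x ∈ T := ⟨mem_chart_target V x, by rw [mem_preimage, hex]; exact hx⟩
  set G : ℝ × V → N := fun z => Ψ z.1 (e.symm z.2) with hG
  have hGs : ContMDiffOn 𝓘(ℝ, ℝ × V) 𝓘(ℝ, W) ∞ G (Icc 0 1 ×ˢ T) := by
    have h1 : ContMDiffOn 𝓘(ℝ, ℝ × V) 𝓘(ℝ, ℝ) ∞ (fun z : ℝ × V => z.1) (Icc 0 1 ×ˢ T) :=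
      contDiffOn_fst.contMDiffOn
    have h2 : ContMDiffOn 𝓘(ℝ, ℝ × V) 𝓘(ℝ, V) ∞ (fun z : ℝ × V => z.2) (Icc 0 1 ×ˢ T) :=
      contDiffOn_snd.contMDiffOn
    have h3 : ContMDiffOn 𝓘(ℝ, V) 𝓘(ℝ, V) ∞ e.symm e.target := contMDiffOn_chart_symm
    exact hΨ.comp (h1.prodMk (h3.comp h2 fun z hz => hz.2.1)) fun z hz => ⟨hz.1, hz.2.2⟩
  have hGx : G (t, e x) = q := by simp only [hG, hex, hqdef]
  have hmem : (t, e x) ∈ Icc (0 : ℝ) 1 ×ˢ T := ⟨ht, hxT⟩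
  have hfd : DifferentiableWithinAt ℝ (fun z => chartAt W q (G z)) (Icc 0 1 ×ˢ T) (t, e x) := by
    have h1 : ContMDiffWithinAt 𝓘(ℝ, W) 𝓘(ℝ, W) ∞ (chartAt W q) (chartAt W q).source q :=
      contMDiffOn_chart q (mem_chart_source W q)
    have h2 : ContMDiffAt 𝓘(ℝ, W) 𝓘(ℝ, W) ∞ (chartAt W q) (G (t, e x)) := by
      rw [hGx]
      exact h1.contMDiffAt ((chartAt W q).open_source.mem_nhds (mem_chart_source W q))
    exact (h2.comp_contMDiffWithinAt _ (hGs _ hmem)).contDiffWithinAt.differentiableWithinAt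
      (by simp)
  set D := fderivWithin ℝ (fun z => chartAt W q (G z)) (Icc 0 1 ×ˢ T) (t, e x) with hD
  have hDf : HasFDerivWithinAt (fun z => chartAt W q (G z)) D (Icc 0 1 ×ˢ T) (t, e x) :=
    hfd.hasFDerivWithinAt
  obtain ⟨A, hA⟩ : ∃ A : V →L[ℝ] W, mfderiv 𝓘(ℝ, V) 𝓘(ℝ, W) (Ψ t) x = A := ⟨_, rfl⟩
  have hinjA : Function.Injective A := by rw [← hA]; exact hinj
  have htrA : ∀ v : V, A v ≠ timeDeriv W Ψ t x := by rw [← hA]; exact htr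
  have hspace : A = D.comp (ContinuousLinearMap.inr ℝ ℝ V) := by
    rw [← hA]
    refine mfderiv_eq_of_hasFDerivAt ?_ ?_
    · have h1 : ContinuousOn (fun y => Ψ t y) O :=
        hΨ.continuousOn.comp (f := fun y : M => (t, y)) (by fun_prop) fun y hy => ⟨ht, hy⟩
      exact h1.continuousAt (hO.mem_nhds hx)
    · have h2 : HasFDerivWithinAt (fun y : V => (t, y)) (ContinuousLinearMap.inr ℝ ℝ V) T (e x) :=
        (hasFDerivAt_prodMk_right t (e x)).hasFDerivWithinAt
      exact (hDf.comp (e x) h2 fun y hy => ⟨ht, hy⟩).hasFDerivAt (hTo.mem_nhds hxT)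
  have htime : (timeDeriv W Ψ t x : W) = D (1, 0) := by
    have h2 : HasFDerivWithinAt (fun τ : ℝ => (τ, e x)) (ContinuousLinearMap.inl ℝ ℝ V)
        (Icc 0 1) t := (hasFDerivAt_prodMk_left t (e x)).hasFDerivWithinAt
    have hmaps : MapsTo (fun τ : ℝ => (τ, e x)) (Icc 0 1) (Icc 0 1 ×ˢ T) := fun τ hτ => ⟨hτ, hxT⟩
    have h3 := hDf.comp t h2 hmaps
    have h4 : mfderivWithin 𝓘(ℝ, ℝ) 𝓘(ℝ, W) (fun τ => Ψ τ x) (Icc 0 1) t =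
        D.comp (ContinuousLinearMap.inl ℝ ℝ V) := by
      refine mfderivWithin_eq_of_hasFDerivWithinAt ?_ ?_ (uniqueDiffOn_Icc zero_lt_one t ht)
      · have h1 : ContinuousOn (fun τ => Ψ τ x) (Icc 0 1) :=
          hΨ.continuousOn.comp (f := fun τ : ℝ => (τ, x)) (by fun_prop) fun τ hτ => ⟨hτ, hx⟩
        exact h1 t ht
      · refine h3.congr (fun τ _ => ?_) ?_ <;>
          simp only [Function.comp_apply, hG, hex, hqdef]
    have h5 := congrArg (fun A : ℝ →L[ℝ] W => A 1) h4
    exact h5.trans (by simp)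
  -- Transversality says that `(t, x) ↦ Ψ t x` is itself immersive at the point. An injective
  -- derivative on a finite-dimensional space is bounded below, so the value `q` is not taken again
  -- nearby.
  have hDinj : Function.Injective D := by
    rw [injective_iff_map_eq_zero]
    rintro ⟨τ, v⟩ h
    have h1 : D (τ, v) = τ • D (1, 0) + D (0, v) := by
      rw [← map_smul, ← map_add]
      simp
    have h2 : ∀ w : V, D (0, w) = A w := fun w => by
      rw [hspace]; rfl
    rw [h1, h2] at h
    have hτ : τ = 0 := by
      by_contra hτ
      refine htrA (-τ⁻¹ • v) ?_
      rw [htime, map_smul, neg_smul, eq_neg_of_add_eq_zero_right h, smul_neg, neg_neg, smul_smul,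
        inv_mul_cancel₀ hτ, one_smul]
    rw [hτ, zero_smul, zero_add] at h
    rw [hτ, hinjA (h.trans (map_zero A).symm)]
    rfl
  have hanti : ∃ C, AntilipschitzWith C D := by
    obtain ⟨C, -, hC⟩ := D.toLinearMap.exists_antilipschitzWith (LinearMap.ker_eq_bot.2 hDinj)
    exact ⟨C, hC⟩
  have hne := hDf.eventually_ne (c := chartAt W q q) hanti
  rw [eventually_nhdsWithin_iff] at hne ⊢
  have hcont : ContinuousAt (fun z : ℝ × M => (z.1, e z.2)) (t, x) :=
    continuousAt_fst.prodMk ((e.continuousAt (mem_chart_source V x)).comp continuousAt_snd)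
  have h6 := hcont.eventually hne
  have h7 : ∀ᶠ z : ℝ × M in 𝓝 (t, x), z.2 ∈ e.source ∩ O :=
    continuousAt_snd.eventually_mem ((e.open_source.inter hO).mem_nhds ⟨mem_chart_source V x, hx⟩)
  filter_upwards [h6, h7] with z hz hzs hzne hzI hzq
  have h8 : e.symm (e z.2) = z.2 := e.left_inv hzs.1
  refine hz ⟨⟨hzI, e.map_source hzs.1, ?_⟩, ?_⟩ ?_
  · rw [mem_preimage, h8]
    exact hzs.2
  · intro h9
    have h10 := Prod.ext_iff.1 h9
    exact hzne (Prod.ext h10.1 (e.injOn hzs.1 (mem_chart_source V x) h10.2))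
  · simp only [hG, h8, hzq]

end Curves

/-! ### The critical locus of a geodesic -/

section CriticalLocus

variable {n : ℕ}
  {E : Type*} [NormedAddCommGroup E] [NormedSpace ℂ E]
  {X : Type*} [TopologicalSpace X] [ChartedSpace E X]
  {L : Type*} [TopologicalSpace L] [ChartedSpace (EuclideanSpace ℝ (Fin n)) L]
  {Y : CalabiYau n E X} {o : OrientationForm n L} {S : Finset L} {C₀ : Set X}

namespace PositiveGeodesic

/-- A horizontal velocity that is tangent to the Lagrangian vanishes. -/
theorem timeDeriv_eq_zero_of_tangent (Λ : PositiveGeodesic Y o S C₀) {t : ℝ}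
    (ht : t ∈ Icc (0 : ℝ) 1) {x : L} (hx : x ∉ S) {u : EuclideanSpace ℝ (Fin n)}
    (hu : (tangentMapAt n E (Λ.lift t) x u : E) = timeDeriv E Λ.lift t x) :
    (timeDeriv E Λ.lift t x : E) = 0 := by
  have hu0 : u = 0 := eq_zero_of_contraction_eq_zero (V := EuclideanSpace ℝ (Fin n)) (E := E)
    (EuclideanSpace.basisFun (Fin n) ℝ).toBasis (o.ne_zero x)
    (A := tangentMapAt n E (Λ.lift t) x) (R := Y.holVol (Λ.lift t x))
    ((Λ.positive t ht).smooth_locus x (by simpa using hx))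
    (fun w i => hu ▸ Λ.horizontal t ht x hx w i)
  exact hu.symm.trans (hu0 ▸ map_zero (tangentMapAt n E (Λ.lift t) x))

/-- At critical points of the Hamiltonian the velocity is tangent to the Lagrangian. -/
theorem exists_tangent_of_mfderiv_ham_eq_zero [FiniteDimensional ℂ E]
    (hE : Module.finrank ℂ E = n) (Λ : PositiveGeodesic Y o S C₀) {t : ℝ}
    (ht : t ∈ Icc (0 : ℝ) 1) {x : L} (hx : x ∉ S)
    (h0 : ∀ v : EuclideanSpace ℝ (Fin n),
      mfderiv 𝓘(ℝ, EuclideanSpace ℝ (Fin n)) 𝓘(ℝ, ℝ) Λ.ham x v = (0 : ℝ)) :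
    ∃ u : EuclideanSpace ℝ (Fin n),
      (tangentMapAt n E (Λ.lift t) x u : E) = timeDeriv E Λ.lift t x :=
  exists_eq_of_isotropic (V := EuclideanSpace ℝ (Fin n)) (E := E) (σ := Y.sympl (Λ.lift t x))
    (fun u hu => Y.sympl_positive (Λ.lift t x) u hu) (A := tangentMapAt n E (Λ.lift t) x)
    (by simp [hE]) ((Λ.coneImmersion t ht).immersive x (by simpa using hx))
    (Λ.lagrangian t ht x (by simpa using hx))
    (fun v => (Λ.deriv_eq t ht x hx v).trans (h0 v))

/-- The lifting is constant in time at the cone points. -/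
theorem lift_eq_of_mem [T2Space X] [NeZero n] (Λ : PositiveGeodesic Y o S C₀) {x : L} (hx : x ∈ S)
    {s t : ℝ} (hs : s ∈ Icc (0 : ℝ) 1) (ht : t ∈ Icc (0 : ℝ) 1) : Λ.lift s x = Λ.lift t x := by
  have : Nontrivial (EuclideanSpace ℝ (Fin n)) := inferInstance
  obtain ⟨v, hv⟩ := exists_ne (0 : EuclideanSpace ℝ (Fin n))
  obtain ⟨ε, hε, h⟩ := Λ.smoothFamily.coneSmooth x (by simpa using hx)
  have hC₀ : C₀.Finite := by
    rw [← Λ.coneLocus 0 ⟨le_rfl, zero_le_one⟩]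
    exact S.finite_toSet.image _
  have hcont : ContinuousOn (fun t => Λ.lift t x) (Icc 0 1) := by
    have h1 := h.continuousOn.comp (f := fun t : ℝ => (t, (0 : ℝ), v)) (s := Icc 0 1)
      (by fun_prop) fun t ht => ⟨ht, le_rfl, hv, by simpa using hε⟩
    simpa [Function.comp_def] using h1
  exact eq_of_continuousOn_of_finite hcont hC₀ (fun t ht => (Λ.coneLocus t ht).subset
    (mem_image_of_mem _ (by simpa using hx))) hs ht

variable [FiniteDimensional ℂ E] [T2Space X] [IsManifold 𝓘(ℂ, E) ω X]
  [IsManifold 𝓘(ℝ, EuclideanSpace ℝ (Fin n)) ∞ L]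

/-- Every point of the critical locus is the image of a single point for all times. -/
theorem exists_forall_lift_eq [T2Space L] [SecondCountableTopology L] [NeZero n]
    (hE : Module.finrank ℂ E = n)
    (Λ : PositiveGeodesic Y o S C₀) {q : X} (hq : q ∈ Λ.critLocus) :
    ∃ p : L, ∀ t ∈ Icc (0 : ℝ) 1, Λ.lift t p = q := by
  have hX : IsManifold 𝓘(ℝ, E) ∞ X := isManifold_real
  have hSo : IsOpen ((S : Set L)ᶜ) := S.finite_toSet.isClosed.isOpen_compl
  by_contra! hno
  set 𝒜 : Set (ℝ × L) := {z | z.1 ∈ Icc (0 : ℝ) 1 ∧ Λ.lift z.1 z.2 = q} with h𝒜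
  -- Every point of `𝒜` is isolated: it is not a cone point, as these are static, and its velocity
  -- is transverse, as otherwise it would be static too.
  have hiso : ∀ z ∈ 𝒜, 𝓝[≠] z ⊓ 𝓟 𝒜 = ⊥ := by
    rintro ⟨t, x⟩ ⟨ht, hxq⟩
    simp only at ht hxq
    have hxS : x ∉ S := by
      intro hx
      obtain ⟨s, hs, hsq⟩ := hno x
      exact hsq ((Λ.lift_eq_of_mem hx hs ht).trans hxq)
    have htr : ∀ v : EuclideanSpace ℝ (Fin n),
        (tangentMapAt n E (Λ.lift t) x v : E) ≠ timeDeriv E Λ.lift t x := by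
      intro v hv
      -- A tangent velocity pairs to zero with a Lagrangian tangent space, so `x` is a critical
      -- point of the Hamiltonian. This does not depend on time, so the velocity is tangent, and
      -- hence zero, at all times.
      have h0 : ∀ w : EuclideanSpace ℝ (Fin n),
          mfderiv 𝓘(ℝ, EuclideanSpace ℝ (Fin n)) 𝓘(ℝ, ℝ) Λ.ham x w = (0 : ℝ) := by
        intro w
        have h1 := Λ.deriv_eq t ht x hxS w
        rw [← hv] at h1
        exact h1.symm.trans (Λ.lagrangian t ht x (by simpa using hxS) v w)
      have hzero : ∀ s ∈ Icc (0 : ℝ) 1, (timeDeriv E Λ.lift s x : E) = 0 := by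
        intro s hs
        obtain ⟨u, hu⟩ := Λ.exists_tangent_of_mfderiv_ham_eq_zero hE hs hxS h0
        exact Λ.timeDeriv_eq_zero_of_tangent hs hxS hu
      have hcurve : ContMDiffOn 𝓘(ℝ, ℝ) 𝓘(ℝ, E) ∞ (fun s => Λ.lift s x) (Icc 0 1) := by
        have h1 : ContMDiffOn 𝓘(ℝ, ℝ) (𝓘(ℝ, ℝ).prod 𝓘(ℝ, EuclideanSpace ℝ (Fin n))) ∞
            (fun s : ℝ => (s, x)) (Icc 0 1) := contMDiffOn_id.prodMk contMDiffOn_const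
        exact Λ.smoothFamily.smooth.comp h1 fun s hs => ⟨hs, by simpa using hxS⟩
      have hconst : ∀ s ∈ Icc (0 : ℝ) 1, Λ.lift s x = Λ.lift 0 x := fun s hs =>
        eq_of_mfderivWithin_eq_zero hcurve hzero hs
      obtain ⟨s, hs, hsq⟩ := hno x
      exact hsq ((hconst s hs).trans ((hconst t ht).symm.trans hxq))
    have hev := eventually_ne_of_transverse hSo Λ.smoothFamily.smooth ht
      (show x ∈ (S : Set L)ᶜ by simpa using hxS)
      ((Λ.coneImmersion t ht).immersive x (by simpa using hxS)) htr
    rw [← disjoint_iff, disjoint_principal_right]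
    filter_upwards [hev] with z hz hzA
    exact hz hzA.1 (hzA.2.trans hxq.symm)
  -- A discrete subset of a second countable space is countable, but membership of `q` in the
  -- critical locus makes `𝒜` project onto the uncountable `[0, 1]`.
  have hdisc : DiscreteTopology 𝒜 := discreteTopology_subtype_iff.2 hiso
  have hcount : 𝒜.Countable := by
    have : Countable 𝒜 := countable_of_Lindelof_of_discrete
    exact countable_coe_iff.1 this
  have hIcc : Icc (0 : ℝ) 1 ⊆ Prod.fst '' 𝒜 := by
    intro t ht
    obtain ⟨x, hx⟩ := mem_iInter₂.1 hq t ht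
    exact ⟨(t, x), ⟨ht, hx⟩, rfl⟩
  have h1 := (hcount.image Prod.fst).mono hIcc
  exact absurd h1 (Cardinal.Real.Icc_countable_iff.not.2 (by norm_num))

end PositiveGeodesic

end CriticalLocus

/-! ### Regularity of geodesics -/

/-! ### Dimension zero. -/

section ZeroDimensional

variable {V : Type} [NormedAddCommGroup V] [NormedSpace ℝ V] [Subsingleton V]
  {M : Type*} [TopologicalSpace M] [ChartedSpace V M]
  {W : Type*} [NormedAddCommGroup W] [NormedSpace ℝ W] [Subsingleton W]
  {N : Type*} [TopologicalSpace N] [ChartedSpace W N]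

theorem subsingleton_of_connected_of_zero_dim (V : Type) [TopologicalSpace V] [Subsingleton V]
    {M : Type*} [TopologicalSpace M] [ChartedSpace V M] [ConnectedSpace M] : Subsingleton M := by
  have : DiscreteTopology M := by
    refine discreteTopology_iff_isOpen_singleton.2 fun x => ?_
    have h : (chartAt V x).source = {x} := by
      refine Subset.antisymm (fun y hy => ?_) (singleton_subset_iff.2 (mem_chart_source V x))
      exact (chartAt V x).injOn hy (mem_chart_source V x) (Subsingleton.elim _ _)
    rw [← h]
    exact (chartAt V x).open_source
  exact PreconnectedSpace.trivial_of_discrete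

theorem isC11At_of_zero_dim {Ψ : ℝ → M → N} {t : ℝ} {x : M}
    (h : ∀ s ∈ Icc (0 : ℝ) 1, Ψ s x = Ψ t x) : IsC11At V W Ψ t x := by
  refine ⟨1, one_pos, fun y _ => ?_, fun z hz => ?_, ?_, 0, fun z _ z' _ => ?_⟩
  · rw [Subsingleton.elim y (chartAt V x x)]
    exact mem_chart_target V x
  · rw [Subsingleton.elim z.2 (chartAt V x x), (chartAt V x).left_inv (mem_chart_source V x),
      h z.1 hz.1.1]
    exact mem_chart_source W _
  · exact contDiff_of_subsingleton.contDiffOn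
  · have : Subsingleton (ℝ × V →L[ℝ] W) :=
      ⟨fun A B => ContinuousLinearMap.ext fun v => Subsingleton.elim _ _⟩
    rw [Subsingleton.elim (fderivWithin ℝ (localFamily V W Ψ t x) (localDomain V t x 1) z)
      (fderivWithin ℝ (localFamily V W Ψ t x) (localDomain V t x 1) z'), edist_self]
    exact zero_le

end ZeroDimensional

namespace PositiveGeodesic

variable {n : ℕ}
  {E : Type*} [NormedAddCommGroup E] [NormedSpace ℂ E]
  {X : Type*} [TopologicalSpace X] [ChartedSpace E X]
  {L : Type*} [TopologicalSpace L] [ChartedSpace (EuclideanSpace ℝ (Fin n)) L]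
  [IsManifold 𝓘(ℝ, EuclideanSpace ℝ (Fin n)) ∞ L]
  {Y : CalabiYau n E X} {o : OrientationForm n L} {S : Finset L} {C₀ : Set X}

theorem lift_mem_submanifold (Λ : PositiveGeodesic Y o S C₀) (t : ℝ) :
    Λ.lift t ∈ Λ.submanifold t :=
  ⟨id, isConeDiffeo_id _, rfl⟩

theorem isC11At_lift [IsManifold 𝓘(ℂ, E) ω X] [T2Space L] (Λ : PositiveGeodesic Y o S C₀)
    {t : ℝ} (ht : t ∈ Icc (0 : ℝ) 1) {x : L} (hx : x ∉ S) :
    IsC11At (EuclideanSpace ℝ (Fin n)) E Λ.lift t x := by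
  have hX : IsManifold 𝓘(ℝ, E) ∞ X := isManifold_real
  exact isC11At_of_contMDiffOn S.finite_toSet.isClosed.isOpen_compl Λ.smoothFamily.smooth ht
    (show x ∈ (S : Set L)ᶜ by simpa using hx)

/-- The source is a single point. If it is a cone point, the fixed cone locus makes its image
constant in time, otherwise the lifting is smooth there. -/
theorem isC11Near_of_zero_dim [FiniteDimensional ℂ E] [IsManifold 𝓘(ℂ, E) ω X]
    {L : Type*} [TopologicalSpace L] [T2Space L] [ConnectedSpace L]
    [ChartedSpace (EuclideanSpace ℝ (Fin 0)) L] [IsManifold 𝓘(ℝ, EuclideanSpace ℝ (Fin 0)) ∞ L]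
    (hE : Module.finrank ℂ E = 0) {Y : CalabiYau 0 E X} {o : OrientationForm 0 L} {S : Finset L}
    (Λ : PositiveGeodesic Y o S C₀) (q : X) : Λ.IsC11Near q := by
  have : Subsingleton E := Module.finrank_zero_iff.1 hE
  have hL : Subsingleton L := subsingleton_of_connected_of_zero_dim (EuclideanSpace ℝ (Fin 0))
  refine ⟨univ, univ_mem, Λ.lift, fun t _ => Λ.lift_mem_submanifold t, fun t ht x _ => ?_⟩
  by_cases hx : x ∈ S
  · refine isC11At_of_zero_dim fun s hs => ?_
    have h1 : Λ.lift s x ∈ Λ.lift t '' (S : Set L) :=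
      ((Λ.coneLocus s hs).trans (Λ.coneLocus t ht).symm).subset
        (mem_image_of_mem _ (by simpa using hx))
    obtain ⟨y, -, hy⟩ := h1
    rw [← hy, Subsingleton.elim y x]
  · exact Λ.isC11At_lift ht hx

/-- A geodesic with linear tangent cones at a point of the critical locus is of class `C^{1,1}`
near that point. -/
theorem isC11Near_of_linear_tangentCone [FiniteDimensional ℂ E] [T2Space X]
    [IsManifold 𝓘(ℂ, E) ω X] [T2Space L] [NeZero n] (Λ : PositiveGeodesic Y o S C₀)
    (h₀ : IsSmoothlyEmbedded (EuclideanSpace ℝ (Fin n)) E (Λ.submanifold 0)) {q : X} {p : L}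
    (hp : ∀ t ∈ Icc (0 : ℝ) 1, Λ.lift t p = q)
    (hlin : ∀ t ∈ Icc (0 : ℝ) 1, ∃ P : Submodule ℝ (TangentSpace 𝓘(ℝ, E) (Λ.lift t p)),
      tangentCone (EuclideanSpace ℝ (Fin n)) E (Λ.lift t) p =
        (P : Set (TangentSpace 𝓘(ℝ, E) (Λ.lift t p)))) : Λ.IsC11Near q := by
  have hX : IsManifold 𝓘(ℝ, E) ∞ X := isManifold_real
  have : FiniteDimensional ℝ E := FiniteDimensional.complexToReal E
  have hz : (0 : ℝ) ∈ Icc (0 : ℝ) 1 := ⟨le_rfl, zero_le_one⟩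
  obtain ⟨f, ⟨φ, hφ, hfφ⟩, hf⟩ := h₀
  have hinj : Function.Injective (Λ.lift 0) := by
    have h1 : Function.Injective (Λ.lift 0 ∘ φ) := hfφ ▸ hf.isEmbedding.injective
    exact h1.of_comp_right hφ.surjective
  have hC₀ : C₀.Finite := by
    rw [← Λ.coneLocus 0 hz]
    exact S.finite_toSet.image _
  have hmem : ∀ t ∈ Icc (0 : ℝ) 1, ∀ x ∈ S, Λ.lift t x ∈ C₀ := fun t ht x hx =>
    (Λ.coneLocus t ht).subset (mem_image_of_mem _ (by simpa using hx))
  -- Cone points are static, so a cone point over `q` at any time lies over `q` at time `0`, where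
  -- the lifting is injective.
  have hfib : ∀ t ∈ Icc (0 : ℝ) 1, ∀ x ∈ S, Λ.lift t x = q → x = p := fun t ht x hx hxq =>
    hinj ((Λ.lift_eq_of_mem hx hz ht).trans (hxq.trans (hp 0 hz).symm))
  -- Values in this neighborhood exclude every cone point except possibly `p`, so regularity need
  -- not be arranged at the others.
  have hU : (C₀ \ {q})ᶜ ∈ 𝓝 q :=
    (hC₀.subset sdiff_subset).isClosed.isOpen_compl.mem_nhds (by simp)
  by_cases hpS : p ∈ S
  · obtain ⟨Φ, hΦ, hΦS, hC11⟩ := exists_c11_reparametrization S.finite_toSet hφ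
      (show p ∈ (S : Set L) by simpa using hpS) hp Λ.smoothFamily
      (fun t ht v hv => (Λ.coneImmersion t ht).coneImmersive p (by simpa using hpS) v hv) hlin
      (by
        have h1 : (fun x => Λ.lift 0 (φ x)) = f := hfφ.symm
        rw [h1]
        exact hf.contMDiff p)
    refine ⟨_, hU, Φ, hΦ, fun t ht x hx => hC11 t ht x fun hxS => ?_⟩
    rw [hΦS t ht x hxS] at hx
    by_contra hne
    exact hx ⟨hmem t ht x hxS, fun h => hne (hfib t ht x hxS h)⟩
  · refine ⟨_, hU, Λ.lift, fun t _ => Λ.lift_mem_submanifold t, fun t ht x hx =>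
      Λ.isC11At_lift ht fun hxS => ?_⟩
    exact hx ⟨hmem t ht x hxS, fun h => hpS (hfib t ht x hxS h ▸ hxS)⟩

end PositiveGeodesic

end PosLag

theorem lemma5p7 {n : ℕ}
    {E : Type*} [NormedAddCommGroup E] [NormedSpace ℂ E] [FiniteDimensional ℂ E]
    (hE : Module.finrank ℂ E = n)
    {X : Type*} [TopologicalSpace X] [T2Space X] [SecondCountableTopology X]
    [ChartedSpace E X] [IsManifold 𝓘(ℂ, E) ω X]
    {L : Type*} [TopologicalSpace L] [T2Space L] [SecondCountableTopology L] [ConnectedSpace L]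
    [ChartedSpace (EuclideanSpace ℝ (Fin n)) L]
    [IsManifold 𝓘(ℝ, EuclideanSpace ℝ (Fin n)) ∞ L]
    (Y : PosLag.CalabiYau n E X) (o : PosLag.OrientationForm n L) (S : Finset L) (C₀ : Set X)
    (Λ : PosLag.PositiveGeodesic Y o S C₀)
    (h₀ : PosLag.IsSmoothlyEmbedded (EuclideanSpace ℝ (Fin n)) E (Λ.submanifold 0))
    (h₁ : PosLag.IsSmoothlyEmbedded (EuclideanSpace ℝ (Fin n)) E (Λ.submanifold 1))
    (q : X) (hq : q ∈ Λ.critLocus)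
    (hlin : ∀ p : L, (∀ t ∈ Icc (0 : ℝ) 1, Λ.lift t p = q) → ∀ t ∈ Icc (0 : ℝ) 1,
      ∃ V : Submodule ℝ (TangentSpace 𝓘(ℝ, E) (Λ.lift t p)),
        PosLag.tangentCone (EuclideanSpace ℝ (Fin n)) E (Λ.lift t) p = (V : Set (TangentSpace 𝓘(ℝ, E) (Λ.lift t p)))) :
    Λ.IsC11Near q := by
  -- For `n = 0` there are no directions out of a point and the polar coordinate arguments have no
  -- content.
  rcases Nat.eq_zero_or_pos n with rfl | hn
  · exact Λ.isC11Near_of_zero_dim hE q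
  · have : NeZero n := ⟨hn.ne'⟩
    obtain ⟨p, hp⟩ := Λ.exists_forall_lift_eq hE hq
    exact Λ.isC11Near_of_linear_tangentCone h₀ hp (hlin p hp)
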